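/- Let $n \ge 10$ and let $C \in \mathbb{Z}[x_1,\dots,x_n]$ be a cubic form. Write $C(\mathbf{x})=\sum_{i,j,k=1}^n c_{ijk}x_ix_jx_k$ with coefficients $c_{ijk}\in\frac16\mathbb{Z}$ that are symmetric in $i,j,k$, and for $\mathbf{x}\in\mathbb{Z}^n$ let $r(\mathbf{x})$ be the rank over $\mathbb{Q}$ of the $n\times n$ matrix $M(\mathbf{x})$ with entries $M(\mathbf{x})_{jk}=\sum_{i=1}^n c_{ijk}x_i$. Assume that $C$ satisfies Davenport's Geometric Condition: for every integer $r$ with $0\le r\le n$ and every $\varepsilon>0$ there is a constant $K=K(C,r,\varepsilon)$ such that $$\#\{\mathbf{x}\in\mathbb{Z}^n : \max_i|x_i|\le P,\ r(\mathbf{x})=r\}\le K\,P^{r+\varepsilon}\qquad\text{for all real } P\ge 1.$$ For integers $q\ge 1$ and $a$ put $$S(q,a)=\sum_{\mathbf{x}\in(\mathbb{Z}/q\mathbb{Z})^n} e^{2\pi i\,aC(\mathbf{x})/q}.$$ Then the singular series $$\mathfrak{S}=\sum_{q=1}^\infty\ \sum_{\substack{a \bmod q\\ (a,q)=1}}\frac{S(q,a)}{q^n}$$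 converges absolutely, that is, $\sum_{q=1}^\infty\sum_{a \bmod q,\,(a,q)=1}|S(q,a)|\,q^{-n}<\infty$, and its value $\mathfrak{S}$ is a positive real number. -/

import Mathlib

namespace CubicForm

/-- The coefficients `c i j k`, symmetric in the three indices, of the expansion
`F = ∑ i, ∑ j, ∑ k, c i j k * X i * X j * X k` of a cubic form `F` with integer coefficients.
They are a priori rational numbers whose product with `6` is an integer;
`symCoeff_symm` and `sum_symCoeff` below show that they are what they should be. -/
noncomputable def symCoeff {n : ℕ} (F : MvPolynomial (Fin n) ℤ) (i j k : Fin n) : ℚ :=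
  ((MvPolynomial.coeff 0
    (MvPolynomial.pderiv k (MvPolynomial.pderiv j (MvPolynomial.pderiv i F))) : ℤ) : ℚ) / 6

theorem pderiv_comm' {n : ℕ} (F : MvPolynomial (Fin n) ℤ) (i j : Fin n) :
    MvPolynomial.pderiv i (MvPolynomial.pderiv j F)
      = MvPolynomial.pderiv j (MvPolynomial.pderiv i F) := by
  have h : ⁅MvPolynomial.pderiv (R := ℤ) i, MvPolynomial.pderiv (R := ℤ) j⁆ = 0 := by
    apply MvPolynomial.derivation_ext
    intro k
    simp [Derivation.commutator_apply, MvPolynomial.pderiv_X, Pi.single_apply, apply_ite]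
  have h2 := congrArg (fun D => D F) h
  simpa [Derivation.commutator_apply, sub_eq_zero] using h2

theorem symCoeff_symm {n : ℕ} (F : MvPolynomial (Fin n) ℤ) (i j k : Fin n) :
    symCoeff F i j k = symCoeff F j i k ∧ symCoeff F i j k = symCoeff F i k j := by
  constructor
  · rw [symCoeff, symCoeff, pderiv_comm' F j i]
  · rw [symCoeff, symCoeff, pderiv_comm' _ k j]

theorem sum_symCoeff {n : ℕ} (F : MvPolynomial (Fin n) ℤ) (hF : F.IsHomogeneous 3)
    (x : Fin n → ℤ) :
    ((MvPolynomial.eval x F : ℤ) : ℚ)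
      = ∑ i, ∑ j, ∑ k, symCoeff F i j k * x i * x j * x k := by
  have key : ∀ (m : ℕ) (G : MvPolynomial (Fin n) ℤ), G.IsHomogeneous m →
      ∑ i, x i * MvPolynomial.eval x (MvPolynomial.pderiv i G)
        = m * MvPolynomial.eval x G := by
    intro m G hG
    have := congrArg (MvPolynomial.eval x) hG.sum_X_mul_pderiv
    simpa using this
  have h1 := key 3 F hF
  have h2 : ∀ i, _ := fun i => key 2 _ (hF.pderiv (i := i))
  have h3 : ∀ i j, _ := fun i j => key 1 _ ((hF.pderiv (i := i)).pderiv (i := j))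
  have h4 : ∀ i j k, MvPolynomial.eval x (MvPolynomial.pderiv k (MvPolynomial.pderiv j
      (MvPolynomial.pderiv i F))) = MvPolynomial.coeff 0 (MvPolynomial.pderiv k
      (MvPolynomial.pderiv j (MvPolynomial.pderiv i F))) := by
    intro i j k
    have h0 : (MvPolynomial.pderiv k (MvPolynomial.pderiv j
      (MvPolynomial.pderiv i F))).IsHomogeneous 0 :=
      ((hF.pderiv (i := i)).pderiv (i := j)).pderiv (i := k)
    have := (MvPolynomial.totalDegree_eq_zero_iff_eq_C).1
      (Nat.le_zero.1 h0.totalDegree_le)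
    generalize MvPolynomial.pderiv k (MvPolynomial.pderiv j (MvPolynomial.pderiv i F)) = G at this
    obtain ⟨c, rfl⟩ : ∃ c, G = MvPolynomial.C c := ⟨_, this⟩
    rw [MvPolynomial.eval_C, MvPolynomial.coeff_zero_C]
  have h6 : 6 * MvPolynomial.eval x F = ∑ i, ∑ j, ∑ k, MvPolynomial.coeff 0
      (MvPolynomial.pderiv k (MvPolynomial.pderiv j (MvPolynomial.pderiv i F)))
        * x i * x j * x k := by
    have : 6 * MvPolynomial.eval x F = 2 * (((3 : ℕ) : ℤ) * MvPolynomial.eval x F) := by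
      push_cast; ring
    rw [this, ← h1, Finset.mul_sum]
    refine Finset.sum_congr rfl fun i _ => ?_
    have e2 := h2 i
    push_cast at e2
    rw [mul_left_comm, ← e2, Finset.mul_sum]
    refine Finset.sum_congr rfl fun j _ => ?_
    have e3 := h3 i j
    push_cast at e3
    rw [one_mul] at e3
    rw [← e3, Finset.mul_sum, Finset.mul_sum]
    refine Finset.sum_congr rfl fun k _ => ?_
    rw [h4]; ring
  have h7 := congrArg (Int.cast : ℤ → ℚ) h6
  rw [Int.cast_mul] at h7
  have h8 : ((MvPolynomial.eval x F : ℤ) : ℚ)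
      = (((6 : ℤ) : ℚ) * ((MvPolynomial.eval x F : ℤ) : ℚ)) / 6 := by push_cast; ring
  rw [h8, h7]
  push_cast
  simp only [Finset.sum_div, symCoeff]
  refine Finset.sum_congr rfl fun i _ => Finset.sum_congr rfl fun j _ =>
    Finset.sum_congr rfl fun k _ => ?_
  ring

/-- The matrix `M(x)` with entries `M(x) j k = ∑ i, c i j k * x i`. -/
noncomputable def matrixM {n : ℕ} (F : MvPolynomial (Fin n) ℤ) (x : Fin n → ℤ) :
    Matrix (Fin n) (Fin n) ℚ :=
  Matrix.of fun j k => ∑ i, symCoeff F i j k * x i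

/-- Davenport's Geometric Condition: for every `0 ≤ r ≤ n` and every `ε > 0`,
`#{x ∈ ℤⁿ : ‖x‖_∞ ≤ P, rank M(x) = r} ≪ P ^ (r + ε)` for `P ≥ 1`, where the implied constant
may depend on `F` and `ε`. -/
def GeometricCondition {n : ℕ} (F : MvPolynomial (Fin n) ℤ) : Prop :=
  ∀ r : ℕ, r ≤ n → ∀ ε : ℝ, 0 < ε → ∃ K : ℝ, ∀ P : ℝ, 1 ≤ P →
    (Set.ncard {x : Fin n → ℤ | (∀ i, |(x i : ℝ)| ≤ P) ∧ (matrixM F x).rank = r} : ℝ)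
      ≤ K * P ^ ((r : ℝ) + ε)

/-- The sum `S(q, a) = ∑_{x mod q} e(a F(x) / q)`, where `e(t) = exp(2 π i t)`. -/
noncomputable def expSum {n : ℕ} (F : MvPolynomial (Fin n) ℤ) (q a : ℕ) : ℂ :=
  ∑ x : Fin n → Fin q,
    Complex.exp (2 * Real.pi * Complex.I *
      ((a : ℂ) * ((MvPolynomial.eval (fun i => ((x i : ℕ) : ℤ)) F : ℤ) : ℂ) / (q : ℂ)))

/-- The reduced residues modulo `q`, represented in `{0, …, q - 1}`
(so that `a = 0` is the only one for `q = 1`). -/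
def reducedResidues (q : ℕ) : Finset ℕ :=
  {a ∈ Finset.range q | Nat.Coprime a q}

end CubicForm

/-! Let `A(q) = ∑_a |S(q, a)| q ^ (-n)` (`absSum`). By the Chinese remainder theorem `A` is
multiplicative, so absolute convergence follows from `∑_p ∑_{k ≥ 1} A(p ^ k) < ∞`.

All estimates start from van der Corput differencing with shifts `u` in a box of side `H`: `|S|²` is
bounded by an average over `u` of differenced sums, whose phase is quadratic with matrix `6 M(u)`
(`hess`). Their size is controlled by the kernel of that matrix modulo `q`. If `M(u)` has rank `r`,
the kernel has at most `q ^ (n - r)` times a nonzero minor of size `O(H ^ r)` elements, while the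
Geometric Condition allows only `O(H ^ (r + ε))` such `u`. Taking `H ≈ q ^ (1/3)` gives `|S(q, a)| q
^ (-n) ≪ q ^ (-8/5)` (`exists_norm_charSum_le`), so `A(q) ≪ q ^ (-3/5)`. This settles the prime
powers with `k ≥ 2`, but not the primes.

For primes two further averages are used. Averaging over `a` modulo `p` inside the absolute value
produces a Gauss sum and saves `√p` unless `p ∣ F(u)` (`norm_sum_diffSum_le_of_not_dvd`). Averaging
over primes `p ∈ [Q, 2Q)` helps because the kernel modulo `p` exceeds `p ^ (n - r)` only for the
boundedly many `p` dividing a fixed minor. With `H ≈ Q ^ 0.402` this suffices, except for full rank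
when `n = 10`. There the only harmful `u` have `p ∣ F(u)` and `p ^ 4 ∣ det 6M(u)` for some such `p`.
Writing `F(u) = p k` and `det = p ^ 4 m` puts `u` on the hypersurface `k ^ 4 det = m F ^ 4`, proper
since the degrees 10 and 12 differ, so these `u` are rare (`exists_card_exceptionalSet_le`).
Altogether `∑_{Q ≤ p < 2Q} A(p) ≪ Q ^ (-1/200)`.

For positivity the series is an Euler product with convergent logarithm, so each factor must be
shown positive. The factor at `p` is the limit of the normalised numbers of zeros modulo `p ^ N`,
which is positive as soon as some integral point satisfies the hypothesis of Hensel's lemma. If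
there were none, the sets `L_k = {x : p ^ k ∣ F(x)}` would be lattices. Chevalley–Warning in four
variables gives `[L_k : L_{k+1}] ≤ p ^ 3`, so `L_{3e}` has index at most `p ^ (9e)`. On the other
hand the trilinear form is divisible by `p ^ (3e)` on `L_{3e} ⊇ p ^ e ℤⁿ`, which forces `p ^ (2en)`
to divide the squared index times a fixed nonzero Hessian determinant. For `n ≥ 10` and large `e`
this is impossible (`not_noSmoothPoint`). -/

namespace CubicForm

open MvPolynomial

variable {n : ℕ}

/-! ### The trilinear form of a cubic and its polarisation identities. -/

/-- The integral coefficients `6 c i j k` of the symmetric trilinear form attached to `F`. -/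
noncomputable def triCoeff (F : MvPolynomial (Fin n) ℤ) (i j k : Fin n) : ℤ :=
  coeff 0 (pderiv k (pderiv j (pderiv i F)))

theorem triCoeff_swap_left (F : MvPolynomial (Fin n) ℤ) (i j k : Fin n) :
    triCoeff F i j k = triCoeff F j i k := by
  rw [triCoeff, triCoeff, pderiv_comm' F j i]

theorem triCoeff_swap_right (F : MvPolynomial (Fin n) ℤ) (i j k : Fin n) :
    triCoeff F i j k = triCoeff F i k j := by
  rw [triCoeff, triCoeff, pderiv_comm' _ k j]

theorem symCoeff_eq (F : MvPolynomial (Fin n) ℤ) (i j k : Fin n) :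
    symCoeff F i j k = (triCoeff F i j k : ℚ) / 6 := rfl

/-- The symmetric trilinear form `T` with `T(x, x, x) = 6 F(x)`, over any commutative ring. -/
noncomputable def tri {R : Type*} [CommRing R] (F : MvPolynomial (Fin n) ℤ)
    (x y z : Fin n → R) : R :=
  ∑ i, ∑ j, ∑ k, (triCoeff F i j k : R) * x i * y j * z k

section tri

variable {R : Type*} [CommRing R] (F : MvPolynomial (Fin n) ℤ)

theorem tri_swap_left (x y z : Fin n → R) : tri F x y z = tri F y x z := by
  unfold tri
  rw [Finset.sum_comm]
  refine Finset.sum_congr rfl fun i _ => Finset.sum_congr rfl fun j _ =>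
    Finset.sum_congr rfl fun k _ => ?_
  rw [triCoeff_swap_left]; ring

theorem tri_swap_right (x y z : Fin n → R) : tri F x y z = tri F x z y := by
  unfold tri
  refine Finset.sum_congr rfl fun i _ => ?_
  rw [Finset.sum_comm]
  refine Finset.sum_congr rfl fun j _ => Finset.sum_congr rfl fun k _ => ?_
  rw [triCoeff_swap_right]; ring

theorem tri_add_left (x x' y z : Fin n → R) :
    tri F (x + x') y z = tri F x y z + tri F x' y z := by
  simp only [tri, Pi.add_apply, mul_add, add_mul, Finset.sum_add_distrib]

theorem tri_add_mid (x y y' z : Fin n → R) :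
    tri F x (y + y') z = tri F x y z + tri F x y' z := by
  rw [tri_swap_left, tri_add_left, tri_swap_left, tri_swap_left F y']

theorem tri_add_right (x y z z' : Fin n → R) :
    tri F x y (z + z') = tri F x y z + tri F x y z' := by
  rw [tri_swap_right, tri_add_mid, tri_swap_right, tri_swap_right F x z']

theorem tri_smul_left (c : R) (x y z : Fin n → R) :
    tri F (c • x) y z = c * tri F x y z := by
  simp only [tri, Pi.smul_apply, smul_eq_mul, Finset.mul_sum]
  refine Finset.sum_congr rfl fun i _ => Finset.sum_congr rfl fun j _ =>
    Finset.sum_congr rfl fun k _ => ?_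
  ring

theorem tri_smul_mid (c : R) (x y z : Fin n → R) :
    tri F x (c • y) z = c * tri F x y z := by
  rw [tri_swap_left, tri_smul_left, tri_swap_left]

theorem tri_smul_right (c : R) (x y z : Fin n → R) :
    tri F x y (c • z) = c * tri F x y z := by
  rw [tri_swap_right, tri_smul_mid, tri_swap_right]

theorem tri_map {S : Type*} [CommRing S] (f : R →+* S) (x y z : Fin n → R) :
    tri F (fun i => f (x i)) (fun i => f (y i)) (fun i => f (z i)) = f (tri F x y z) := by
  simp [tri, map_sum, map_mul]

end tri

/-- The integral matrix `6 M(u)`. -/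
noncomputable def hess (F : MvPolynomial (Fin n) ℤ) (u : Fin n → ℤ) :
    Matrix (Fin n) (Fin n) ℤ :=
  Matrix.of fun j k => ∑ i, triCoeff F i j k * u i

theorem tri_eq_dotProduct (F : MvPolynomial (Fin n) ℤ) (x u y : Fin n → ℤ) :
    tri F x u y = x ⬝ᵥ (hess F u).mulVec y := by
  rw [tri_swap_left]
  simp only [tri, dotProduct, Matrix.mulVec, hess, Matrix.of_apply, Finset.mul_sum,
    Finset.sum_mul]
  rw [Finset.sum_comm]
  refine Finset.sum_congr rfl fun j _ => ?_
  rw [Finset.sum_comm]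
  refine Finset.sum_congr rfl fun k _ => Finset.sum_congr rfl fun i _ => ?_
  simp only [Int.cast_id]
  ring

theorem tri_eq_dotProduct_map {R : Type*} [CommRing R] (F : MvPolynomial (Fin n) ℤ)
    (x y : Fin n → R) (u : Fin n → ℤ) :
    tri F x (fun i => (u i : R)) y
      = x ⬝ᵥ ((hess F u).map (Int.castRingHom R)).mulVec y := by
  rw [tri_swap_left]
  simp only [tri, dotProduct, Matrix.mulVec, hess, Matrix.map_apply, Matrix.of_apply,
    Finset.mul_sum, Finset.sum_mul, map_sum, map_mul]
  rw [Finset.sum_comm]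
  refine Finset.sum_congr rfl fun j _ => ?_
  rw [Finset.sum_comm]
  refine Finset.sum_congr rfl fun k _ => Finset.sum_congr rfl fun i _ => ?_
  simp
  ring

theorem matrixM_eq (F : MvPolynomial (Fin n) ℤ) (u : Fin n → ℤ) :
    matrixM F u = (6 : ℚ)⁻¹ • (hess F u).map (Int.castRingHom ℚ) := by
  ext j k
  simp only [matrixM, hess, Matrix.of_apply, Matrix.smul_apply, Matrix.map_apply, symCoeff_eq,
    smul_eq_mul, map_sum, map_mul, Finset.mul_sum]
  refine Finset.sum_congr rfl fun i _ => ?_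
  simp
  ring

theorem rank_matrixM (F : MvPolynomial (Fin n) ℤ) (u : Fin n → ℤ) :
    (matrixM F u).rank = ((hess F u).map (Int.castRingHom ℚ)).rank := by
  rw [matrixM_eq]
  exact Matrix.rank_smul_of_mem_nonZeroDivisors _ (mem_nonZeroDivisors_of_ne_zero (by norm_num))

/-- The value `∇F(x) · y`. -/
noncomputable def gradDot (F : MvPolynomial (Fin n) ℤ) (x y : Fin n → ℤ) : ℤ :=
  ∑ j, eval x (pderiv j F) * y j

/-- The polarisation identities are proved over `ℤ`, where 2 and 6 can be cancelled, and only then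
reduced modulo `q`, which may have common factors with 6. -/
theorem six_mul_eval {F : MvPolynomial (Fin n) ℤ} (hF : F.IsHomogeneous 3)
    (x : Fin n → ℤ) : 6 * eval x F = tri F x x x := by
  have h := sum_symCoeff F hF x
  have : ((6 * eval x F : ℤ) : ℚ) = ((tri F x x x : ℤ) : ℚ) := by
    push_cast
    rw [h]
    simp only [tri, symCoeff_eq]
    push_cast
    simp only [Finset.mul_sum]
    refine Finset.sum_congr rfl fun i _ => Finset.sum_congr rfl fun j _ =>
      Finset.sum_congr rfl fun k _ => ?_
    ring
  exact_mod_cast this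

theorem two_mul_gradDot {F : MvPolynomial (Fin n) ℤ} (hF : F.IsHomogeneous 3)
    (x y : Fin n → ℤ) : 2 * gradDot F x y = tri F x x y := by
  have key : ∀ (m : ℕ) (G : MvPolynomial (Fin n) ℤ), G.IsHomogeneous m →
      ∑ i, x i * eval x (pderiv i G) = m * eval x G := by
    intro m G hG
    have := congrArg (eval x) hG.sum_X_mul_pderiv
    simpa using this
  have h4 : ∀ i j k, eval x (pderiv k (pderiv j (pderiv i F))) = triCoeff F i j k := by
    intro i j k
    have h0 : (pderiv k (pderiv j (pderiv i F))).IsHomogeneous 0 :=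
      ((hF.pderiv (i := i)).pderiv (i := j)).pderiv (i := k)
    have := (totalDegree_eq_zero_iff_eq_C).1 (Nat.le_zero.1 h0.totalDegree_le)
    rw [triCoeff]
    generalize pderiv k (pderiv j (pderiv i F)) = G at this
    obtain ⟨c, rfl⟩ : ∃ c, G = C c := ⟨_, this⟩
    rw [eval_C, coeff_zero_C]
  rw [tri_swap_right, tri_swap_left]
  simp only [gradDot, tri, Finset.mul_sum]
  refine Finset.sum_congr rfl fun j _ => ?_
  have e2 := key 2 _ (hF.pderiv (i := j))
  push_cast at e2
  rw [← mul_assoc, ← e2, Finset.sum_mul]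
  refine Finset.sum_congr rfl fun i _ => ?_
  have e3 := key 1 _ ((hF.pderiv (i := j)).pderiv (i := i))
  push_cast at e3
  rw [one_mul] at e3
  rw [← e3, Finset.mul_sum, Finset.sum_mul]
  refine Finset.sum_congr rfl fun k _ => ?_
  rw [h4, Int.cast_id]
  ring

theorem tri_self_left {F : MvPolynomial (Fin n) ℤ} (hF : F.IsHomogeneous 3)
    (x y : Fin n → ℤ) : tri F x y y = 2 * gradDot F y x := by
  rw [two_mul_gradDot hF, tri_swap_left, tri_swap_right]

theorem eval_add_eq {F : MvPolynomial (Fin n) ℤ} (hF : F.IsHomogeneous 3)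
    (x y : Fin n → ℤ) :
    eval (x + y) F = eval x F + gradDot F x y + gradDot F y x + eval y F := by
  have h := six_mul_eval hF (x + y)
  simp only [tri_add_left, tri_add_mid, tri_add_right] at h
  have h1 := six_mul_eval hF x
  have h2 := six_mul_eval hF y
  have h3 := two_mul_gradDot hF x y
  have h4 := two_mul_gradDot hF y x
  have e1 : tri F x y x = tri F x x y := tri_swap_right F _ _ _
  have e2 : tri F y x x = tri F x x y := by rw [tri_swap_left, tri_swap_right]
  have e3 : tri F y x y = tri F y y x := tri_swap_right F _ _ _
  have e4 : tri F x y y = tri F y y x := by rw [tri_swap_left, tri_swap_right]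
  rw [e1, e2, e3, e4] at h
  linarith

theorem eval_smul_eq {F : MvPolynomial (Fin n) ℤ} (hF : F.IsHomogeneous 3)
    (c : ℤ) (x : Fin n → ℤ) : eval (c • x) F = c ^ 3 * eval x F := by
  have h := six_mul_eval hF (c • x)
  have h1 := six_mul_eval hF x
  have h' : tri F (c • x) (c • x) (c • x) = c ^ 3 * tri F x x x := by
    rw [tri_smul_left, tri_smul_mid, tri_smul_right]; ring
  rw [h', ← h1] at h
  linarith

theorem eval_neg_eq {F : MvPolynomial (Fin n) ℤ} (hF : F.IsHomogeneous 3)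
    (x : Fin n → ℤ) : eval (-x) F = -eval x F := by
  have := eval_smul_eq hF (-1) x
  rw [neg_one_smul] at this
  rw [this]; ring

theorem gradDot_add_left {F : MvPolynomial (Fin n) ℤ} (hF : F.IsHomogeneous 3)
    (x z y : Fin n → ℤ) :
    gradDot F (x + z) y = gradDot F x y + tri F x z y + gradDot F z y := by
  have h := two_mul_gradDot hF (x + z) y
  have h1 := two_mul_gradDot hF x y
  have h2 := two_mul_gradDot hF z y
  have e : tri F z x y = tri F x z y := tri_swap_left F _ _ _
  simp only [tri_add_left, tri_add_mid, e] at h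
  linarith

theorem gradDot_smul_left {F : MvPolynomial (Fin n) ℤ} (hF : F.IsHomogeneous 3)
    (c : ℤ) (x y : Fin n → ℤ) :
    gradDot F (c • x) y = c ^ 2 * gradDot F x y := by
  have h := two_mul_gradDot hF (c • x) y
  have h1 := two_mul_gradDot hF x y
  rw [tri_smul_left, tri_smul_mid, ← h1] at h
  linarith

theorem gradDot_self {F : MvPolynomial (Fin n) ℤ} (hF : F.IsHomogeneous 3)
    (x : Fin n → ℤ) : gradDot F x x = 3 * eval x F := by
  have h := two_mul_gradDot hF x x
  have h1 := six_mul_eval hF x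
  linarith

theorem gradDot_add_right (F : MvPolynomial (Fin n) ℤ) (x y z : Fin n → ℤ) :
    gradDot F x (y + z) = gradDot F x y + gradDot F x z := by
  simp [gradDot, mul_add, Finset.sum_add_distrib]

theorem gradDot_smul_right (F : MvPolynomial (Fin n) ℤ) (c : ℤ) (x y : Fin n → ℤ) :
    gradDot F x (c • y) = c * gradDot F x y := by
  simp only [gradDot, Pi.smul_apply, smul_eq_mul, Finset.mul_sum]
  exact Finset.sum_congr rfl fun i _ => by ring

theorem gradDot_single (F : MvPolynomial (Fin n) ℤ) (x : Fin n → ℤ) (j : Fin n) :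
    gradDot F x (Pi.single j 1) = eval x (pderiv j F) := by
  simp [gradDot, Pi.single_apply]

/-- Reduction of integral vectors modulo `q`. -/
theorem exists_intCast_eq (q : ℕ) (x : Fin n → ZMod q) :
    ∃ y : Fin n → ℤ, (fun i => (y i : ZMod q)) = x := by
  choose y hy using fun i => ZMod.intCast_surjective (x i)
  exact ⟨y, funext hy⟩

theorem aeval_intCast (F : MvPolynomial (Fin n) ℤ) {R : Type*} [CommRing R] (y : Fin n → ℤ) :
    aeval (fun i => (y i : R)) F = ((eval y F : ℤ) : R) := by
  have := MvPolynomial.aeval_algebraMap_apply R y F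
  rw [MvPolynomial.aeval_eq_eval] at this
  exact this

/-- The second difference of a cubic is affine in `x`, with linear part `T(x, h, k)`. This makes the
differenced phase quadratic. -/
theorem aeval_second_difference {F : MvPolynomial (Fin n) ℤ} (hF : F.IsHomogeneous 3) (q : ℕ)
    (x h k : Fin n → ZMod q) :
    aeval (x + h + k) F - aeval (x + k) F - (aeval (x + h) F - aeval x F)
      = tri F x h k + (aeval (h + k) F - aeval h F - aeval k F) := by
  obtain ⟨x, rfl⟩ := exists_intCast_eq q x
  obtain ⟨h, rfl⟩ := exists_intCast_eq q h
  obtain ⟨k, rfl⟩ := exists_intCast_eq q k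
  have key : eval (x + h + k) F - eval (x + k) F - (eval (x + h) F - eval x F)
      = tri F x h k + (eval (h + k) F - eval h F - eval k F) := by
    have e : tri F h x k = tri F x h k := tri_swap_left F _ _ _
    have e1 : gradDot F k (x + h) = gradDot F k x + gradDot F k h := gradDot_add_right _ _ _ _
    rw [eval_add_eq hF (x + h) k, eval_add_eq hF x k, eval_add_eq hF h k,
      gradDot_add_left hF x h k, e1]
    ring
  have c : ∀ a b : Fin n → ℤ, (fun i => (a i : ZMod q)) + (fun i => (b i : ZMod q))
      = fun i => ((a + b) i : ZMod q) := by intro a b; ext i; simp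
  have t := tri_map F (Int.castRingHom (ZMod q)) x h k
  simp only [eq_intCast] at t
  rw [c, c, c, c, t]
  simp only [aeval_intCast]
  exact_mod_cast congrArg (Int.cast : ℤ → ZMod q) key

/-- Centring the difference removes the terms linear in `x`, leaving a quadratic form plus a
constant. -/
theorem aeval_symmetric_difference {F : MvPolynomial (Fin n) ℤ} (hF : F.IsHomogeneous 3) (q : ℕ)
    (x v : Fin n → ZMod q) :
    aeval (x + v) F - aeval (x - v) F = tri F x x v + 2 * aeval v F := by
  obtain ⟨x, rfl⟩ := exists_intCast_eq q x
  obtain ⟨v, rfl⟩ := exists_intCast_eq q v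
  have key : eval (x + v) F - eval (x + -v) F = tri F x x v + 2 * eval v F := by
    have e : gradDot F x (-v) = -gradDot F x v := by
      have := gradDot_smul_right F (-1) x v
      rw [neg_one_smul] at this
      rw [this]; ring
    have e' : gradDot F (-v) x = gradDot F v x := by
      have := gradDot_smul_left hF (-1) v x
      rw [neg_one_smul] at this
      rw [this]; ring
    rw [eval_add_eq hF x v, eval_add_eq hF x (-v), e, e', eval_neg_eq hF,
      ← two_mul_gradDot hF x v]
    ring
  have c : ∀ a b : Fin n → ℤ, (fun i => (a i : ZMod q)) + (fun i => (b i : ZMod q))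
      = fun i => ((a + b) i : ZMod q) := by intro a b; ext i; simp
  have c' : ∀ a b : Fin n → ℤ, (fun i => (a i : ZMod q)) - (fun i => (b i : ZMod q))
      = fun i => ((a + -b) i : ZMod q) := by intro a b; ext i; simp [sub_eq_add_neg]
  have t := tri_map F (Int.castRingHom (ZMod q)) x x v
  simp only [eq_intCast] at t
  rw [c, c', t]
  simp only [aeval_intCast]
  exact_mod_cast congrArg (Int.cast : ℤ → ZMod q) key

/-! ### Complete exponential sums and multiplicativity in the modulus. -/

/-- The complete exponential sum `∑ x, e(a F(x) / q)`, for a residue class `a` modulo `q`. -/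
noncomputable def charSum (F : MvPolynomial (Fin n) ℤ) (q : ℕ) [NeZero q] (a : ZMod q) : ℂ :=
  ∑ x : Fin n → ZMod q, ZMod.stdAddChar (a * aeval x F)

theorem expSum_eq_charSum (F : MvPolynomial (Fin n) ℤ) (q : ℕ) [NeZero q] (a : ℕ) :
    expSum F q a = charSum F q (a : ZMod q) := by
  have key : ∀ x : Fin n → ZMod q, Complex.exp (2 * Real.pi * Complex.I *
      ((a : ℂ) * ((MvPolynomial.eval (fun i => ((x i).val : ℤ)) F : ℤ) : ℂ) / (q : ℂ)))
      = ZMod.stdAddChar ((a : ZMod q) * aeval x F) := by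
    intro x
    have h : x = fun i => (((x i).val : ℤ) : ZMod q) := by
      ext i
      push_cast
      exact (ZMod.natCast_zmod_val (x i)).symm
    conv_rhs => rw [h]
    rw [aeval_intCast, ← Int.cast_natCast (R := ZMod q) a, ← Int.cast_mul, ZMod.stdAddChar_coe]
    congr 1
    push_cast
    ring
  obtain ⟨m, rfl⟩ := Nat.exists_eq_succ_of_ne_zero (NeZero.ne q)
  exact Fintype.sum_equiv (Equiv.refl _) _ _ fun x => key x

theorem sum_reducedResidues {M : Type*} [AddCommMonoid M] (q : ℕ) [NeZero q] (φ : ZMod q → M) :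
    ∑ a ∈ reducedResidues q, φ (a : ZMod q) = ∑ a : (ZMod q)ˣ, φ (a : ZMod q) := by
  refine Finset.sum_bij' (fun a ha => ZMod.unitOfCoprime a (Finset.mem_filter.1 ha).2)
    (fun a _ => (a : ZMod q).val) ?_ ?_ ?_ ?_ ?_
  · intro a _; exact Finset.mem_univ _
  · intro a _
    exact Finset.mem_filter.2 ⟨Finset.mem_range.2 (ZMod.val_lt _), ZMod.val_coe_unit_coprime a⟩
  · intro a ha
    have := (Finset.mem_filter.1 ha).1
    simp [ZMod.val_natCast, Nat.mod_eq_of_lt (Finset.mem_range.1 this)]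
  · intro a _
    ext
    simp
  · intro a ha
    simp

/-- The relation `U r + V q = 1` is the partial fraction decomposition `1 / (q r) = U / q + V / r`.
-/
theorem stdAddChar_mul_modulus {q r : ℕ} [NeZero q] [NeZero r] {U V : ℤ}
    (h : U * r + V * q = 1) (Z : ℤ) :
    (ZMod.stdAddChar (Z : ZMod (q * r)) : ℂ)
      = ZMod.stdAddChar ((U * Z : ℤ) : ZMod q) * ZMod.stdAddChar ((V * Z : ℤ) : ZMod r) := by
  rw [ZMod.stdAddChar_coe, ZMod.stdAddChar_coe, ZMod.stdAddChar_coe, ← Complex.exp_add]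
  have hq : (q : ℂ) ≠ 0 := Nat.cast_ne_zero.2 (NeZero.ne q)
  have hr : (r : ℂ) ≠ 0 := Nat.cast_ne_zero.2 (NeZero.ne r)
  have h' : (U : ℂ) * r + V * q = 1 := by exact_mod_cast h
  congr 1
  push_cast
  field_simp
  linear_combination -(Z : ℂ) * h'

theorem charSum_mul_modulus (F : MvPolynomial (Fin n) ℤ) {q r : ℕ} [NeZero q] [NeZero r]
    (hqr : q.Coprime r) {U V : ℤ} (h : U * r + V * q = 1) (a : ZMod (q * r)) :
    charSum F (q * r) a
      = charSum F q (U * (ZMod.chineseRemainder hqr a).1)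
        * charSum F r (V * (ZMod.chineseRemainder hqr a).2) := by
  unfold charSum
  rw [Finset.sum_mul_sum, ← Finset.sum_product', Finset.univ_product_univ]
  let e : (Fin n → ZMod (q * r)) ≃ (Fin n → ZMod q) × (Fin n → ZMod r) :=
    ((Equiv.refl (Fin n)).arrowCongr (ZMod.chineseRemainder hqr).toEquiv).trans
      (Equiv.arrowProdEquivProdArrow _ _ _)
  refine Fintype.sum_equiv e _ _ fun x => ?_
  obtain ⟨y, rfl⟩ := exists_intCast_eq (q * r) x
  obtain ⟨A, rfl⟩ := ZMod.intCast_surjective a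
  have e1 : (e fun i => ((y i : ℤ) : ZMod (q * r))).1 = fun i => (y i : ZMod q) := by
    funext i
    change (ZMod.chineseRemainder hqr (y i : ZMod (q * r))).1 = _
    rw [map_intCast]; rfl
  have e2 : (e fun i => ((y i : ℤ) : ZMod (q * r))).2 = fun i => (y i : ZMod r) := by
    funext i
    change (ZMod.chineseRemainder hqr (y i : ZMod (q * r))).2 = _
    rw [map_intCast]; rfl
  have a1 : (ZMod.chineseRemainder hqr (A : ZMod (q * r))).1 = (A : ZMod q) := by
    rw [map_intCast]; rfl
  have a2 : (ZMod.chineseRemainder hqr (A : ZMod (q * r))).2 = (A : ZMod r) := by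
    rw [map_intCast]; rfl
  rw [e1, e2, a1, a2, aeval_intCast, aeval_intCast, aeval_intCast, ← Int.cast_mul,
    stdAddChar_mul_modulus h]
  push_cast
  rw [mul_assoc, mul_assoc]

/-- The sum `∑ g(S(q, a) / q ^ n)` over reduced residues `a` modulo `q`. -/
noncomputable def localSum {R : Type*} [CommRing R] (F : MvPolynomial (Fin n) ℤ) (g : ℂ →* R)
    (q : ℕ) : R :=
  ∑ a ∈ reducedResidues q, g (expSum F q a / (q : ℂ) ^ n)

theorem localSum_eq {R : Type*} [CommRing R] (F : MvPolynomial (Fin n) ℤ) (g : ℂ →* R)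
    (q : ℕ) [NeZero q] :
    localSum F g q = ∑ a : (ZMod q)ˣ, g (charSum F q a / (q : ℂ) ^ n) := by
  unfold localSum
  rw [← sum_reducedResidues q fun a => g (charSum F q a / (q : ℂ) ^ n)]
  refine Finset.sum_congr rfl fun a _ => ?_
  rw [expSum_eq_charSum]

theorem localSum_zero {R : Type*} [CommRing R] (F : MvPolynomial (Fin n) ℤ) (g : ℂ →* R) :
    localSum F g 0 = 0 := by
  simp [localSum, reducedResidues]

theorem localSum_one {R : Type*} [CommRing R] (F : MvPolynomial (Fin n) ℤ) (g : ℂ →* R) :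
    localSum F g 1 = 1 := by
  have : reducedResidues 1 = {0} := by decide
  rw [localSum, this, Finset.sum_singleton]
  simp [expSum]

theorem localSum_mul {R : Type*} [CommRing R] (F : MvPolynomial (Fin n) ℤ) (g : ℂ →* R)
    {q r : ℕ} (hqr : q.Coprime r) :
    localSum F g (q * r) = localSum F g q * localSum F g r := by
  rcases Nat.eq_zero_or_pos q with rfl | hq
  · simp [localSum_zero]
  rcases Nat.eq_zero_or_pos r with rfl | hr
  · simp [localSum_zero]
  have : NeZero q := ⟨hq.ne'⟩
  have : NeZero r := ⟨hr.ne'⟩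
  rw [localSum_eq, localSum_eq, localSum_eq, Finset.sum_mul_sum, ← Finset.sum_product',
    Finset.univ_product_univ]
  obtain ⟨U, V, h⟩ : ∃ U V : ℤ, U * r + V * q = 1 := by
    have := (Nat.isCoprime_iff_coprime.2 hqr.symm)
    exact this
  have hU : IsUnit (U : ZMod q) := by
    refine IsUnit.of_mul_eq_one (r : ZMod q) ?_
    have := congrArg (Int.cast : ℤ → ZMod q) h
    push_cast at this
    simpa using this
  have hV : IsUnit (V : ZMod r) := by
    refine IsUnit.of_mul_eq_one (q : ZMod r) ?_
    have := congrArg (Int.cast : ℤ → ZMod r) h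
    push_cast at this
    simpa using this
  -- `U` and `V` are units modulo `q` and `r`, so the twists produced by `charSum_mul_modulus` only
  -- permute the reduced residues.
  let e : (ZMod (q * r))ˣ ≃ (ZMod q)ˣ × (ZMod r)ˣ :=
    ((Units.mapEquiv (ZMod.chineseRemainder hqr).toMulEquiv).toEquiv.trans
      MulEquiv.prodUnits.toEquiv).trans
      ((Equiv.mulLeft hU.unit).prodCongr (Equiv.mulLeft hV.unit))
  refine Fintype.sum_equiv e _ _ fun a => ?_
  rw [charSum_mul_modulus F hqr h, ← map_mul, div_mul_div_comm, ← mul_pow, ← Nat.cast_mul]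
  rfl

/-! ### Minors of integral matrices and their kernels modulo `q`. -/

theorem exists_injective_linearIndependent_col {m n K : Type*} [Fintype m] [Fintype n] [Field K]
    (A : Matrix m n K) {r : ℕ} (hr : A.rank = r) :
    ∃ g : Fin r → n, Function.Injective g ∧ LinearIndependent K (A.col ∘ g) := by
  subst hr
  obtain ⟨κ, a, ha, hsp, hli⟩ := exists_linearIndependent' K A.col
  have : Finite κ := Finite.of_injective a ha
  have := Fintype.ofFinite κ
  have hc : Fintype.card κ = A.rank := by
    rw [Matrix.rank_eq_finrank_span_cols, ← hsp, finrank_span_eq_card hli]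
  let e : Fin A.rank ≃ κ := (Fintype.equivFinOfCardEq hc).symm
  exact ⟨a ∘ e, ha.comp e.injective, hli.comp e e.injective⟩

/-- For a rank `r` matrix over a field there is a nonvanishing `r × r` minor. -/
theorem exists_submatrix_det_ne_zero {m n K : Type*} [Fintype m] [Fintype n] [Field K]
    (A : Matrix m n K) {r : ℕ} (hr : A.rank = r) :
    ∃ (f : Fin r → m) (g : Fin r → n), Function.Injective f ∧ Function.Injective g ∧
      (A.submatrix f g).det ≠ 0 := by
  obtain ⟨f, hf, hfl⟩ := exists_injective_linearIndependent_col A.transpose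
    ((Matrix.rank_transpose A).trans hr)
  have hr' : (A.submatrix f id).rank = r := by
    have : LinearIndependent K (A.submatrix f id).row := hfl
    rw [this.rank_matrix, Fintype.card_fin]
  obtain ⟨g, hg, hgl⟩ := exists_injective_linearIndependent_col (A.submatrix f id) hr'
  refine ⟨f, g, hf, hg, ?_⟩
  have : LinearIndependent K (A.submatrix f g).col := hgl
  rw [Matrix.linearIndependent_cols_iff_isUnit, Matrix.isUnit_iff_isUnit_det] at this
  exact this.ne_zero

/-- The number of solutions of `A z ≡ 0` modulo `q`. -/
noncomputable def kerCard {m n : Type*} [Fintype n] (A : Matrix m n ℤ) (q : ℕ) : ℕ :=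
  Nat.card {z : n → ZMod q // (A.map (Int.castRingHom (ZMod q))).mulVec z = 0}

/-- The kernel modulo `q` has as many elements as the cokernel. That cokernel is the quotient of
`ℤⁿ` by `A ℤⁿ + q ℤⁿ`, and its order divides the index `|det A|` of `A ℤⁿ`. -/
theorem kerCard_dvd_det {ι : Type*} [Fintype ι] [DecidableEq ι] (A : Matrix ι ι ℤ)
    (hA : A.det ≠ 0) (q : ℕ) [NeZero q] : kerCard A q ∣ A.det.natAbs := by
  let f : (ι → ZMod q) →+ (ι → ZMod q) :=
    (A.map (Int.castRingHom (ZMod q))).mulVecLin.toAddMonoidHom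
  have h1 : kerCard A q = f.range.index := by
    have e1 := f.ker.card_mul_index
    have e2 := f.range.card_mul_index
    rw [AddSubgroup.index_ker] at e1
    have hpos : 0 < Nat.card f.range := Nat.card_pos
    have : Nat.card f.ker = f.range.index := by
      refine Nat.eq_of_mul_eq_mul_left hpos ?_
      rw [e2, mul_comm, e1]
    exact this
  let π : (ι → ℤ) →+ (ι → ZMod q) :=
    { toFun := fun x i => (x i : ZMod q)
      map_zero' := by ext; simp
      map_add' := by intro x y; ext; simp }
  have hπ : Function.Surjective π := by
    intro x
    choose y hy using fun i => ZMod.intCast_surjective (x i)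
    exact ⟨y, funext hy⟩
  let N : Submodule ℤ (ι → ℤ) := LinearMap.range A.mulVecLin
  have hinj : Function.Injective A.mulVecLin := by
    have := Matrix.mulVec_injective_of_det_ne_zero hA
    exact this
  let e : (ι → ℤ) ≃ₗ[ℤ] N := LinearEquiv.ofInjective A.mulVecLin hinj
  have h2 : A.det.natAbs = N.toAddSubgroup.index := by
    have := Submodule.natAbs_det_equiv N e
    have e3 : (N.subtype ∘ₗ AddMonoidHom.toIntLinearMap (e : (ι → ℤ) →+ N)) = A.mulVecLin := by
      ext; rfl
    rw [e3, ← Matrix.toLin'_apply', LinearMap.det_toLin'] at this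
    exact this
  rw [h1, h2, ← AddSubgroup.index_comap_of_surjective f.range hπ]
  refine AddSubgroup.index_dvd_of_le ?_
  rintro _ ⟨y, rfl⟩
  refine ⟨π y, ?_⟩
  ext i
  simp [f, π, Matrix.mulVec, dotProduct]

/-- The coordinates outside the range of `g` take at most `q ^ (n - r)` values. Two solutions
agreeing there differ by a vector supported on that range and killed by the minor. -/
theorem kerCard_le_mul {m n : Type*} [Fintype m] [Fintype n] [DecidableEq n] (A : Matrix m n ℤ)
    (q : ℕ) [NeZero q] {r : ℕ} (f : Fin r → m) {g : Fin r → n} (hg : Function.Injective g) :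
    kerCard A q ≤ q ^ (Fintype.card n - r) * kerCard (A.submatrix f g) q := by
  classical
  let s : Set n := Set.range g
  let X : Finset (n → ZMod q) :=
    {z | (A.map (Int.castRingHom (ZMod q))).mulVec z = 0}
  let Y : Finset (Fin r → ZMod q) :=
    {z | ((A.submatrix f g).map (Int.castRingHom (ZMod q))).mulVec z = 0}
  have hX : kerCard A q = X.card := by
    rw [kerCard, Nat.card_eq_fintype_card, Fintype.card_subtype]
  have hY : kerCard (A.submatrix f g) q = Y.card := by
    rw [kerCard, Nat.card_eq_fintype_card, Fintype.card_subtype]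
  rw [hX, hY]
  let φ : (n → ZMod q) → ((sᶜ : Set n) → ZMod q) := fun z i => z i
  have hcard : (X.image φ).card ≤ q ^ (Fintype.card n - r) := by
    refine (Finset.card_le_univ _).trans ?_
    rw [Fintype.card_fun, ZMod.card, Fintype.card_compl_set, Set.card_range_of_injective hg,
      Fintype.card_fin]
  have hfib : ∀ a ∈ X.image φ, (X.filter fun z => φ z = a).card ≤ Y.card := by
    intro a ha
    obtain ⟨z₀, hz₀, rfl⟩ := Finset.mem_image.1 ha
    have hz0 := (Finset.mem_filter.1 hz₀).2
    refine Finset.card_le_card_of_injOn (fun z i => z (g i) - z₀ (g i)) ?_ ?_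
    · intro z hz
      have hz1 := (Finset.mem_filter.1 (Finset.mem_filter.1 hz).1).2
      have hz2 := (Finset.mem_filter.1 hz).2
      have hsub : (A.map (Int.castRingHom (ZMod q))).mulVec (z - z₀) = 0 := by
        rw [Matrix.mulVec_sub, hz1, hz0, sub_zero]
      refine Finset.mem_coe.2 (Finset.mem_filter.2 ⟨Finset.mem_univ _, ?_⟩)
      ext i
      have := congrFun hsub (f i)
      simp only [Matrix.mulVec, dotProduct, Matrix.map_apply, Pi.sub_apply, Pi.zero_apply,
        Matrix.submatrix_apply] at this ⊢
      rw [← this]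
      rw [← Finset.sum_subset (Finset.subset_univ (Finset.univ.image g)),
        Finset.sum_image (fun a _ b _ h => hg h)]
      intro j _ hj
      have hj' : j ∈ sᶜ := by
        rintro ⟨k, rfl⟩
        exact hj (Finset.mem_image_of_mem _ (Finset.mem_univ _))
      have := congrFun hz2 ⟨j, hj'⟩
      simp only [φ] at this
      rw [this, sub_self, mul_zero]
    · intro z hz w hw hzw
      have hz2 := (Finset.mem_filter.1 hz).2
      have hw2 := (Finset.mem_filter.1 hw).2
      ext j
      by_cases hj : j ∈ s
      · obtain ⟨k, rfl⟩ := hj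
        have := congrFun hzw k
        simpa using this
      · have := congrFun (hz2.trans hw2.symm) ⟨j, hj⟩
        exact this
  calc X.card ≤ Y.card * (X.image φ).card := Finset.card_le_mul_card_image X _ hfib
    _ ≤ Y.card * q ^ (Fintype.card n - r) := Nat.mul_le_mul_left _ hcard
    _ = _ := mul_comm _ _

/-- The kernel of an integral matrix modulo a prime has prime power order. -/
theorem exists_kerCard_eq_pow {m n : Type*} [Fintype n] (A : Matrix m n ℤ) (p : ℕ)
    [Fact p.Prime] : ∃ e : ℕ, kerCard A p = p ^ e := by
  let W := LinearMap.ker (A.map (Int.castRingHom (ZMod p))).mulVecLin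
  refine ⟨Module.finrank (ZMod p) W, ?_⟩
  have : Nat.card W = Nat.card (ZMod p) ^ Module.finrank (ZMod p) W :=
    Module.natCard_eq_pow_finrank
  rw [Nat.card_zmod] at this
  exact this

/-! ### Weyl differencing and the van der Corput inequality. -/

theorem norm_stdAddChar {q : ℕ} [NeZero q] (x : ZMod q) : ‖(ZMod.stdAddChar x : ℂ)‖ = 1 := by
  rw [ZMod.stdAddChar_apply, Circle.norm_coe]

theorem stdAddChar_mul_conj {q : ℕ} [NeZero q] (x y : ZMod q) :
    (ZMod.stdAddChar x : ℂ) * (starRingEnd ℂ) (ZMod.stdAddChar y) = ZMod.stdAddChar (x - y) := by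
  rw [ZMod.stdAddChar_apply, ZMod.stdAddChar_apply, ZMod.stdAddChar_apply, ← Circle.coe_inv_eq_conj,
    ← Circle.coe_mul, sub_eq_add_neg, AddChar.map_add_eq_mul, AddChar.map_neg_eq_inv]

theorem sum_stdAddChar_hom {V : Type*} [AddCommGroup V] [Fintype V] {q : ℕ} [NeZero q]
    (L : V →+ ZMod q) (hL : L ≠ 0) : ∑ x, (ZMod.stdAddChar (L x) : ℂ) = 0 := by
  let χ : AddChar V ℂ := ZMod.stdAddChar.compAddMonoidHom L
  have hχ : χ ≠ 0 := by
    intro h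
    apply hL
    ext x
    have : χ x = 1 := by rw [h]; rfl
    exact ZMod.injective_stdAddChar (this.trans (AddChar.map_zero_eq_one _).symm)
  exact AddChar.sum_eq_zero_iff_ne_zero.2 hχ

/-- Weyl's bound for exponential sums with a quadratic phase. -/
theorem norm_sum_quadratic_sq_le {V : Type*} [AddCommGroup V] [Fintype V] {q : ℕ} [NeZero q]
    (φ : V → ZMod q) (L : V → (V →+ ZMod q)) (c : V → ZMod q)
    (h : ∀ x k, φ (x + k) - φ x = L k x + c k) :
    ‖∑ x, (ZMod.stdAddChar (φ x) : ℂ)‖ ^ 2 ≤ Fintype.card V * Nat.card {k // L k = 0} := by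
  classical
  have key : ((‖∑ x, (ZMod.stdAddChar (φ x) : ℂ)‖ ^ 2 : ℝ) : ℂ)
      = ∑ k, ZMod.stdAddChar (c k) * ∑ x, (ZMod.stdAddChar (L k x) : ℂ) := by
    rw [← Complex.normSq_eq_norm_sq, ← Complex.mul_conj, map_sum, Finset.sum_mul_sum,
      Finset.sum_comm]
    have : ∀ x, ∑ y, (ZMod.stdAddChar (φ y) : ℂ) * (starRingEnd ℂ) (ZMod.stdAddChar (φ x))
        = ∑ k, (ZMod.stdAddChar (c k) : ℂ) * ZMod.stdAddChar (L k x) := by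
      intro x
      rw [← Equiv.sum_comp (Equiv.addLeft x)]
      refine Finset.sum_congr rfl fun k _ => ?_
      rw [stdAddChar_mul_conj, Equiv.coe_addLeft, h, AddChar.map_add_eq_mul, mul_comm]
    rw [Finset.sum_congr rfl fun x _ => this x, Finset.sum_comm]
    exact Finset.sum_congr rfl fun k _ => (Finset.mul_sum _ _ _).symm
  have h2 : ‖((‖∑ x, (ZMod.stdAddChar (φ x) : ℂ)‖ ^ 2 : ℝ) : ℂ)‖
      ≤ ∑ k, if L k = 0 then (Fintype.card V : ℝ) else 0 := by
    rw [key]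
    refine norm_sum_le_of_le _ fun k _ => ?_
    split_ifs with hk
    · rw [norm_mul, norm_stdAddChar, one_mul]
      refine (norm_sum_le _ _).trans ?_
      simp
    · rw [sum_stdAddChar_hom _ hk, mul_zero, norm_zero]
  rw [Complex.norm_real, Real.norm_of_nonneg (by positivity)] at h2
  refine h2.trans (le_of_eq ?_)
  rw [← Finset.sum_filter, Finset.sum_const, nsmul_eq_mul, Nat.card_eq_fintype_card,
    Fintype.card_subtype, mul_comm]

/-- The differenced sum `∑ x, e(a (F(x + u) - F(x)) / q)`. -/
noncomputable def diffSum (F : MvPolynomial (Fin n) ℤ) (q : ℕ) [NeZero q] (a : ZMod q)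
    (u : Fin n → ℤ) : ℂ :=
  ∑ x : Fin n → ZMod q,
    ZMod.stdAddChar (a * (aeval (x + fun i => (u i : ZMod q)) F - aeval x F))

theorem norm_diffSum_sq_le {F : MvPolynomial (Fin n) ℤ} (hF : F.IsHomogeneous 3) (q : ℕ)
    [NeZero q] (a : (ZMod q)ˣ) (u : Fin n → ℤ) :
    ‖diffSum F q a u‖ ^ 2 ≤ (q : ℝ) ^ n * kerCard (hess F u) q := by
  let v : Fin n → ZMod q := fun i => (u i : ZMod q)
  let L : (Fin n → ZMod q) → ((Fin n → ZMod q) →+ ZMod q) := fun k =>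
    { toFun := fun x => a * tri F x v k
      map_zero' := by
        have := tri_smul_left F 0 0 v k
        rw [zero_smul, zero_mul] at this
        rw [this, mul_zero]
      map_add' := by intro x y; rw [tri_add_left, mul_add] }
  have := norm_sum_quadratic_sq_le (q := q)
    (fun x : Fin n → ZMod q => (a : ZMod q) * (aeval (x + v) F - aeval x F)) L
    (fun k => a * (aeval (v + k) F - aeval v F - aeval k F)) (by
      intro x k
      change (a : ZMod q) * _ - a * _ = a * tri F x v k + _
      rw [← mul_sub, ← mul_add, ← aeval_second_difference hF, add_right_comm])
  refine this.trans ?_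
  rw [Fintype.card_fun, ZMod.card, Fintype.card_fin, Nat.cast_pow]
  refine mul_le_mul_of_nonneg_left ?_ (by positivity)
  rw [kerCard, Nat.cast_le]
  refine Nat.card_le_card_of_injective (fun k => ⟨k.1, ?_⟩) ?_
  · ext i
    -- Testing the vanishing linear form `x ↦ a T(x, u, k)` on unit vectors, with `a` invertible,
    -- yields the rows of `hess F u * k = 0`.
    have h1 := DFunLike.congr_fun k.2 (Pi.single i 1)
    change (a : ZMod q) * tri F (Pi.single i 1) v k.1 = 0 at h1
    rw [Units.mul_right_eq_zero, tri_eq_dotProduct_map, single_dotProduct, one_mul] at h1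
    exact h1
  · intro k l h
    exact Subtype.ext (congrArg (fun z => z.1) h)

/-- The integral vectors with all entries less than `H` in absolute value. -/
noncomputable def box (n H : ℕ) : Finset (Fin n → ℤ) :=
  Fintype.piFinset fun _ => Finset.Ioo (-(H : ℤ)) H

theorem mem_box {H : ℕ} {u : Fin n → ℤ} : u ∈ box n H ↔ ∀ i, |u i| < H := by
  simp [box, Fintype.mem_piFinset, abs_lt]

/-- The van der Corput inequality for a family of functions on `(ℤ / q ℤ) ^ n`. -/
theorem sum_norm_sum_sq_le {ι : Type*} (s : Finset ι) (q : ℕ) [NeZero q]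
    (f : ι → (Fin n → ZMod q) → ℂ) {H : ℕ} (hH : 0 < H) :
    ∑ a ∈ s, ‖∑ x, f a x‖ ^ 2 ≤ (q : ℝ) ^ n / (H : ℝ) ^ n * ∑ u ∈ box n H,
      ‖∑ a ∈ s, ∑ x, f a (x + fun i => (u i : ZMod q)) * (starRingEnd ℂ) (f a x)‖ := by
  classical
  let S : Finset (Fin n → ℤ) := Fintype.piFinset fun _ => Finset.Ico (0 : ℤ) H
  let π : (Fin n → ℤ) → (Fin n → ZMod q) := fun u i => (u i : ZMod q)
  have hπ : ∀ u v, π (u - v) = π u - π v := by intro u v; ext i; simp [π]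
  have hS : (S.card : ℝ) = (H : ℝ) ^ n := by simp [S, Fintype.card_piFinset]
  let E : (Fin n → ℤ) → ℂ := fun u =>
    ∑ a ∈ s, ∑ x, f a (x + π u) * (starRingEnd ℂ) (f a x)
  have hV : (Fintype.card (Fin n → ZMod q) : ℝ) = (q : ℝ) ^ n := by
    rw [Fintype.card_fun, ZMod.card, Fintype.card_fin, Nat.cast_pow]
  have h1 : ∀ a, (H : ℝ) ^ n * (H : ℝ) ^ n * ‖∑ x, f a x‖ ^ 2
      ≤ (q : ℝ) ^ n * ∑ x, ‖∑ h ∈ S, f a (x + π h)‖ ^ 2 := by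
    intro a
    have e : ((H : ℝ) ^ n : ℂ) * ∑ x, f a x = ∑ x, ∑ h ∈ S, f a (x + π h) := by
      rw [Finset.sum_comm]
      have : ∀ h ∈ S, ∑ x, f a (x + π h) = ∑ x, f a x := fun h _ =>
        Equiv.sum_comp (Equiv.addRight (π h)) (f a)
      rw [Finset.sum_congr rfl this, Finset.sum_const, nsmul_eq_mul]
      congr 1
      exact_mod_cast hS.symm
    have e2 : (H : ℝ) ^ n * (H : ℝ) ^ n * ‖∑ x, f a x‖ ^ 2
        = ‖∑ x, ∑ h ∈ S, f a (x + π h)‖ ^ 2 := by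
      rw [← e, norm_mul, mul_pow, ← Complex.ofReal_pow, Complex.norm_real,
        Real.norm_of_nonneg (by positivity)]
      ring
    rw [e2]
    calc ‖∑ x, ∑ h ∈ S, f a (x + π h)‖ ^ 2 ≤ (∑ x, ‖∑ h ∈ S, f a (x + π h)‖) ^ 2 := by
          gcongr
          exact norm_sum_le _ _
      _ ≤ _ := by
          have := sq_sum_le_card_mul_sum_sq (s := Finset.univ)
            (f := fun x => ‖∑ h ∈ S, f a (x + π h)‖)
          rwa [Finset.card_univ, hV] at this
  have h2 : ((∑ a ∈ s, ∑ x, ‖∑ h ∈ S, f a (x + π h)‖ ^ 2 : ℝ) : ℂ)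
      = ∑ k ∈ S, ∑ h ∈ S, E (h - k) := by
    push_cast
    have e : ∀ a, ∑ x, (‖∑ h ∈ S, f a (x + π h)‖ : ℂ) ^ 2
        = ∑ k ∈ S, ∑ h ∈ S, ∑ x, f a (x + π (h - k)) * (starRingEnd ℂ) (f a x) := by
      intro a
      have : ∀ x, (‖∑ h ∈ S, f a (x + π h)‖ : ℂ) ^ 2
          = ∑ k ∈ S, ∑ h ∈ S, f a (x + π h) * (starRingEnd ℂ) (f a (x + π k)) := by
        intro x
        rw [← Complex.ofReal_pow, ← Complex.normSq_eq_norm_sq, ← Complex.mul_conj, map_sum,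
          Finset.sum_mul_sum, Finset.sum_comm]
      rw [Finset.sum_congr rfl fun x _ => this x, Finset.sum_comm]
      refine Finset.sum_congr rfl fun k _ => ?_
      rw [Finset.sum_comm]
      refine Finset.sum_congr rfl fun h _ => ?_
      rw [← Equiv.sum_comp (Equiv.addRight (π k)) fun x =>
        f a (x + π (h - k)) * (starRingEnd ℂ) (f a x)]
      refine Finset.sum_congr rfl fun x _ => ?_
      have : x + π k + (π h - π k) = x + π h := by abel
      rw [hπ, Equiv.coe_addRight, this]
    rw [Finset.sum_congr rfl fun a _ => e a, Finset.sum_comm]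
    refine Finset.sum_congr rfl fun k _ => ?_
    rw [Finset.sum_comm]
  -- For each of the `H ^ n` values of `k`, the differences `h - k` are distinct points of the box.
  have h3 : ∑ a ∈ s, ∑ x, ‖∑ h ∈ S, f a (x + π h)‖ ^ 2
      ≤ (H : ℝ) ^ n * ∑ u ∈ box n H, ‖E u‖ := by
    have : ∑ a ∈ s, ∑ x, ‖∑ h ∈ S, f a (x + π h)‖ ^ 2
        = ‖((∑ a ∈ s, ∑ x, ‖∑ h ∈ S, f a (x + π h)‖ ^ 2 : ℝ) : ℂ)‖ := by
      rw [Complex.norm_real, Real.norm_of_nonneg]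
      positivity
    rw [this, h2, ← hS, ← nsmul_eq_mul, ← Finset.sum_const]
    refine norm_sum_le_of_le _ fun k hk => (norm_sum_le _ _).trans ?_
    rw [← Finset.sum_image (f := fun u => ‖E u‖) (g := fun h => h - k)
      (fun a _ b _ hab => sub_left_injective hab)]
    refine Finset.sum_le_sum_of_subset_of_nonneg ?_ fun _ _ _ => norm_nonneg _
    intro u hu
    obtain ⟨h, hh, rfl⟩ := Finset.mem_image.1 hu
    rw [mem_box]
    intro i
    have e1 := Finset.mem_Ico.1 (Fintype.mem_piFinset.1 hh i)
    have e2 := Finset.mem_Ico.1 (Fintype.mem_piFinset.1 hk i)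
    rw [Pi.sub_apply, abs_lt]
    constructor <;> linarith [e1.1, e1.2, e2.1, e2.2]
  have hHn : (0 : ℝ) < (H : ℝ) ^ n := by positivity
  have h4 : (H : ℝ) ^ n * (H : ℝ) ^ n * ∑ a ∈ s, ‖∑ x, f a x‖ ^ 2
      ≤ (q : ℝ) ^ n * ((H : ℝ) ^ n * ∑ u ∈ box n H, ‖E u‖) := by
    rw [Finset.mul_sum]
    refine (Finset.sum_le_sum fun a _ => h1 a).trans ?_
    rw [← Finset.mul_sum]
    exact mul_le_mul_of_nonneg_left h3 (by positivity)
  change _ ≤ (q : ℝ) ^ n / (H : ℝ) ^ n * ∑ u ∈ box n H, ‖E u‖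
  rw [div_mul_eq_mul_div, le_div_iff₀ hHn]
  refine le_of_mul_le_mul_left ?_ hHn
  calc _ = (H : ℝ) ^ n * (H : ℝ) ^ n * ∑ a ∈ s, ‖∑ x, f a x‖ ^ 2 := by ring
    _ ≤ _ := h4
    _ = _ := by ring

/-- The sum over `a` stays inside the absolute value: a singleton `s` gives the pointwise bound, and
the full set of nonzero residues gives the cancellation exploited at primes. -/
theorem sum_norm_charSum_sq_le (F : MvPolynomial (Fin n) ℤ) (q : ℕ) [NeZero q]
    (s : Finset (ZMod q)) {H : ℕ} (hH : 0 < H) :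
    ∑ a ∈ s, ‖charSum F q a‖ ^ 2
      ≤ (q : ℝ) ^ n / (H : ℝ) ^ n * ∑ u ∈ box n H, ‖∑ a ∈ s, diffSum F q a u‖ := by
  refine (sum_norm_sum_sq_le s q (fun a x => ZMod.stdAddChar (a * aeval x F)) hH).trans
    (le_of_eq ?_)
  congr 1
  refine Finset.sum_congr rfl fun u _ => ?_
  congr 1
  refine Finset.sum_congr rfl fun a _ => Finset.sum_congr rfl fun x _ => ?_
  rw [stdAddChar_mul_conj, mul_sub]

/-! ### Ranks and minors of the Hessian at points of a box. -/

theorem exists_minor_bound (F : MvPolynomial (Fin n) ℤ) :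
    ∃ c : ℝ, 1 ≤ c ∧ ∀ H : ℕ, 0 < H → ∀ u ∈ box n H, ∀ r ≤ n, ∀ f g : Fin r → Fin n,
      (((hess F u).submatrix f g).det.natAbs : ℝ) ≤ c * (H : ℝ) ^ r := by
  let m : ℤ := ∑ i, ∑ j, ∑ k, |triCoeff F i j k|
  have hm : 0 ≤ m := by positivity
  refine ⟨(n.factorial : ℝ) * ((m : ℝ) + 1) ^ n, ?_, ?_⟩
  · have h1 : (1 : ℝ) ≤ n.factorial := by exact_mod_cast n.factorial_pos
    have h2 : (1 : ℝ) ≤ ((m : ℝ) + 1) ^ n := by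
      apply one_le_pow₀
      have : (0 : ℝ) ≤ m := by exact_mod_cast hm
      linarith
    nlinarith
  · intro H hH u hu r hr f g
    have hent : ∀ j k, |hess F u j k| ≤ (m + 1) * H := by
      intro j k
      have h1 : |hess F u j k| ≤ ∑ i, |triCoeff F i j k| * H := by
        rw [hess, Matrix.of_apply]
        refine (Finset.abs_sum_le_sum_abs _ _).trans (Finset.sum_le_sum fun i _ => ?_)
        rw [abs_mul]
        exact mul_le_mul_of_nonneg_left (mem_box.1 hu i).le (abs_nonneg _)
      have h2 : ∑ i, |triCoeff F i j k| ≤ m := by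
        refine Finset.sum_le_sum fun i _ => ?_
        calc |triCoeff F i j k| ≤ ∑ k', |triCoeff F i j k'| :=
              Finset.single_le_sum (f := fun k' => |triCoeff F i j k'|)
                (fun _ _ => abs_nonneg _) (Finset.mem_univ k)
          _ ≤ _ := Finset.single_le_sum (f := fun j' => ∑ k', |triCoeff F i j' k'|)
                (fun _ _ => by positivity) (Finset.mem_univ j)
      rw [← Finset.sum_mul] at h1
      have hH' : (0 : ℤ) ≤ H := Int.natCast_nonneg H
      nlinarith
    have hdet : |((hess F u).submatrix f g).det| ≤ (r.factorial : ℤ) * ((m + 1) * H) ^ r := by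
      have := Matrix.det_le (A := (hess F u).submatrix f g) (abv := AbsoluteValue.abs)
        (x := (m + 1) * H) (fun i j => hent (f i) (g j))
      simpa [nsmul_eq_mul] using this
    have hcast : (((hess F u).submatrix f g).det.natAbs : ℝ)
        ≤ (r.factorial : ℝ) * (((m : ℝ) + 1) * H) ^ r := by
      rw [Nat.cast_natAbs]
      exact_mod_cast hdet
    refine hcast.trans ?_
    rw [mul_pow, ← mul_assoc]
    have hm' : (1 : ℝ) ≤ (m : ℝ) + 1 := by
      have : (0 : ℝ) ≤ m := by exact_mod_cast hm
      linarith
    gcongr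

theorem GeometricCondition.card_le {F : MvPolynomial (Fin n) ℤ} (hgc : GeometricCondition F)
    {ε : ℝ} (hε : 0 < ε) :
    ∃ K : ℝ, 0 < K ∧ ∀ H : ℕ, 0 < H → ∀ r ≤ n,
      (((box n H).filter fun u => (matrixM F u).rank = r).card : ℝ) ≤ K * (H : ℝ) ^ (r + ε) := by
  have h : ∀ r : ℕ, ∃ K : ℝ, r ≤ n → ∀ P : ℝ, 1 ≤ P →
    (Set.ncard {x : Fin n → ℤ | (∀ i, |(x i : ℝ)| ≤ P) ∧ (matrixM F x).rank = r} : ℝ)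
      ≤ K * P ^ ((r : ℝ) + ε) := by
    intro r
    by_cases hr : r ≤ n
    · obtain ⟨K, hK⟩ := hgc r hr ε hε
      exact ⟨K, fun _ => hK⟩
    · exact ⟨0, fun h => absurd h hr⟩
  choose K hK using h
  refine ⟨1 + ∑ r ∈ Finset.range (n + 1), |K r|, by positivity, ?_⟩
  intro H hH r hr
  have hH1 : (1 : ℝ) ≤ H := by exact_mod_cast hH
  have h1 := hK r hr H hH1
  have hfin : Set.Finite {x : Fin n → ℤ | (∀ i, |(x i : ℝ)| ≤ H) ∧ (matrixM F x).rank = r} := by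
    refine (Fintype.piFinset fun _ : Fin n => Finset.Icc (-(H : ℤ)) H).finite_toSet.subset ?_
    rintro x ⟨hx, -⟩
    refine Fintype.mem_piFinset.2 fun i => Finset.mem_Icc.2 (abs_le.1 ?_)
    exact_mod_cast hx i
  have h2 : ((box n H).filter fun u => (matrixM F u).rank = r).card
      ≤ Set.ncard {x : Fin n → ℤ | (∀ i, |(x i : ℝ)| ≤ H) ∧ (matrixM F x).rank = r} := by
    rw [← Set.ncard_coe_finset]
    refine Set.ncard_le_ncard ?_ hfin
    intro u hu
    obtain ⟨hu, hr⟩ := Finset.mem_filter.1 hu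
    refine ⟨fun i => ?_, hr⟩
    exact_mod_cast (mem_box.1 hu i).le
  calc _ ≤ (Set.ncard {x : Fin n → ℤ | (∀ i, |(x i : ℝ)| ≤ H) ∧ (matrixM F x).rank = r} : ℝ) := by
        exact_mod_cast h2
    _ ≤ K r * (H : ℝ) ^ (r + ε) := h1
    _ ≤ _ := by
      refine mul_le_mul_of_nonneg_right ?_ (by positivity)
      have := Finset.single_le_sum (f := fun r => |K r|) (fun _ _ => abs_nonneg _)
        (Finset.mem_range.2 (Nat.lt_succ_of_le hr))
      have h3 := le_abs_self (K r)
      linarith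

theorem rank_le (F : MvPolynomial (Fin n) ℤ) (u : Fin n → ℤ) : (matrixM F u).rank ≤ n :=
  (Matrix.rank_le_width _)

theorem sum_box_eq {M : Type*} [AddCommMonoid M] (F : MvPolynomial (Fin n) ℤ) (H : ℕ)
    (φ : (Fin n → ℤ) → M) :
    ∑ u ∈ box n H, φ u = ∑ r ∈ Finset.range (n + 1),
      ∑ u ∈ (box n H).filter fun u => (matrixM F u).rank = r, φ u :=
  (Finset.sum_fiberwise_of_maps_to
    (fun u _ => Finset.mem_range.2 (Nat.lt_succ_of_le (rank_le F u))) _).symm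

theorem exists_minor (F : MvPolynomial (Fin n) ℤ) (u : Fin n → ℤ) {r : ℕ}
    (hr : (matrixM F u).rank = r) :
    ∃ (f g : Fin r → Fin n), Function.Injective f ∧ Function.Injective g ∧
      ((hess F u).submatrix f g).det ≠ 0 := by
  rw [rank_matrixM] at hr
  obtain ⟨f, g, hf, hg, h⟩ := exists_submatrix_det_ne_zero _ hr
  refine ⟨f, g, hf, hg, fun h0 => h ?_⟩
  have := RingHom.map_det (Int.castRingHom ℚ) ((hess F u).submatrix f g)
  rw [h0, map_zero] at this
  exact this.symm

theorem det_hess_ne_zero (F : MvPolynomial (Fin n) ℤ) (u : Fin n → ℤ)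
    (hr : (matrixM F u).rank = n) : (hess F u).det ≠ 0 := by
  obtain ⟨f, g, hf, hg, h⟩ := exists_minor F u hr
  intro h0
  apply h
  let e := Equiv.ofBijective f (Finite.injective_iff_bijective.1 hf)
  let e' := Equiv.ofBijective g (Finite.injective_iff_bijective.1 hg)
  have h1 : (hess F u).submatrix f g = ((hess F u).submatrix e e).submatrix id (e'.trans e.symm) := by
    ext i j
    simp [e, e', Equiv.ofBijective_apply_symm_apply]
  rw [h1, Matrix.det_permute', Matrix.det_submatrix_equiv_self, h0, mul_zero]

theorem box_card (n H : ℕ) : (box n H).card = (2 * H - 1) ^ n := by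
  rw [box, Fintype.card_piFinset]
  simp only [Int.card_Ioo, Finset.prod_const, Finset.card_univ, Fintype.card_fin]
  congr 1
  omega

/-- If the Hessian determinant vanished at every point, all ranks would be below `n`, and the
Geometric Condition would leave room for only `O(H ^ (n - 1/2))` of the at least `H ^ n` points of
the box. -/
theorem exists_det_hess_ne_zero {F : MvPolynomial (Fin n) ℤ}
    (hgc : GeometricCondition F) : ∃ u, (hess F u).det ≠ 0 := by
  by_contra! hcon
  have hlt : ∀ u, (matrixM F u).rank < n := fun u =>
    lt_of_le_of_ne (rank_le F u) fun h => det_hess_ne_zero F u h (hcon u)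
  obtain ⟨K, hK, hcard⟩ := hgc.card_le (ε := 1 / 2) (by norm_num)
  have key : ∀ H : ℕ, 0 < H → (H : ℝ) ^ n ≤ n * K * (H : ℝ) ^ ((n : ℝ) - 1 / 2) := by
    intro H hH
    have hH1 : (1 : ℝ) ≤ H := by exact_mod_cast hH
    have h1 : (H : ℝ) ^ n ≤ (box n H).card := by
      rw [box_card]
      have : H ≤ 2 * H - 1 := by omega
      exact_mod_cast Nat.pow_le_pow_left this n
    have h2 : (box n H).card = ∑ r ∈ Finset.range n,
        ((box n H).filter fun u => (matrixM F u).rank = r).card :=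
      Finset.card_eq_sum_card_fiberwise fun u _ => Finset.mem_coe.2 (Finset.mem_range.2 (hlt u))
    refine h1.trans ?_
    rw [h2]
    push_cast
    calc ∑ r ∈ Finset.range n, (((box n H).filter fun u => (matrixM F u).rank = r).card : ℝ)
        ≤ ∑ _r ∈ Finset.range n, K * (H : ℝ) ^ ((n : ℝ) - 1 / 2) := by
          refine Finset.sum_le_sum fun r hr => (hcard H hH r (Finset.mem_range.1 hr).le).trans ?_
          have : (r : ℝ) + 1 ≤ n := by exact_mod_cast Finset.mem_range.1 hr
          gcongr
          linarith
      _ = _ := by simp; ring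
  have key2 : ∀ H : ℕ, 0 < H → (H : ℝ) ^ (1 / 2 : ℝ) ≤ n * K := by
    intro H hH
    have hH1 : (0 : ℝ) < H := by exact_mod_cast hH
    have h := key H hH
    rw [Real.rpow_sub hH1, Real.rpow_natCast] at h
    have h3 : (0 : ℝ) < (H : ℝ) ^ n := by positivity
    have h4 : (0 : ℝ) < (H : ℝ) ^ (1 / 2 : ℝ) := by positivity
    rw [← mul_div_assoc, le_div_iff₀ h4] at h
    nlinarith
  obtain ⟨N, hN⟩ := exists_nat_gt (n * K)
  -- For `H = (N + 1) ^ 2` the square root is `N + 1`, which exceeds `n K`.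
  have h := key2 ((N + 1) ^ 2) (by positivity)
  rw [Nat.cast_pow, ← Real.rpow_natCast, ← Real.rpow_mul (by positivity)] at h
  norm_num at h
  linarith

/-! ### The pointwise bound for all moduli. -/

theorem exists_cube_root (q : ℕ) : ∃ H : ℕ, H ^ 3 ≤ q ∧ q < (H + 1) ^ 3 := by
  refine ⟨Nat.findGreatest (fun h => h ^ 3 ≤ q) q, ?_, ?_⟩
  · exact Nat.findGreatest_spec (P := fun h => h ^ 3 ≤ q) (Nat.zero_le q) (by simp)
  · by_contra! h
    have h1 : Nat.findGreatest (fun h => h ^ 3 ≤ q) q + 1 ≤ q :=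
      (Nat.le_self_pow (by norm_num) _).trans h
    have := Nat.le_findGreatest (P := fun h => h ^ 3 ≤ q) h1 h
    omega

/-- The basic estimate for complete exponential sums, valid for all moduli. -/
theorem exists_norm_charSum_le (hn : 10 ≤ n) {F : MvPolynomial (Fin n) ℤ}
    (hF : F.IsHomogeneous 3) (hgc : GeometricCondition F) :
    ∃ C : ℝ, 0 < C ∧ ∀ (q : ℕ) [NeZero q] (a : (ZMod q)ˣ),
      ‖charSum F q a / (q : ℂ) ^ n‖ ≤ C * (q : ℝ) ^ (-(8 / 5) : ℝ) := by
  obtain ⟨c, hc, hminor⟩ := exists_minor_bound F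
  -- The method saves `q ^ ((10 - ε) / 6)`. Any `ε < 1` makes this exponent exceed `3 / 2`, which is
  -- what summability over squares of primes requires.
  obtain ⟨K, hK, hcard⟩ := hgc.card_le (ε := 2 / 5) (by norm_num)
  let C₀ : ℝ := (n + 1) * K * √c * 2 ^ (48 / 5 : ℝ)
  have hC₀ : 0 < C₀ := by
    have : 0 < √c := Real.sqrt_pos.2 (by linarith)
    positivity
  refine ⟨√C₀, Real.sqrt_pos.2 hC₀, ?_⟩
  intro q _ a
  have hq : 0 < q := Nat.pos_of_ne_zero (NeZero.ne q)
  have hq1 : (0 : ℝ) < q := by exact_mod_cast hq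
  obtain ⟨H, hH3, hH4⟩ := exists_cube_root q
  have hH : 0 < H := by
    rcases Nat.eq_zero_or_pos H with rfl | h
    · norm_num at hH4; omega
    · exact h
  have hH1 : (1 : ℝ) ≤ H := by exact_mod_cast hH
  have hH0 : (0 : ℝ) < H := by linarith
  have hH3' : (H : ℝ) ^ 3 ≤ q := by exact_mod_cast hH3
  have hdiff : ∀ u ∈ box n H, ∀ r, (matrixM F u).rank = r →
      ‖diffSum F q a u‖ ≤ (q : ℝ) ^ n * √c / (H : ℝ) ^ r := by
    intro u hu r hr
    have hrn : r ≤ n := hr ▸ rank_le F u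
    obtain ⟨f, g, hf, hg, hdet⟩ := exists_minor F u hr
    have h1 := norm_diffSum_sq_le hF q a u
    have h2 := kerCard_le_mul (hess F u) q f hg
    have h3 := Nat.le_of_dvd (Int.natAbs_pos.2 hdet) (kerCard_dvd_det _ hdet q)
    have h4 := hminor H hH u hu r hrn f g
    rw [Fintype.card_fin] at h2
    have h5 : (kerCard (hess F u) q : ℝ) ≤ (q : ℝ) ^ (n - r) * (c * (H : ℝ) ^ r) := by
      calc (kerCard (hess F u) q : ℝ)
          ≤ (q : ℝ) ^ (n - r) * kerCard ((hess F u).submatrix f g) q := by exact_mod_cast h2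
        _ ≤ _ := by
          gcongr
          refine le_trans ?_ h4
          exact_mod_cast h3
    refine abs_le_of_sq_le_sq' ?_ (by positivity) |>.2
    -- This is where `H ^ 3 ≤ q` enters: it turns the Weyl bound `q ^ n √(c H ^ r / q ^ r)` into `q
    -- ^ n √c / H ^ r`, which matches the `H ^ (r + ε)` points of rank `r` for every `r` at once.
    have h6 : (H : ℝ) ^ (3 * r) ≤ (q : ℝ) ^ r := by
      rw [pow_mul]; gcongr
    rw [div_pow, mul_pow, Real.sq_sqrt (by linarith), le_div_iff₀ (by positivity)]
    calc ‖diffSum F q a u‖ ^ 2 * ((H : ℝ) ^ r) ^ 2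
        ≤ ((q : ℝ) ^ n * ((q : ℝ) ^ (n - r) * (c * (H : ℝ) ^ r))) * ((H : ℝ) ^ r) ^ 2 := by
          gcongr
          exact h1.trans (by gcongr)
      _ = (q : ℝ) ^ n * (q : ℝ) ^ (n - r) * c * (H : ℝ) ^ (3 * r) := by ring
      _ ≤ (q : ℝ) ^ n * (q : ℝ) ^ (n - r) * c * (q : ℝ) ^ r := by gcongr
      _ = (q : ℝ) ^ n * ((q : ℝ) ^ (n - r) * (q : ℝ) ^ r) * c := by ring
      _ = _ := by rw [← pow_add, Nat.sub_add_cancel hrn]; ring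
  have hsum : ∑ u ∈ box n H, ‖diffSum F q a u‖
      ≤ (n + 1) * (K * ((q : ℝ) ^ n * √c * (H : ℝ) ^ (2 / 5 : ℝ))) := by
    rw [sum_box_eq F]
    calc _ ≤ ∑ r ∈ Finset.range (n + 1), K * ((q : ℝ) ^ n * √c * (H : ℝ) ^ (2 / 5 : ℝ)) := by
          refine Finset.sum_le_sum fun r hr => ?_
          have h1 := hcard H hH r (Nat.lt_succ_iff.1 (Finset.mem_range.1 hr))
          calc _ ≤ ∑ u ∈ (box n H).filter fun u => (matrixM F u).rank = r,
                (q : ℝ) ^ n * √c / (H : ℝ) ^ r :=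
                Finset.sum_le_sum fun u hu => hdiff u (Finset.mem_filter.1 hu).1 r
                  (Finset.mem_filter.1 hu).2
            _ = (((box n H).filter fun u => (matrixM F u).rank = r).card : ℝ)
                * ((q : ℝ) ^ n * √c / (H : ℝ) ^ r) := by rw [Finset.sum_const, nsmul_eq_mul]
            _ ≤ K * (H : ℝ) ^ ((r : ℝ) + 2 / 5) * ((q : ℝ) ^ n * √c / (H : ℝ) ^ r) := by gcongr
            _ = _ := by
              rw [Real.rpow_add hH0, Real.rpow_natCast]
              field_simp
      _ = _ := by simp
  have hvdc := sum_norm_charSum_sq_le F q {(a : ZMod q)} hH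
  simp only [Finset.sum_singleton] at hvdc
  have hfin : ‖charSum F q a‖ ^ 2
      ≤ ((q : ℝ) ^ n) ^ 2 * ((n + 1) * K * √c * (H : ℝ) ^ (-(48 / 5) : ℝ)) := by
    refine hvdc.trans ?_
    have h1 : (H : ℝ) ^ (2 / 5 : ℝ) / (H : ℝ) ^ n ≤ (H : ℝ) ^ (-(48 / 5) : ℝ) := by
      rw [← Real.rpow_natCast, ← Real.rpow_sub hH0]
      have : (10 : ℝ) ≤ n := by exact_mod_cast hn
      refine Real.rpow_le_rpow_of_exponent_le hH1 ?_
      linarith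
    calc _ ≤ (q : ℝ) ^ n / (H : ℝ) ^ n
          * ((n + 1) * (K * ((q : ℝ) ^ n * √c * (H : ℝ) ^ (2 / 5 : ℝ)))) := by gcongr
      _ = ((q : ℝ) ^ n) ^ 2 * ((n + 1) * K * √c * ((H : ℝ) ^ (2 / 5 : ℝ) / (H : ℝ) ^ n)) := by
        ring
      _ ≤ _ := by gcongr
  have hHq : (H : ℝ) ^ (-(48 / 5) : ℝ) ≤ 2 ^ (48 / 5 : ℝ) * ((q : ℝ) ^ (-(8 / 5) : ℝ)) ^ 2 := by
    have h1 : (q : ℝ) ≤ (2 * H) ^ 3 := by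
      have h : (H + 1) ^ 3 ≤ (2 * H) ^ 3 := Nat.pow_le_pow_left (by omega) 3
      exact_mod_cast hH4.le.trans h
    have h2 : ((2 * (H : ℝ)) ^ 3) ^ (-(16 / 5) : ℝ) ≤ (q : ℝ) ^ (-(16 / 5) : ℝ) :=
      Real.rpow_le_rpow_of_nonpos hq1 h1 (by norm_num)
    have h3 : ((q : ℝ) ^ (-(8 / 5) : ℝ)) ^ 2 = (q : ℝ) ^ (-(16 / 5) : ℝ) := by
      rw [← Real.rpow_natCast, ← Real.rpow_mul hq1.le]; norm_num
    rw [h3]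
    refine le_trans (le_of_eq ?_) (mul_le_mul_of_nonneg_left h2 (by positivity))
    rw [← Real.rpow_natCast, ← Real.rpow_mul (by positivity),
      Real.mul_rpow (by norm_num) hH0.le, ← mul_assoc, ← Real.rpow_add (by norm_num)]
    norm_num
  rw [norm_div, norm_pow, Complex.norm_natCast, div_le_iff₀ (by positivity)]
  refine abs_le_of_sq_le_sq' ?_ (by positivity) |>.2
  refine hfin.trans ?_
  rw [mul_pow, mul_pow, Real.sq_sqrt hC₀.le]
  calc _ ≤ ((q : ℝ) ^ n) ^ 2 * ((n + 1) * K * √c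
        * (2 ^ (48 / 5 : ℝ) * ((q : ℝ) ^ (-(8 / 5) : ℝ)) ^ 2)) := by gcongr
    _ = _ := by simp only [C₀]; ring

/-! ### Prime moduli: averaging over the numerators. -/

theorem norm_sum_sq_phase_le {p : ℕ} [Fact p.Prime] (hp2 : p ≠ 2) {b : ZMod p} (hb : b ≠ 0) :
    ‖∑ t : ZMod p, (ZMod.stdAddChar (b * t ^ 2) : ℂ)‖ ≤ √p := by
  have h2 : (2 : ZMod p) ≠ 0 := by
    intro h
    have : ((2 : ℕ) : ZMod p) = 0 := by exact_mod_cast h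
    rw [ZMod.natCast_eq_zero_iff] at this
    exact hp2 ((Nat.prime_dvd_prime_iff_eq Fact.out Nat.prime_two).1 this)
  have h := norm_sum_quadratic_sq_le (q := p) (fun t : ZMod p => b * t ^ 2)
    (fun k => AddMonoidHom.mulLeft (2 * b * k)) (fun k => b * k ^ 2) (by
      intro x k
      simp only [AddMonoidHom.coe_mulLeft]
      ring)
  have hc : Nat.card {k : ZMod p // AddMonoidHom.mulLeft (2 * b * k) = 0} = 1 := by
    rw [Nat.card_eq_one_iff_unique]
    refine ⟨⟨fun x y => ?_⟩, ⟨⟨0, by ext; simp⟩⟩⟩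
    have hz : ∀ x : {k : ZMod p // AddMonoidHom.mulLeft (2 * b * k) = 0}, x.1 = 0 := by
      intro x
      have := DFunLike.congr_fun x.2 1
      simpa [h2, hb] using this
    exact Subtype.ext ((hz x).trans (hz y).symm)
  rw [hc, ZMod.card, Nat.cast_one, mul_one] at h
  exact Real.le_sqrt_of_sq_le h

theorem aeval_smul_eq {F : MvPolynomial (Fin n) ℤ} (hF : F.IsHomogeneous 3) (q : ℕ)
    (c : ZMod q) (v : Fin n → ZMod q) : aeval (c • v) F = c ^ 3 * aeval v F := by
  obtain ⟨c, rfl⟩ := ZMod.intCast_surjective c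
  obtain ⟨v, rfl⟩ := exists_intCast_eq q v
  have : ((c : ZMod q) • fun i => (v i : ZMod q)) = fun i => ((c • v) i : ZMod q) := by
    ext i; simp
  rw [this, aeval_intCast, aeval_intCast, eval_smul_eq hF]
  push_cast
  ring

/-- Averaging the differenced sums over the residues modulo a prime `p` saves a factor `√p`
unless `p ∣ F(u)`. -/
theorem norm_sum_diffSum_le_of_not_dvd {F : MvPolynomial (Fin n) ℤ} (hF : F.IsHomogeneous 3)
    {p : ℕ} [Fact p.Prime] (hp2 : p ≠ 2) {u : Fin n → ℤ} (hu : ¬ (p : ℤ) ∣ eval u F) :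
    ‖∑ a ∈ Finset.univ.erase (0 : ZMod p), diffSum F p a u‖
      ≤ (√p + 1) * √((p : ℝ) ^ n * kerCard (hess F u) p) := by
  have h2 : (2 : ZMod p) ≠ 0 := by
    intro h
    have : ((2 : ℕ) : ZMod p) = 0 := by exact_mod_cast h
    rw [ZMod.natCast_eq_zero_iff] at this
    exact hp2 ((Nat.prime_dvd_prime_iff_eq Fact.out Nat.prime_two).1 this)
  let w : Fin n → ZMod p := fun i => (u i : ZMod p)
  -- With `2 v = u`, the shift `x ↦ x - v` turns the phase into the quadratic form `T(x, x, v)` plus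
  -- the constant `c = 2 F(v)`, nonzero because `p ∤ F(u)`.
  let v : Fin n → ZMod p := (2 : ZMod p)⁻¹ • w
  have hwv : w = v + v := by
    rw [← two_smul (ZMod p) v, smul_smul, mul_inv_cancel₀ h2, one_smul]
  let c : ZMod p := 2 * aeval v F
  have hc : c ≠ 0 := by
    intro h0
    apply hu
    rw [← ZMod.intCast_zmod_eq_zero_iff_dvd, ← aeval_intCast]
    change aeval w F = 0
    have hv : aeval v F = 0 := (mul_eq_zero.1 h0).resolve_left h2
    rw [hwv, ← two_smul (ZMod p) v, aeval_smul_eq hF, hv, mul_zero]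
  let G : ZMod p → ℂ := fun a => ∑ x, ZMod.stdAddChar (a * tri F x x v)
  have hdiff : ∀ a, diffSum F p a u = G a * ZMod.stdAddChar (a * c) := by
    intro a
    unfold diffSum
    rw [← Equiv.sum_comp (Equiv.subRight v), Finset.sum_mul]
    refine Finset.sum_congr rfl fun x _ => ?_
    rw [← AddChar.map_add_eq_mul, Equiv.subRight_apply]
    change ZMod.stdAddChar (a * (aeval (x - v + w) F - _)) = _
    have : x - v + w = x + v := by rw [hwv]; abel
    rw [this, aeval_symmetric_difference hF, mul_add]
  have hG : ∀ a ≠ 0, ‖G a‖ ≤ √((p : ℝ) ^ n * kerCard (hess F u) p) := by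
    intro a ha
    have := norm_diffSum_sq_le hF p (Units.mk0 a ha) u
    rw [Units.val_mk0, hdiff, norm_mul, norm_stdAddChar, mul_one] at this
    exact Real.le_sqrt_of_sq_le this
  -- The quadratic part depends on `a` only up to squares, by scaling `x`. Averaging over `a ↦ t ^ 2
  -- a` therefore moves the whole `t`-dependence to the constant term, where it becomes a Gauss sum.
  have hGt : ∀ a t : ZMod p, t ≠ 0 → G (t ^ 2 * a) = G a := by
    intro a t ht
    change ∑ x, ZMod.stdAddChar (t ^ 2 * a * tri F x x v) = ∑ x, ZMod.stdAddChar (a * tri F x x v)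
    refine Fintype.sum_equiv (MulAction.toPerm (Units.mk0 t ht)) _ _ fun x => ?_
    have : (MulAction.toPerm (Units.mk0 t ht)) x = t • x := rfl
    rw [this, tri_smul_left, tri_smul_mid]
    congr 1
    ring
  let Tot : ℂ := ∑ a ∈ Finset.univ.erase (0 : ZMod p), G a * ZMod.stdAddChar (a * c)
  have hS : ∑ a ∈ Finset.univ.erase (0 : ZMod p), diffSum F p a u = Tot :=
    Finset.sum_congr rfl fun a _ => hdiff a
  have hscale : ∀ t ∈ Finset.univ.erase (0 : ZMod p),
      Tot = ∑ a ∈ Finset.univ.erase (0 : ZMod p), G a * ZMod.stdAddChar (a * c * t ^ 2) := by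
    intro t ht
    have ht0 := (Finset.mem_erase.1 ht).1
    have ht2 : t ^ 2 ≠ 0 := pow_ne_zero 2 ht0
    refine (Finset.sum_bij (fun a _ => t ^ 2 * a) ?_ ?_ ?_ ?_).symm
    · intro a ha
      exact Finset.mem_erase.2 ⟨mul_ne_zero ht2 (Finset.mem_erase.1 ha).1, Finset.mem_univ _⟩
    · intro a _ b _ hab
      exact mul_left_cancel₀ ht2 hab
    · intro b hb
      refine ⟨(t ^ 2)⁻¹ * b, Finset.mem_erase.2
        ⟨mul_ne_zero (inv_ne_zero ht2) (Finset.mem_erase.1 hb).1, Finset.mem_univ _⟩, ?_⟩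
      rw [mul_inv_cancel_left₀ ht2]
    · intro a _
      rw [hGt a t ht0]
      congr 2
      ring
  have hcard : ((Finset.univ.erase (0 : ZMod p)).card : ℝ) = p - 1 := by
    rw [Finset.card_erase_of_mem (Finset.mem_univ _), Finset.card_univ, ZMod.card,
      Nat.cast_sub (Fact.out : p.Prime).one_lt.le, Nat.cast_one]
  have hp1 : (0 : ℝ) < p - 1 := by
    have : (1 : ℝ) < p := by exact_mod_cast (Fact.out : p.Prime).one_lt
    linarith
  have havg : (((p : ℝ) - 1 : ℝ) : ℂ) * Tot = ∑ a ∈ Finset.univ.erase (0 : ZMod p),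
      G a * ∑ t ∈ Finset.univ.erase (0 : ZMod p), ZMod.stdAddChar (a * c * t ^ 2) := by
    have h1 : ∑ _t ∈ Finset.univ.erase (0 : ZMod p), Tot = (((p : ℝ) - 1 : ℝ) : ℂ) * Tot := by
      rw [Finset.sum_const, nsmul_eq_mul, ← hcard]
      norm_cast
    rw [← h1, Finset.sum_congr rfl hscale, Finset.sum_comm]
    exact Finset.sum_congr rfl fun a _ => (Finset.mul_sum _ _ _).symm
  have hgauss : ∀ b : ZMod p, b ≠ 0 →
      ‖∑ t ∈ Finset.univ.erase (0 : ZMod p), (ZMod.stdAddChar (b * t ^ 2) : ℂ)‖ ≤ √p + 1 := by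
    intro b hb
    have h1 := Finset.add_sum_erase Finset.univ
      (fun t : ZMod p => (ZMod.stdAddChar (b * t ^ 2) : ℂ)) (Finset.mem_univ 0)
    have h3 := eq_sub_of_add_eq' h1
    rw [h3]
    refine (norm_sub_le _ _).trans (add_le_add (norm_sum_sq_phase_le hp2 hb) ?_)
    rw [norm_stdAddChar]
  rw [hS]
  have hnorm : (p - 1 : ℝ) * ‖Tot‖
      ≤ (p - 1 : ℝ) * ((√p + 1) * √((p : ℝ) ^ n * kerCard (hess F u) p)) := by
    have e : (p - 1 : ℝ) * ‖Tot‖ = ‖(((p : ℝ) - 1 : ℝ) : ℂ) * Tot‖ := by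
      rw [norm_mul, Complex.norm_real, Real.norm_of_nonneg hp1.le]
    rw [e, havg, ← hcard, ← nsmul_eq_mul, ← Finset.sum_const]
    refine norm_sum_le_of_le _ fun a ha => ?_
    have ha0 := (Finset.mem_erase.1 ha).1
    rw [norm_mul, mul_comm]
    exact mul_le_mul (hgauss _ (mul_ne_zero ha0 hc)) (hG a ha0) (norm_nonneg _) (by positivity)
  exact le_of_mul_le_mul_left hnorm hp1

theorem norm_sum_diffSum_le {F : MvPolynomial (Fin n) ℤ} (hF : F.IsHomogeneous 3)
    {p : ℕ} [Fact p.Prime] (u : Fin n → ℤ) :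
    ‖∑ a ∈ Finset.univ.erase (0 : ZMod p), diffSum F p a u‖
      ≤ p * √((p : ℝ) ^ n * kerCard (hess F u) p) := by
  have h1 : ‖∑ a ∈ Finset.univ.erase (0 : ZMod p), diffSum F p a u‖
      ≤ ∑ _a ∈ Finset.univ.erase (0 : ZMod p), √((p : ℝ) ^ n * kerCard (hess F u) p) := by
    refine norm_sum_le_of_le _ fun a ha => ?_
    exact Real.le_sqrt_of_sq_le
      (norm_diffSum_sq_le hF p (Units.mk0 a (Finset.mem_erase.1 ha).1) u)
  refine h1.trans ?_
  rw [Finset.sum_const, nsmul_eq_mul]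
  refine mul_le_mul_of_nonneg_right ?_ (Real.sqrt_nonneg _)
  have := Finset.card_le_univ (Finset.univ.erase (0 : ZMod p))
  rw [ZMod.card] at this
  exact_mod_cast this

/-- The majorant for the normalised average over `a` of the differenced sums modulo `p`. -/
noncomputable def diffBound (F : MvPolynomial (Fin n) ℤ) (p : ℕ) (u : Fin n → ℤ) : ℝ :=
  p * (√(kerCard (hess F u) p) / √((p : ℝ) ^ n)) *
    if (p : ℤ) ∣ eval u F then 1 else 2 / √p

theorem norm_sum_diffSum_le_diffBound {F : MvPolynomial (Fin n) ℤ} (hF : F.IsHomogeneous 3)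
    {p : ℕ} [Fact p.Prime] (u : Fin n → ℤ) :
    ‖∑ a ∈ Finset.univ.erase (0 : ZMod p), diffSum F p a u‖ ≤ (p : ℝ) ^ n * diffBound F p u := by
  have hp : (0 : ℝ) < p := by exact_mod_cast (Fact.out : p.Prime).pos
  have hp1 : (1 : ℝ) ≤ p := by exact_mod_cast (Fact.out : p.Prime).one_lt.le
  have hs : (0 : ℝ) < √((p : ℝ) ^ n) := Real.sqrt_pos.2 (by positivity)
  have e : ∀ g : ℝ, (p : ℝ) ^ n * (p * (√(kerCard (hess F u) p) / √((p : ℝ) ^ n)) * g)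
      = p * g * √((p : ℝ) ^ n * kerCard (hess F u) p) := by
    intro g
    have h1 : (p : ℝ) ^ n = √((p : ℝ) ^ n) * √((p : ℝ) ^ n) :=
      (Real.mul_self_sqrt (by positivity)).symm
    rw [Real.sqrt_mul (by positivity)]
    generalize √((p : ℝ) ^ n) = z at h1 hs ⊢
    rw [h1]
    field_simp
  have hsp : (0 : ℝ) < √p := Real.sqrt_pos.2 hp
  rw [diffBound, e]
  split_ifs with h
  · rw [mul_one]; exact norm_sum_diffSum_le hF u
  · have e2 : (p : ℝ) * (2 / √p) = 2 * √p := by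
      field_simp
      rw [Real.sq_sqrt hp.le]
    rw [e2]
    -- At `p = 2`, where halving `u` is impossible, the claimed factor `2 √p` exceeds `p` and the
    -- trivial bound is enough.
    by_cases hp2 : p = 2
    · refine (norm_sum_diffSum_le hF u).trans
        (mul_le_mul_of_nonneg_right ?_ (Real.sqrt_nonneg _))
      have h1 : (1 : ℝ) ≤ √p := Real.one_le_sqrt.2 hp1
      rw [hp2] at h1 ⊢
      push_cast at h1 ⊢
      linarith
    · refine (norm_sum_diffSum_le_of_not_dvd hF hp2 h).trans
        (mul_le_mul_of_nonneg_right ?_ (Real.sqrt_nonneg _))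
      have h1 : (1 : ℝ) ≤ √p := Real.one_le_sqrt.2 hp1
      linarith

/-- The sum of the absolute values of the normalised exponential sums modulo `q`. -/
noncomputable def absSum (F : MvPolynomial (Fin n) ℤ) (q : ℕ) : ℝ :=
  ∑ a ∈ reducedResidues q, ‖expSum F q a / (q : ℂ) ^ n‖

theorem absSum_nonneg (F : MvPolynomial (Fin n) ℤ) (q : ℕ) : 0 ≤ absSum F q :=
  Finset.sum_nonneg fun _ _ => norm_nonneg _

theorem absSum_eq_localSum (F : MvPolynomial (Fin n) ℤ) (q : ℕ) :
    absSum F q = localSum F (normHom : ℂ →*₀ ℝ).toMonoidHom q := rfl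

theorem absSum_eq (F : MvPolynomial (Fin n) ℤ) (q : ℕ) [NeZero q] :
    absSum F q = ∑ a : (ZMod q)ˣ, ‖charSum F q a / (q : ℂ) ^ n‖ := by
  rw [absSum_eq_localSum, localSum_eq]
  rfl

/-- Cauchy–Schwarz over `a`, then van der Corput. `H` is independent of `p`, so one box can serve a
whole dyadic range of primes. -/
theorem absSum_prime_sq_le {F : MvPolynomial (Fin n) ℤ} (hF : F.IsHomogeneous 3)
    {p : ℕ} (hp : p.Prime) {H : ℕ} (hH : 0 < H) :
    absSum F p ^ 2 ≤ p / (H : ℝ) ^ n * ∑ u ∈ box n H, diffBound F p u := by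
  have : Fact p.Prime := ⟨hp⟩
  have hp0 : (0 : ℝ) < p := by exact_mod_cast hp.pos
  have h1 : absSum F p = ∑ a ∈ Finset.univ.erase (0 : ZMod p), ‖charSum F p a / (p : ℂ) ^ n‖ := by
    rw [absSum_eq]
    refine Finset.sum_bij (fun a _ => (a : ZMod p)) ?_ ?_ ?_ ?_
    · intro a _; exact Finset.mem_erase.2 ⟨a.ne_zero, Finset.mem_univ _⟩
    · intro a _ b _ h; exact Units.ext h
    · intro b hb; exact ⟨Units.mk0 b (Finset.mem_erase.1 hb).1, Finset.mem_univ _, rfl⟩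
    · intro a _; rfl
  have h2 := sq_sum_le_card_mul_sum_sq (s := Finset.univ.erase (0 : ZMod p))
    (f := fun a => ‖charSum F p a / (p : ℂ) ^ n‖)
  have hcard : ((Finset.univ.erase (0 : ZMod p)).card : ℝ) ≤ p := by
    have := Finset.card_le_univ (Finset.univ.erase (0 : ZMod p))
    rw [ZMod.card] at this
    exact_mod_cast this
  have h3 := sum_norm_charSum_sq_le F p (Finset.univ.erase (0 : ZMod p)) hH
  have h4 : ∑ a ∈ Finset.univ.erase (0 : ZMod p), ‖charSum F p a / (p : ℂ) ^ n‖ ^ 2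
      ≤ 1 / (H : ℝ) ^ n * ∑ u ∈ box n H, diffBound F p u := by
    have e : ∀ a, ‖charSum F p a / (p : ℂ) ^ n‖ ^ 2 = ‖charSum F p a‖ ^ 2 / ((p : ℝ) ^ n) ^ 2 := by
      intro a
      rw [norm_div, norm_pow, Complex.norm_natCast, div_pow]
    rw [Finset.sum_congr rfl fun a _ => e a, ← Finset.sum_div, div_le_iff₀ (by positivity)]
    refine h3.trans ?_
    calc (p : ℝ) ^ n / (H : ℝ) ^ n
          * ∑ u ∈ box n H, ‖∑ a ∈ Finset.univ.erase (0 : ZMod p), diffSum F p a u‖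
        ≤ (p : ℝ) ^ n / (H : ℝ) ^ n * ∑ u ∈ box n H, (p : ℝ) ^ n * diffBound F p u := by
          gcongr
          exact norm_sum_diffSum_le_diffBound hF _
      _ = _ := by rw [← Finset.mul_sum]; ring
  rw [h1]
  refine h2.trans ?_
  calc _ ≤ (p : ℝ) * (1 / (H : ℝ) ^ n * ∑ u ∈ box n H, diffBound F p u) := by
        gcongr
    _ = _ := by ring

/-! ### Averaging over the primes of a dyadic interval. -/

/-- The primes in the interval `[Q, 2 Q)`. -/
def dyadicPrimes (Q : ℕ) : Finset ℕ := (Finset.Ico Q (2 * Q)).filter Nat.Prime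

theorem mem_dyadicPrimes {Q p : ℕ} : p ∈ dyadicPrimes Q ↔ (Q ≤ p ∧ p < 2 * Q) ∧ p.Prime := by
  simp [dyadicPrimes]

theorem card_dyadicPrimes_le (Q : ℕ) : (dyadicPrimes Q).card ≤ Q := by
  refine (Finset.card_filter_le _ _).trans ?_
  rw [Nat.card_Ico]
  omega

/-- The product of these primes divides `d`, and each of them is at least `Q`. -/
theorem card_dyadicPrimes_dvd_le {Q d m : ℕ} (hQ : 2 ≤ Q) (hd : 0 < d) (h : d ≤ Q ^ m) :
    ((dyadicPrimes Q).filter fun p => p ∣ d).card ≤ m := by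
  have h1 : ∏ p ∈ (dyadicPrimes Q).filter fun p => p ∣ d, p ∣ d := by
    refine Finset.prod_primes_dvd d ?_ ?_
    · intro p hp
      exact (mem_dyadicPrimes.1 (Finset.mem_filter.1 hp).1).2.prime
    · intro p hp
      exact (Finset.mem_filter.1 hp).2
  have h2 : Q ^ ((dyadicPrimes Q).filter fun p => p ∣ d).card
      ≤ ∏ p ∈ (dyadicPrimes Q).filter fun p => p ∣ d, p :=
    Finset.pow_card_le_prod _ _ _ fun p hp =>
      (mem_dyadicPrimes.1 (Finset.mem_filter.1 hp).1).1.1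
  exact (Nat.pow_le_pow_iff_right hQ).1 ((h2.trans (Nat.le_of_dvd hd h1)).trans h)

theorem diffBound_nonneg (F : MvPolynomial (Fin n) ℤ) (p : ℕ) (u : Fin n → ℤ) :
    0 ≤ diffBound F p u := by
  unfold diffBound
  split_ifs <;> positivity

/-- The kernel modulo `p` has order a power of `p` dividing the determinant, so it is trivial when
`p` does not divide the determinant. -/
theorem sqrt_kerCard_le {ι : Type*} [Fintype ι] [DecidableEq ι] {B : Matrix ι ι ℤ}
    (hdet : B.det ≠ 0) {D : ℝ} (hD : (B.det.natAbs : ℝ) ≤ D) {p : ℕ} (hp : p.Prime) :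
    √(kerCard B p) ≤ 1 + if p ∣ B.det.natAbs then √D else 0 := by
  have : Fact p.Prime := ⟨hp⟩
  have hdvd := kerCard_dvd_det _ hdet p
  split_ifs with h
  · have h3 := Nat.le_of_dvd (Int.natAbs_pos.2 hdet) hdvd
    have : √(kerCard B p : ℝ) ≤ √D := Real.sqrt_le_sqrt (le_trans (by exact_mod_cast h3) hD)
    linarith
  · obtain ⟨e, he⟩ := exists_kerCard_eq_pow B p
    have : e = 0 := by
      by_contra h0
      apply h
      rw [he] at hdvd
      exact (dvd_pow_self p h0).trans hdvd
    rw [he, this]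
    simp

/-- Primes not dividing the chosen minor contribute the main term `Q`. As the minor is at most `c H
^ r ≤ Q ^ (r + 1)`, at most `n + 1` primes divide it. The saving from `p ∤ F(u)` is discarded here.
-/
theorem sum_diffBound_le {F : MvPolynomial (Fin n) ℤ} {c : ℝ} {H Q : ℕ}
    {u : Fin n → ℤ} {r : ℕ} (hr : (matrixM F u).rank = r)
    (hminor : ∀ f g : Fin r → Fin n,
      (((hess F u).submatrix f g).det.natAbs : ℝ) ≤ c * (H : ℝ) ^ r)
    (hQ : 2 ≤ Q) (hc : c ≤ Q) (hHQ : H ≤ Q) :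
    ∑ p ∈ dyadicPrimes Q, diffBound F p u
      ≤ 4 * Q / √((Q : ℝ) ^ r) * (Q + (n + 1) * √(c * (H : ℝ) ^ r)) := by
  have hQ0 : (0 : ℝ) < Q := by exact_mod_cast (by omega : 0 < Q)
  have hrn : r ≤ n := hr ▸ rank_le F u
  obtain ⟨f, g, hf, hg, hdet⟩ := exists_minor F u hr
  set B := (hess F u).submatrix f g with hB
  have hD := hminor f g
  set D : ℝ := c * (H : ℝ) ^ r with hDdef
  have hpt : ∀ p ∈ dyadicPrimes Q, diffBound F p u
      ≤ 4 * Q / √((Q : ℝ) ^ r) * (1 + if p ∣ B.det.natAbs then √D else 0) := by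
    intro p hp
    obtain ⟨⟨hp1, hp2⟩, hpp⟩ := mem_dyadicPrimes.1 hp
    have : Fact p.Prime := ⟨hpp⟩
    have hp0 : (0 : ℝ) < p := by exact_mod_cast hpp.pos
    have hp1' : (Q : ℝ) ≤ p := by exact_mod_cast hp1
    have hp2' : (p : ℝ) ≤ 2 * Q := by exact_mod_cast hp2.le
    have hk := kerCard_le_mul (hess F u) p f hg
    rw [Fintype.card_fin, ← hB] at hk
    have h1 : √(kerCard (hess F u) p : ℝ) / √((p : ℝ) ^ n) ≤ √(kerCard B p) / √((Q : ℝ) ^ r) := by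
      rw [← Real.sqrt_div (by positivity), ← Real.sqrt_div (by positivity)]
      refine Real.sqrt_le_sqrt ?_
      rw [div_le_div_iff₀ (by positivity) (by positivity)]
      have hk' : (kerCard (hess F u) p : ℝ) ≤ (p : ℝ) ^ (n - r) * kerCard B p := by
        exact_mod_cast hk
      calc (kerCard (hess F u) p : ℝ) * (Q : ℝ) ^ r
          ≤ ((p : ℝ) ^ (n - r) * kerCard B p) * (p : ℝ) ^ r := by gcongr
        _ = kerCard B p * ((p : ℝ) ^ (n - r) * (p : ℝ) ^ r) := by ring
        _ = _ := by rw [← pow_add, Nat.sub_add_cancel hrn]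
    have h2 : (if (p : ℤ) ∣ eval u F then (1 : ℝ) else 2 / √p) ≤ 2 := by
      split_ifs
      · norm_num
      · have h1 : (1 : ℝ) ≤ √p := Real.one_le_sqrt.2 (by exact_mod_cast hpp.one_lt.le)
        rw [div_le_iff₀ (by linarith)]
        linarith
    have h0 : (0 : ℝ) ≤ if (p : ℤ) ∣ eval u F then (1 : ℝ) else 2 / √p := by
      split_ifs <;> positivity
    calc diffBound F p u ≤ (2 * Q) * (√(kerCard B p) / √((Q : ℝ) ^ r)) * 2 := by
          unfold diffBound
          gcongr
      _ = 4 * Q / √((Q : ℝ) ^ r) * √(kerCard B p) := by ring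
      _ ≤ _ := by
        gcongr
        exact sqrt_kerCard_le hdet hD hpp
  refine (Finset.sum_le_sum hpt).trans ?_
  rw [← Finset.mul_sum]
  gcongr
  rw [Finset.sum_add_distrib, ← Finset.sum_filter, Finset.sum_const, Finset.sum_const,
    nsmul_eq_mul, nsmul_eq_mul, mul_one]
  have hbad : ((dyadicPrimes Q).filter fun p => p ∣ B.det.natAbs).card ≤ n + 1 := by
    refine card_dyadicPrimes_dvd_le hQ (Int.natAbs_pos.2 hdet) ?_
    have : (B.det.natAbs : ℝ) ≤ (Q : ℝ) ^ (r + 1) := by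
      refine hD.trans ?_
      rw [pow_succ']
      have : (H : ℝ) ≤ Q := by exact_mod_cast hHQ
      exact mul_le_mul hc (pow_le_pow_left₀ (by positivity) this _) (by positivity) hQ0.le
    have h' : B.det.natAbs ≤ Q ^ (r + 1) := by exact_mod_cast this
    exact h'.trans (Nat.pow_le_pow_right (by omega) (by omega))
  gcongr
  · exact_mod_cast card_dyadicPrimes_le Q
  · exact_mod_cast hbad

/-- The points of the box at which a large power of a prime may divide the Hessian while
`F` vanishes modulo that prime. -/
noncomputable def exceptionalSet (F : MvPolynomial (Fin n) ℤ) (H Q : ℕ) : Finset (Fin n → ℤ) :=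
  (box n H).filter fun u => (hess F u).det ≠ 0 ∧
    ∃ p ∈ dyadicPrimes Q, (p : ℤ) ∣ eval u F ∧ (p : ℤ) ^ 4 ∣ (hess F u).det

/-- Here `p / √(p ^ 10) = p ^ (-4)`. For the at most 11 primes dividing the determinant there are
three cases: `p ∤ F(u)`, where the Gauss sum saves `√Q`; kernel of order at most `p ^ 3 ≤ 8 Q ^ 3`;
and otherwise `p ∣ F(u)` and `p ^ 4 ∣ det`, so that `u` is exceptional. -/
theorem sum_diffBound_le_of_ten (hn : n = 10) {F : MvPolynomial (Fin n) ℤ} {c : ℝ} {H Q : ℕ}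
    {u : Fin n → ℤ} (hu : u ∈ box n H) (hdet : (hess F u).det ≠ 0)
    (hD : ((hess F u).det.natAbs : ℝ) ≤ c * (H : ℝ) ^ 10)
    (hQ : 2 ≤ Q) (hc : c ≤ Q) (hHQ : H ≤ Q) :
    ∑ p ∈ dyadicPrimes Q, diffBound F p u
      ≤ 1 / (Q : ℝ) ^ 4 * (2 * Q + 11 * (2 * √(c * (H : ℝ) ^ 10) / √Q + √(8 * (Q : ℝ) ^ 3)
        + if u ∈ exceptionalSet F H Q then √(c * (H : ℝ) ^ 10) else 0)) := by
  have hQ0 : (0 : ℝ) < Q := by exact_mod_cast (by omega : 0 < Q)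
  set D : ℝ := c * (H : ℝ) ^ 10 with hDdef
  set X : ℝ := if u ∈ exceptionalSet F H Q then √D else 0 with hX
  have hX0 : 0 ≤ X := by rw [hX]; split_ifs <;> positivity
  set d := (hess F u).det.natAbs with hd
  have hpt : ∀ p ∈ dyadicPrimes Q, diffBound F p u
      ≤ 1 / (Q : ℝ) ^ 4 * (2 + if p ∣ d then (2 * √D / √Q + √(8 * (Q : ℝ) ^ 3) + X) else 0) := by
    intro p hp
    obtain ⟨⟨hp1, hp2⟩, hpp⟩ := mem_dyadicPrimes.1 hp
    have : Fact p.Prime := ⟨hpp⟩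
    have hp0 : (0 : ℝ) < p := by exact_mod_cast hpp.pos
    have hp1' : (Q : ℝ) ≤ p := by exact_mod_cast hp1
    have hp2' : (p : ℝ) ≤ 2 * Q := by exact_mod_cast hp2.le
    have hdvd := kerCard_dvd_det _ hdet p
    have hkD : √(kerCard (hess F u) p : ℝ) ≤ √D := by
      have h3 := Nat.le_of_dvd (Int.natAbs_pos.2 hdet) hdvd
      exact Real.sqrt_le_sqrt (le_trans (by exact_mod_cast h3) hD)
    set k : ℝ := √(kerCard (hess F u) p : ℝ) with hk
    have hk0 : 0 ≤ k := Real.sqrt_nonneg _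
    have e : √((p : ℝ) ^ n) = (p : ℝ) ^ 5 := by
      rw [hn, show (p : ℝ) ^ 10 = ((p : ℝ) ^ 5) ^ 2 by ring]
      exact Real.sqrt_sq (by positivity)
    have e1 : ∀ g : ℝ, 0 ≤ g → (p : ℝ) * (k / √((p : ℝ) ^ n)) * g ≤ 1 / (Q : ℝ) ^ 4 * (k * g) := by
      intro g hg
      have : (p : ℝ) * (k / √((p : ℝ) ^ n)) * g = 1 / (p : ℝ) ^ 4 * (k * g) := by
        rw [e]; field_simp
      rw [this]
      gcongr
    have h0 : (0 : ℝ) ≤ if (p : ℤ) ∣ eval u F then (1 : ℝ) else 2 / √p := by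
      split_ifs <;> positivity
    refine (e1 _ h0).trans ?_
    refine mul_le_mul_of_nonneg_left ?_ (by positivity)
    by_cases hpd : p ∣ d
    · rw [if_pos hpd]
      have hA : 0 ≤ 2 * √D / √Q := by positivity
      have hB : 0 ≤ √(8 * (Q : ℝ) ^ 3) := by positivity
      by_cases hpF : (p : ℤ) ∣ eval u F
      · rw [if_pos hpF, mul_one]
        obtain ⟨e, he⟩ := exists_kerCard_eq_pow (hess F u) p
        by_cases he3 : e ≤ 3
        · have : k ≤ √(8 * (Q : ℝ) ^ 3) := by
            refine Real.sqrt_le_sqrt ?_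
            rw [he]
            calc ((p ^ e : ℕ) : ℝ) ≤ ((p ^ 3 : ℕ) : ℝ) := by
                  exact_mod_cast Nat.pow_le_pow_right hpp.pos he3
              _ = (p : ℝ) ^ 3 := by push_cast; rfl
              _ ≤ (2 * Q) ^ 3 := by gcongr
              _ = _ := by ring
          linarith
        · have hmem : u ∈ exceptionalSet F H Q := by
            refine Finset.mem_filter.2 ⟨hu, hdet, p, hp, hpF, ?_⟩
            rw [he] at hdvd
            have := (pow_dvd_pow p (by omega : 4 ≤ e)).trans hdvd
            have h4 := Int.natCast_dvd.2 this
            exact_mod_cast h4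
          have : X = √D := by rw [hX, if_pos hmem]
          linarith
      · rw [if_neg hpF]
        have : k * (2 / √p) ≤ 2 * √D / √Q := by
          rw [mul_div_assoc', mul_comm k]
          gcongr
        linarith
    · rw [if_neg hpd, add_zero]
      have hk1 : k ≤ 1 := by
        have := sqrt_kerCard_le hdet hD hpp
        rwa [if_neg hpd, add_zero] at this
      have h2 : (if (p : ℤ) ∣ eval u F then (1 : ℝ) else 2 / √p) ≤ 2 := by
        split_ifs
        · norm_num
        · have h1 : (1 : ℝ) ≤ √p := Real.one_le_sqrt.2 (by exact_mod_cast hpp.one_lt.le)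
          rw [div_le_iff₀ (by linarith)]
          linarith
      nlinarith
  refine (Finset.sum_le_sum hpt).trans ?_
  rw [← Finset.mul_sum]
  gcongr
  rw [Finset.sum_add_distrib, ← Finset.sum_filter, Finset.sum_const, Finset.sum_const,
    nsmul_eq_mul, nsmul_eq_mul]
  have hbad : ((dyadicPrimes Q).filter fun p => p ∣ d).card ≤ 11 := by
    refine card_dyadicPrimes_dvd_le hQ (Int.natAbs_pos.2 hdet) ?_
    have : (d : ℝ) ≤ (Q : ℝ) ^ 11 := by
      refine hD.trans ?_
      rw [pow_succ']
      have : (H : ℝ) ≤ Q := by exact_mod_cast hHQ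
      exact mul_le_mul hc (pow_le_pow_left₀ (by positivity) this _) (by positivity) hQ0.le
    exact_mod_cast this
  have hcard : ((dyadicPrimes Q).card : ℝ) ≤ Q := by exact_mod_cast card_dyadicPrimes_le Q
  have hbad' : (((dyadicPrimes Q).filter fun p => p ∣ d).card : ℝ) ≤ 11 := by exact_mod_cast hbad
  have hY : 0 ≤ 2 * √D / √Q + √(8 * (Q : ℝ) ^ 3) + X := by positivity
  nlinarith

/-- The Hessian determinant as a polynomial. -/
noncomputable def hessDet (F : MvPolynomial (Fin n) ℤ) : MvPolynomial (Fin n) ℤ :=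
  Matrix.det (Matrix.of fun j k => ∑ i, C (triCoeff F i j k) * X i :
    Matrix (Fin n) (Fin n) (MvPolynomial (Fin n) ℤ))

theorem eval_hessDet (F : MvPolynomial (Fin n) ℤ) (u : Fin n → ℤ) :
    eval u (hessDet F) = (hess F u).det := by
  rw [hessDet, RingHom.map_det]
  congr 1
  ext j k
  simp [hess]

theorem hess_smul (F : MvPolynomial (Fin n) ℤ) (c : ℤ) (u : Fin n → ℤ) :
    hess F (c • u) = c • hess F u := by
  ext j k
  simp only [hess, Matrix.of_apply, Matrix.smul_apply, Pi.smul_apply, smul_eq_mul, Finset.mul_sum]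
  exact Finset.sum_congr rfl fun i _ => by ring

theorem card_zeros_box_le {P : MvPolynomial (Fin n) ℤ} (hP : P ≠ 0) (hn : 0 < n) {H : ℕ}
    (hH : 0 < H) : ((box n H).filter fun u => eval u P = 0).card
      ≤ P.totalDegree * (2 * H) ^ (n - 1) := by
  have h := schwartz_zippel_totalDegree hP (Finset.Ioo (-(H : ℤ)) H)
  have hs : (Finset.Ioo (-(H : ℤ)) H).card = 2 * H - 1 := by rw [Int.card_Ioo]; omega
  rw [hs] at h
  have hpos : 0 < 2 * H - 1 := by omega
  have hpos' : (0 : ℚ≥0) < ((2 * H - 1 : ℕ) : ℚ≥0) := by exact_mod_cast hpos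
  obtain ⟨m, rfl⟩ : ∃ m, n = m + 1 := ⟨n - 1, by omega⟩
  rw [div_le_div_iff₀ (by positivity) hpos', pow_succ, ← mul_assoc] at h
  have h' := le_of_mul_le_mul_right h hpos'
  have h2 : ((box (m + 1) H).filter fun u => eval u P = 0).card
      ≤ P.totalDegree * (2 * H - 1) ^ m := by
    have : ((((box (m + 1) H).filter fun u => eval u P = 0).card : ℕ) : ℚ≥0)
      ≤ ((P.totalDegree * (2 * H - 1) ^ m : ℕ) : ℚ≥0) := by
      rw [Nat.cast_mul, Nat.cast_pow]; exact h'
    exact_mod_cast this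
  refine h2.trans ?_
  rw [Nat.add_sub_cancel]
  exact Nat.mul_le_mul_left _ (Nat.pow_le_pow_left (by omega) m)

theorem exists_eval_bound {F : MvPolynomial (Fin n) ℤ} (hF : F.IsHomogeneous 3) :
    ∃ c : ℝ, 0 ≤ c ∧ ∀ H : ℕ, ∀ u ∈ box n H, |((eval u F : ℤ) : ℝ)| ≤ c * (H : ℝ) ^ 3 := by
  refine ⟨∑ i, ∑ j, ∑ k, |(triCoeff F i j k : ℝ)|, by positivity, ?_⟩
  intro H u hu
  have h6 := congrArg (Int.cast : ℤ → ℝ) (six_mul_eval hF u)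
  have hu' : ∀ i, |(u i : ℝ)| ≤ H := fun i => by exact_mod_cast (mem_box.1 hu i).le
  have h1 : |((tri F u u u : ℤ) : ℝ)|
      ≤ (∑ i, ∑ j, ∑ k, |(triCoeff F i j k : ℝ)|) * (H : ℝ) ^ 3 := by
    rw [tri]
    push_cast
    simp only [Finset.sum_mul]
    refine (Finset.abs_sum_le_sum_abs _ _).trans (Finset.sum_le_sum fun i _ => ?_)
    refine (Finset.abs_sum_le_sum_abs _ _).trans (Finset.sum_le_sum fun j _ => ?_)
    refine (Finset.abs_sum_le_sum_abs _ _).trans (Finset.sum_le_sum fun k _ => ?_)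
    rw [abs_mul, abs_mul, abs_mul]
    calc _ ≤ |(triCoeff F i j k : ℝ)| * H * H * H := by
          gcongr
          · exact hu' i
          · exact hu' j
          · exact hu' k
      _ = _ := by ring
  rw [← h6] at h1
  push_cast at h1
  rw [abs_mul, abs_of_pos (by norm_num : (0 : ℝ) < 6)] at h1
  have := abs_nonneg ((eval u F : ℤ) : ℝ)
  linarith

/-- With `F(u) = p k` and `det = p ^ 4 m`, eliminating `p` gives `k ^ 4 det = m F(u) ^ 4`. There are
`O(H ^ 3 / Q + 1)` values of `k` and `O(H ^ 10 / Q ^ 4 + 1)` values of `m`, and Schwartz–Zippel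
allows `O(H ^ 9)` zeros for each pair. -/
theorem exists_card_exceptionalSet_le (hn : n = 10) {F : MvPolynomial (Fin n) ℤ}
    (hF : F.IsHomogeneous 3) {u₀ : Fin n → ℤ} (hu₀ : (hess F u₀).det ≠ 0) {c : ℝ} (hc : 0 ≤ c)
    (hdet : ∀ H : ℕ, 0 < H → ∀ u ∈ box n H, ((hess F u).det.natAbs : ℝ) ≤ c * (H : ℝ) ^ n) :
    ∃ C : ℝ, 0 < C ∧ ∀ H Q : ℕ, 0 < H → 0 < Q →
      ((exceptionalSet F H Q).card : ℝ)
        ≤ C * (((H : ℝ) ^ 3 / Q + 1) * ((H : ℝ) ^ 10 / (Q : ℝ) ^ 4 + 1) * (H : ℝ) ^ 9) := by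
  obtain ⟨b, hb, hFb⟩ := exists_eval_bound hF
  let G : ℤ → ℤ → MvPolynomial (Fin n) ℤ := fun k m => C (k ^ 4) * hessDet F - C m * F ^ 4
  have hGe : ∀ k m u, eval u (G k m) = k ^ 4 * (hess F u).det - m * (eval u F) ^ 4 := by
    intro k m u
    simp [G, eval_hessDet]
  have hG : ∀ k m, m ≠ 0 → G k m ≠ 0 := by
    intro k m hm h0
    have h1 := hGe k m u₀
    -- Comparing `u₀` with `2 u₀` separates the degrees: one term scales by `2 ^ 10`, the other by
    -- `2 ^ 12`, so both vanish at `u₀`.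
    have h2 := hGe k m ((2 : ℤ) • u₀)
    rw [h0, map_zero] at h1 h2
    rw [hess_smul, Matrix.det_smul, eval_smul_eq hF, Fintype.card_fin,
      (by rw [hn] : (2 : ℤ) ^ n = 2 ^ 10)] at h2
    have h3 : k ^ 4 * (hess F u₀).det = 0 := by nlinarith
    have hk : k = 0 := by
      have := (mul_eq_zero.1 h3).resolve_right hu₀
      exact pow_eq_zero_iff (by norm_num) |>.1 this
    have hF0 : ∀ u, eval u F = 0 := by
      intro u
      have h4 := hGe k m u
      rw [h0, map_zero, hk] at h4
      have h5 : m * (eval u F) ^ 4 = 0 := by linarith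
      exact pow_eq_zero_iff (by norm_num) |>.1 ((mul_eq_zero.1 h5).resolve_left hm)
    have hF00 : F = 0 := MvPolynomial.funext fun u => by rw [hF0, map_zero]
    apply hu₀
    have : hess F u₀ = 0 := by
      ext i j
      simp [hess, triCoeff, hF00]
    have : Nonempty (Fin n) := ⟨⟨0, by omega⟩⟩
    rw [‹hess F u₀ = 0›, Matrix.det_zero]
  let d : ℕ := max (hessDet F).totalDegree (4 * F.totalDegree)
  have hGd : ∀ k m, (G k m).totalDegree ≤ d := by
    intro k m
    refine (totalDegree_sub _ _).trans (max_le_max ?_ ?_)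
    · refine (totalDegree_mul _ _).trans ?_
      rw [totalDegree_C, zero_add]
    · refine (totalDegree_mul _ _).trans ?_
      rw [totalDegree_C, zero_add]
      exact totalDegree_pow _ _
  refine ⟨(2 * b + 1) * (2 * c + 1) * (d + 1) * 2 ^ 9, by positivity, ?_⟩
  intro H Q hH hQ
  have hQ0 : (0 : ℝ) < Q := by exact_mod_cast hQ
  set K := ⌊b * (H : ℝ) ^ 3 / Q⌋₊ with hK
  set M := ⌊c * (H : ℝ) ^ 10 / (Q : ℝ) ^ 4⌋₊ with hM
  let I : Finset (ℤ × ℤ) :=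
    Finset.Icc (-(K : ℤ)) K ×ˢ (Finset.Icc (-(M : ℤ)) M).erase 0
  have hsub : exceptionalSet F H Q
      ⊆ I.biUnion fun km => (box n H).filter fun u => eval u (G km.1 km.2) = 0 := by
    intro u hu
    obtain ⟨hub, hud, p, hp, ⟨k, hk⟩, ⟨m, hm⟩⟩ := Finset.mem_filter.1 hu
    obtain ⟨⟨hp1, -⟩, hpp⟩ := mem_dyadicPrimes.1 hp
    have hp1' : (Q : ℝ) ≤ p := by exact_mod_cast hp1
    refine Finset.mem_biUnion.2 ⟨(k, m), Finset.mem_product.2 ⟨?_, ?_⟩,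
      Finset.mem_filter.2 ⟨hub, ?_⟩⟩
    · have h1 := hFb H u hub
      rw [hk] at h1
      push_cast at h1
      rw [abs_mul, Nat.abs_cast] at h1
      have h2 : (k.natAbs : ℝ) ≤ b * (H : ℝ) ^ 3 / Q := by
        rw [le_div_iff₀ hQ0, Nat.cast_natAbs, Int.cast_abs]
        have := abs_nonneg (k : ℝ)
        nlinarith
      have h3 := Nat.le_floor h2
      rw [Finset.mem_Icc, ← abs_le, Int.abs_eq_natAbs]
      exact Int.ofNat_le.2 h3
    · refine Finset.mem_erase.2 ⟨?_, ?_⟩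
      · rintro rfl
        exact hud (by rw [hm, mul_zero])
      · have h1 := hdet H hH u hub
        rw [Nat.cast_natAbs, Int.cast_abs, hm, (by rw [hn] : (H : ℝ) ^ n = (H : ℝ) ^ 10)] at h1
        push_cast at h1
        rw [abs_mul, abs_of_nonneg (by positivity)] at h1
        have h2 : (m.natAbs : ℝ) ≤ c * (H : ℝ) ^ 10 / (Q : ℝ) ^ 4 := by
          rw [le_div_iff₀ (by positivity), Nat.cast_natAbs, Int.cast_abs]
          have h4 : (Q : ℝ) ^ 4 ≤ (p : ℝ) ^ 4 := by gcongr
          have := abs_nonneg (m : ℝ)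
          nlinarith
        have h3 := Nat.le_floor h2
        rw [Finset.mem_Icc, ← abs_le, Int.abs_eq_natAbs]
        exact Int.ofNat_le.2 h3
    · rw [hGe, hk, hm]
      ring
  have h1 := (Finset.card_le_card hsub).trans Finset.card_biUnion_le
  have h2 : ∑ km ∈ I, ((box n H).filter fun u => eval u (G km.1 km.2) = 0).card
      ≤ ∑ _km ∈ I, d * (2 * H) ^ 9 := by
    refine Finset.sum_le_sum fun km hkm => ?_
    have hm := (Finset.mem_erase.1 (Finset.mem_product.1 hkm).2).1
    have := card_zeros_box_le (hG km.1 km.2 hm) (by omega) hH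
    rw [(by omega : n - 1 = 9)] at this
    exact this.trans (Nat.mul_le_mul_right _ (hGd _ _))
  have hI : I.card ≤ (2 * K + 1) * (2 * M + 1) := by
    rw [Finset.card_product]
    refine Nat.mul_le_mul ?_ ((Finset.card_erase_le).trans ?_)
    · rw [Int.card_Icc]; omega
    · rw [Int.card_Icc]; omega
  rw [Finset.sum_const, smul_eq_mul] at h2
  have h3 : (exceptionalSet F H Q).card ≤ (2 * K + 1) * (2 * M + 1) * (d * (2 * H) ^ 9) :=
    (h1.trans h2).trans (Nat.mul_le_mul_right _ hI)
  have h4 : ((exceptionalSet F H Q).card : ℝ)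
      ≤ (2 * K + 1) * (2 * M + 1) * (d * (2 * H) ^ 9) := by exact_mod_cast h3
  have hK' : (2 * (K : ℝ) + 1) ≤ (2 * b + 1) * ((H : ℝ) ^ 3 / Q + 1) := by
    have := Nat.floor_le (a := b * (H : ℝ) ^ 3 / Q) (by positivity)
    rw [← hK] at this
    have h5 : 0 ≤ (H : ℝ) ^ 3 / Q := by positivity
    rw [mul_div_assoc] at this
    nlinarith
  have hM' : (2 * (M : ℝ) + 1) ≤ (2 * c + 1) * ((H : ℝ) ^ 10 / (Q : ℝ) ^ 4 + 1) := by
    have := Nat.floor_le (a := c * (H : ℝ) ^ 10 / (Q : ℝ) ^ 4) (by positivity)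
    rw [← hM] at this
    have h5 : 0 ≤ (H : ℝ) ^ 10 / (Q : ℝ) ^ 4 := by positivity
    rw [mul_div_assoc] at this
    nlinarith
  calc _ ≤ _ := h4
    _ ≤ ((2 * b + 1) * ((H : ℝ) ^ 3 / Q + 1)) * ((2 * c + 1) * ((H : ℝ) ^ 10 / (Q : ℝ) ^ 4 + 1))
        * ((d + 1) * (2 * H) ^ 9) := by
      gcongr
      linarith
    _ = _ := by ring

/-- The side `H ≈ Q ^ (201/500)` lies just above the critical `Q ^ (2/5)`. The target exponent must
be below `-2` because the two applications of Cauchy–Schwarz, over `a` and over `p`, each cost a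
factor `Q`. -/
theorem sum_rank_diffBound_le {F : MvPolynomial (Fin n) ℤ} {c K : ℝ} {H Q r : ℕ} (hr : r ≤ n)
    (hc1 : 1 ≤ c) (hK : 0 < K)
    (hminor : ∀ u ∈ box n H, ∀ f g : Fin r → Fin n,
      (((hess F u).submatrix f g).det.natAbs : ℝ) ≤ c * (H : ℝ) ^ r)
    (hcard : (((box n H).filter fun u => (matrixM F u).rank = r).card : ℝ)
      ≤ K * (H : ℝ) ^ ((r : ℝ) + 1 / 100))
    (hn : 10 ≤ n) (hrn : r < n ∨ 11 ≤ n)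
    (hQ : 2 ≤ Q) (hc : c ≤ Q) (hH0 : 0 < H) (hH1 : (H : ℝ) ≤ (Q : ℝ) ^ (201 / 500 : ℝ))
    (hH2 : (Q : ℝ) ^ (201 / 500 : ℝ) ≤ 2 * H) :
    ∑ u ∈ (box n H).filter (fun u => (matrixM F u).rank = r),
        ∑ p ∈ dyadicPrimes Q, diffBound F p u
      ≤ (2 ^ n * (4 * K) * (1 + (n + 1) * √c)) * (Q : ℝ) ^ (-(201 / 100) : ℝ) * (H : ℝ) ^ n := by
  set x : ℝ := (Q : ℝ) with hx
  have hx2 : (2 : ℝ) ≤ x := by rw [hx]; exact_mod_cast hQ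
  have hx0 : 0 < x := by linarith
  have hx1 : 1 ≤ x := by linarith
  have hHr0 : (0 : ℝ) < H := by exact_mod_cast hH0
  have hHQ : H ≤ Q := by
    have : (H : ℝ) ≤ x ^ (1 : ℝ) :=
      hH1.trans (Real.rpow_le_rpow_of_exponent_le hx1 (by norm_num))
    rw [Real.rpow_one, hx] at this
    exact_mod_cast this
  have h1 : ∑ u ∈ (box n H).filter (fun u => (matrixM F u).rank = r),
        ∑ p ∈ dyadicPrimes Q, diffBound F p u
      ≤ K * (H : ℝ) ^ ((r : ℝ) + 1 / 100)
        * (4 * x / √(x ^ r) * (x + (n + 1) * √(c * (H : ℝ) ^ r))) := by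
    refine (Finset.sum_le_sum fun u hu => sum_diffBound_le (Finset.mem_filter.1 hu).2
      (hminor u (Finset.mem_filter.1 hu).1) hQ hc hHQ).trans ?_
    rw [Finset.sum_const, nsmul_eq_mul]
    gcongr
  have hpow : ∀ s : ℝ, 0 ≤ s → (H : ℝ) ^ s ≤ x ^ (201 / 500 * s) := by
    intro s hs
    rw [Real.rpow_mul hx0.le]
    exact Real.rpow_le_rpow hHr0.le hH1 hs
  have hsq : √(x ^ r) = x ^ ((r : ℝ) / 2) := by
    rw [Real.sqrt_eq_rpow, ← Real.rpow_natCast, ← Real.rpow_mul hx0.le]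
    congr 1; ring
  have hsqH : √(c * (H : ℝ) ^ r) ≤ √c * x ^ (201 / 500 * ((r : ℝ) / 2)) := by
    rw [Real.sqrt_mul (by linarith)]
    gcongr
    rw [Real.sqrt_eq_rpow, ← Real.rpow_natCast, ← Real.rpow_mul hHr0.le]
    refine le_trans (le_of_eq ?_) (hpow ((r : ℝ) / 2) (by positivity))
    congr 1; ring
  have hHn : x ^ (201 / 500 * (n : ℝ)) ≤ 2 ^ n * (H : ℝ) ^ n := by
    rw [Real.rpow_mul hx0.le, Real.rpow_natCast, ← mul_pow]
    gcongr
  have hrR : (r : ℝ) ≤ n := by exact_mod_cast hr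
  have hnR : (10 : ℝ) ≤ n := by exact_mod_cast hn
  have hr0 : (0 : ℝ) ≤ r := by positivity
  -- `E1` (good primes) is tightest at `r = 0`, `n = 10`: 2.00402 against 2.01.
  have E1 : 201 / 500 * ((r : ℝ) + 1 / 100) + 1 - (r : ℝ) / 2 + 1
      ≤ -(201 / 100) + 201 / 500 * n := by nlinarith
  -- `E2` (primes dividing the minor) fails narrowly at `r = n = 10`, 2.03402 against 2.01, which is
  -- why that case is excluded and treated separately.
  have E2 : 201 / 500 * ((r : ℝ) + 1 / 100) + 1 - (r : ℝ) / 2 + 201 / 500 * ((r : ℝ) / 2)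
      ≤ -(201 / 100) + 201 / 500 * n := by
    rcases hrn with h | h
    · have : (r : ℝ) + 1 ≤ n := by exact_mod_cast h
      nlinarith
    · have : (11 : ℝ) ≤ n := by exact_mod_cast h
      nlinarith
  calc _ ≤ _ := h1
    _ ≤ K * x ^ (201 / 500 * ((r : ℝ) + 1 / 100))
        * (4 * x / x ^ ((r : ℝ) / 2) * (x + (n + 1) * (√c * x ^ (201 / 500 * ((r : ℝ) / 2))))) := by
      rw [hsq]
      gcongr
      exact hpow _ (by positivity)
    _ = 4 * K * (x ^ (201 / 500 * ((r : ℝ) + 1 / 100) + 1 - (r : ℝ) / 2 + 1)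
        + (n + 1) * √c * x ^ (201 / 500 * ((r : ℝ) + 1 / 100) + 1 - (r : ℝ) / 2
          + 201 / 500 * ((r : ℝ) / 2))) := by
      rw [Real.rpow_add hx0, Real.rpow_sub hx0, Real.rpow_add hx0, Real.rpow_add hx0 (_ - _),
        Real.rpow_sub hx0, Real.rpow_add hx0, Real.rpow_one]
      ring
    _ ≤ 4 * K * (x ^ (-(201 / 100) + 201 / 500 * (n : ℝ))
        + (n + 1) * √c * x ^ (-(201 / 100) + 201 / 500 * (n : ℝ))) := by gcongr
    _ = 4 * K * (1 + (n + 1) * √c) * x ^ (-(201 / 100) : ℝ) * x ^ (201 / 500 * (n : ℝ)) := by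
      rw [Real.rpow_add hx0]; ring
    _ ≤ 4 * K * (1 + (n + 1) * √c) * x ^ (-(201 / 100) : ℝ) * (2 ^ n * (H : ℝ) ^ n) := by
      gcongr
    _ = _ := by ring

/-- Per point of the box, the ordinary terms are at most about `Q ^ (-2.49)`. Exceptional points
have density about `Q ^ (0.206 + 0.02 - 0.402)` and each costs `Q ^ (-4 + 2.01)`, together `Q ^
(-2.166)`. All are below the required `Q ^ (-2.01)`. -/
theorem sum_full_rank_diffBound_le (hn : n = 10) {F : MvPolynomial (Fin n) ℤ} {c C : ℝ}
    {H Q : ℕ} (hc1 : 1 ≤ c) (hC : 0 < C)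
    (hdet : ∀ u ∈ box n H, ((hess F u).det.natAbs : ℝ) ≤ c * (H : ℝ) ^ n)
    (hcard : ((exceptionalSet F H Q).card : ℝ)
        ≤ C * (((H : ℝ) ^ 3 / Q + 1) * ((H : ℝ) ^ 10 / (Q : ℝ) ^ 4 + 1) * (H : ℝ) ^ 9))
    (hQ : 2 ≤ Q) (hc : c ≤ Q) (hH0 : 0 < H) (hH1 : (H : ℝ) ≤ (Q : ℝ) ^ (201 / 500 : ℝ))
    (hH2 : (Q : ℝ) ^ (201 / 500 : ℝ) ≤ 2 * H) :
    ∑ u ∈ (box n H).filter (fun u => (matrixM F u).rank = n),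
        ∑ p ∈ dyadicPrimes Q, diffBound F p u
      ≤ (2 ^ 10 * (35 + 22 * √c) + 88 * C * √c) * (Q : ℝ) ^ (-(201 / 100) : ℝ)
        * (H : ℝ) ^ n := by
  set x : ℝ := (Q : ℝ) with hx
  have hx2 : (2 : ℝ) ≤ x := by rw [hx]; exact_mod_cast hQ
  have hx0 : 0 < x := by linarith
  have hx1 : 1 ≤ x := by linarith
  have hHr0 : (0 : ℝ) < H := by exact_mod_cast hH0
  have hHQ : H ≤ Q := by
    have : (H : ℝ) ≤ x ^ (1 : ℝ) :=
      hH1.trans (Real.rpow_le_rpow_of_exponent_le hx1 (by norm_num))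
    rw [Real.rpow_one, hx] at this
    exact_mod_cast this
  have hn' : (H : ℝ) ^ n = (H : ℝ) ^ 10 := by rw [hn]
  rw [hn'] at hdet ⊢
  set D : ℝ := c * (H : ℝ) ^ 10 with hD
  have hsD : √D ≤ √c * x ^ (201 / 100 : ℝ) := by
    rw [hD, Real.sqrt_mul (by linarith)]
    gcongr
    rw [show (H : ℝ) ^ 10 = ((H : ℝ) ^ 5) ^ 2 by ring, Real.sqrt_sq (by positivity)]
    calc (H : ℝ) ^ 5 ≤ (x ^ (201 / 500 : ℝ)) ^ 5 := by gcongr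
      _ = x ^ (201 / 100 : ℝ) := by
        rw [← Real.rpow_natCast, ← Real.rpow_mul hx0.le]; norm_num
  have hsplit : ∑ u ∈ (box n H).filter (fun u => (matrixM F u).rank = n),
        ∑ p ∈ dyadicPrimes Q, diffBound F p u
      ≤ ∑ u ∈ box n H, 1 / x ^ 4 * (2 * x + 11 * (2 * √D / √x + √(8 * x ^ 3)
        + if u ∈ exceptionalSet F H Q then √D else 0)) := by
    refine (Finset.sum_le_sum fun u hu => sum_diffBound_le_of_ten hn (Finset.mem_filter.1 hu).1
      (det_hess_ne_zero F u (Finset.mem_filter.1 hu).2) (hdet u (Finset.mem_filter.1 hu).1)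
      hQ hc hHQ).trans ?_
    refine Finset.sum_le_sum_of_subset_of_nonneg (Finset.filter_subset _ _) fun u _ _ => ?_
    have : 0 ≤ if u ∈ exceptionalSet F H Q then √D else 0 := by split_ifs <;> positivity
    positivity
  have hsum : ∑ u ∈ box n H, 1 / x ^ 4 * (2 * x + 11 * (2 * √D / √x + √(8 * x ^ 3)
        + if u ∈ exceptionalSet F H Q then √D else 0))
      = (box n H).card * (1 / x ^ 4 * (2 * x + 11 * (2 * √D / √x + √(8 * x ^ 3))))
        + (exceptionalSet F H Q).card * (1 / x ^ 4 * (11 * √D)) := by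
    have : (exceptionalSet F H Q) = (box n H).filter fun u => u ∈ exceptionalSet F H Q := by
      ext u
      simp only [Finset.mem_filter]
      exact ⟨fun h => ⟨(Finset.mem_filter.1 h).1, h⟩, fun h => h.2⟩
    conv_rhs => rw [this]
    rw [← nsmul_eq_mul, ← nsmul_eq_mul, ← Finset.sum_const, ← Finset.sum_const,
      Finset.sum_filter, ← Finset.sum_add_distrib]
    refine Finset.sum_congr rfl fun u _ => ?_
    split_ifs <;> ring
  have hbox : ((box n H).card : ℝ) ≤ 2 ^ 10 * (H : ℝ) ^ 10 := by
    rw [box_card, ← mul_pow]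
    have : (2 * H - 1) ^ n ≤ (2 * H) ^ 10 := by
      rw [hn]; exact Nat.pow_le_pow_left (by omega) 10
    exact_mod_cast this
  have hx4 : 1 / x ^ 4 = x ^ (-4 : ℝ) := by
    rw [Real.rpow_neg hx0.le, one_div, ← Real.rpow_natCast]; norm_num
  have hle : ∀ s t : ℝ, s ≤ t → x ^ s ≤ x ^ t := fun s t h =>
    Real.rpow_le_rpow_of_exponent_le hx1 h
  have hA : 1 / x ^ 4 * (2 * x + 11 * (2 * √D / √x + √(8 * x ^ 3)))
      ≤ (35 + 22 * √c) * x ^ (-(201 / 100) : ℝ) := by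
    have a1 : x ≤ x ^ (199 / 100 : ℝ) := by
      calc x = x ^ (1 : ℝ) := (Real.rpow_one x).symm
        _ ≤ _ := hle _ _ (by norm_num)
    have a2 : √D / √x ≤ √c * x ^ (199 / 100 : ℝ) := by
      rw [Real.sqrt_eq_rpow x, div_le_iff₀ (by positivity), mul_assoc, ← Real.rpow_add hx0]
      refine hsD.trans ?_
      gcongr
      norm_num
    have a3 : √(8 * x ^ 3) ≤ 3 * x ^ (199 / 100 : ℝ) := by
      rw [Real.sqrt_le_left (by positivity), mul_pow, ← Real.rpow_natCast (x ^ (199 / 100 : ℝ)),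
        ← Real.rpow_mul hx0.le]
      have : x ^ 3 ≤ x ^ ((199 / 100 : ℝ) * (2 : ℕ)) := by
        rw [← Real.rpow_natCast]
        exact hle _ _ (by norm_num)
      nlinarith [pow_pos hx0 3]
    have a4 : x ^ (-(201 / 100) : ℝ) = x ^ (-4 : ℝ) * x ^ (199 / 100 : ℝ) := by
      rw [← Real.rpow_add hx0]; norm_num
    rw [hx4, a4]
    have : 2 * x + 11 * (2 * √D / √x + √(8 * x ^ 3))
        ≤ (35 + 22 * √c) * x ^ (199 / 100 : ℝ) := by
      rw [mul_div_assoc]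
      nlinarith
    calc _ ≤ x ^ (-4 : ℝ) * ((35 + 22 * √c) * x ^ (199 / 100 : ℝ)) := by gcongr
      _ = _ := by ring
  have hB : (exceptionalSet F H Q).card * (1 / x ^ 4 * (11 * √D))
      ≤ 88 * C * √c * x ^ (-(201 / 100) : ℝ) * (H : ℝ) ^ 10 := by
    have b1 : (H : ℝ) ^ 3 / x + 1 ≤ 2 * x ^ (103 / 500 : ℝ) := by
      have : (H : ℝ) ^ 3 / x ≤ x ^ (103 / 500 : ℝ) := by
        rw [div_le_iff₀ hx0]
        calc (H : ℝ) ^ 3 ≤ (x ^ (201 / 500 : ℝ)) ^ 3 := by gcongr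
          _ = x ^ (103 / 500 : ℝ) * x := by
            rw [← Real.rpow_natCast, ← Real.rpow_mul hx0.le, ← Real.rpow_add_one hx0.ne']
            norm_num
      have h1 : 1 ≤ x ^ (103 / 500 : ℝ) := Real.one_le_rpow hx1 (by norm_num)
      linarith
    have b2 : (H : ℝ) ^ 10 / x ^ 4 + 1 ≤ 2 * x ^ (1 / 50 : ℝ) := by
      have : (H : ℝ) ^ 10 / x ^ 4 ≤ x ^ (1 / 50 : ℝ) := by
        rw [div_le_iff₀ (by positivity)]
        calc (H : ℝ) ^ 10 ≤ (x ^ (201 / 500 : ℝ)) ^ 10 := by gcongr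
          _ = x ^ (1 / 50 : ℝ) * x ^ 4 := by
            rw [← Real.rpow_natCast, ← Real.rpow_mul hx0.le, ← Real.rpow_natCast x 4,
              ← Real.rpow_add hx0]
            norm_num
      have h1 : 1 ≤ x ^ (1 / 50 : ℝ) := Real.one_le_rpow hx1 (by norm_num)
      linarith
    have b3 : (H : ℝ) ^ 9 ≤ 2 * x ^ (-(201 / 500) : ℝ) * (H : ℝ) ^ 10 := by
      have h1 : 1 ≤ 2 * x ^ (-(201 / 500) : ℝ) * H := by
        rw [Real.rpow_neg hx0.le]
        have : 0 < x ^ (201 / 500 : ℝ) := by positivity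
        rw [mul_right_comm, ← div_eq_mul_inv, le_div_iff₀ this]
        linarith
      calc (H : ℝ) ^ 9 = 1 * (H : ℝ) ^ 9 := by ring
        _ ≤ (2 * x ^ (-(201 / 500) : ℝ) * H) * (H : ℝ) ^ 9 := by gcongr
        _ = _ := by ring
    calc (exceptionalSet F H Q).card * (1 / x ^ 4 * (11 * √D))
        ≤ (C * ((2 * x ^ (103 / 500 : ℝ)) * (2 * x ^ (1 / 50 : ℝ))
          * (2 * x ^ (-(201 / 500) : ℝ) * (H : ℝ) ^ 10)))
          * (x ^ (-4 : ℝ) * (11 * (√c * x ^ (201 / 100 : ℝ)))) := by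
          rw [hx4]
          gcongr
          refine hcard.trans ?_
          gcongr
      _ = 88 * C * √c * (x ^ (103 / 500 : ℝ) * x ^ (1 / 50 : ℝ) * x ^ (-(201 / 500) : ℝ)
          * x ^ (-4 : ℝ) * x ^ (201 / 100 : ℝ)) * (H : ℝ) ^ 10 := by ring
      _ ≤ 88 * C * √c * x ^ (-(201 / 100) : ℝ) * (H : ℝ) ^ 10 := by
          gcongr
          rw [← Real.rpow_add hx0, ← Real.rpow_add hx0, ← Real.rpow_add hx0, ← Real.rpow_add hx0]
          exact hle _ _ (by norm_num)
  calc _ ≤ _ := hsplit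
    _ = _ := hsum
    _ ≤ 2 ^ 10 * (H : ℝ) ^ 10 * ((35 + 22 * √c) * x ^ (-(201 / 100) : ℝ))
        + 88 * C * √c * x ^ (-(201 / 100) : ℝ) * (H : ℝ) ^ 10 := by gcongr
    _ = _ := by ring

theorem exists_sum_diffBound_le (hn : 10 ≤ n) {F : MvPolynomial (Fin n) ℤ}
    (hF : F.IsHomogeneous 3) (hgc : GeometricCondition F) :
    ∃ (C : ℝ) (Q₀ : ℕ), 0 < C ∧ ∀ Q ≥ Q₀, ∃ H : ℕ, 0 < H ∧
      ∑ u ∈ box n H, ∑ p ∈ dyadicPrimes Q, diffBound F p u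
        ≤ C * (Q : ℝ) ^ (-(201 / 100) : ℝ) * (H : ℝ) ^ n := by
  obtain ⟨c, hc, hminor⟩ := exists_minor_bound F
  obtain ⟨K, hK, hcard⟩ := hgc.card_le (ε := 1 / 100) (by norm_num)
  obtain ⟨u₀, hu₀⟩ := exists_det_hess_ne_zero hgc
  have hdet : ∀ H : ℕ, 0 < H → ∀ u ∈ box n H,
      ((hess F u).det.natAbs : ℝ) ≤ c * (H : ℝ) ^ n := fun H hH u hu =>
    hminor H hH u hu n le_rfl id id
  obtain ⟨Q₁, hQ₁⟩ := exists_nat_ge c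
  obtain ⟨C', hC', hex⟩ : ∃ C' : ℝ, 0 < C' ∧ (n = 10 → ∀ H Q : ℕ, 0 < H → 0 < Q →
      ((exceptionalSet F H Q).card : ℝ)
        ≤ C' * (((H : ℝ) ^ 3 / Q + 1) * ((H : ℝ) ^ 10 / (Q : ℝ) ^ 4 + 1) * (H : ℝ) ^ 9)) := by
    by_cases h10 : n = 10
    · obtain ⟨C', h1, h2⟩ := exists_card_exceptionalSet_le h10 hF hu₀ (by linarith) hdet
      exact ⟨C', h1, fun _ => h2⟩
    · exact ⟨1, one_pos, fun h => absurd h h10⟩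
  set A : ℝ := 2 ^ n * (4 * K) * (1 + (n + 1) * √c) with hA
  set B : ℝ := 2 ^ 10 * (35 + 22 * √c) + 88 * C' * √c with hB
  have hA0 : 0 < A := by positivity
  have hB0 : 0 < B := by positivity
  refine ⟨(n + 1) * (A + B), max 2 Q₁, by positivity, ?_⟩
  intro Q hQ
  have hQ2 : 2 ≤ Q := (le_max_left _ _).trans hQ
  have hcQ : c ≤ Q := hQ₁.trans (by exact_mod_cast (le_max_right _ _).trans hQ)
  have hx1 : (1 : ℝ) ≤ Q := by exact_mod_cast (by omega : 1 ≤ Q)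
  -- Taking the integer part of `y ≥ 1` as the side of the box loses at most a factor 2.
  set y : ℝ := (Q : ℝ) ^ (201 / 500 : ℝ) with hy
  have hy1 : 1 ≤ y := Real.one_le_rpow hx1 (by norm_num)
  have hH0 : 0 < ⌊y⌋₊ := Nat.floor_pos.2 hy1
  have hH1 : (⌊y⌋₊ : ℝ) ≤ y := Nat.floor_le (by linarith)
  have hH2 : y ≤ 2 * ⌊y⌋₊ := by
    have h1 := (Nat.lt_floor_add_one y).le
    have h2 : (1 : ℝ) ≤ ⌊y⌋₊ := by exact_mod_cast hH0
    linarith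
  refine ⟨⌊y⌋₊, hH0, ?_⟩
  rw [sum_box_eq F]
  have hpos : (0 : ℝ) ≤ (Q : ℝ) ^ (-(201 / 100) : ℝ) * (⌊y⌋₊ : ℝ) ^ n := by positivity
  have hmono : ∀ s ≤ A + B, s * (Q : ℝ) ^ (-(201 / 100) : ℝ) * (⌊y⌋₊ : ℝ) ^ n
      ≤ (A + B) * (Q : ℝ) ^ (-(201 / 100) : ℝ) * (⌊y⌋₊ : ℝ) ^ n := by
    intro s hs
    rw [mul_assoc, mul_assoc (A + B)]
    exact mul_le_mul_of_nonneg_right hs hpos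
  calc _ ≤ ∑ _r ∈ Finset.range (n + 1),
        (A + B) * (Q : ℝ) ^ (-(201 / 100) : ℝ) * (⌊y⌋₊ : ℝ) ^ n := by
        refine Finset.sum_le_sum fun r hr => ?_
        have hrn : r ≤ n := Nat.lt_succ_iff.1 (Finset.mem_range.1 hr)
        by_cases hcase : r < n ∨ 11 ≤ n
        · refine (sum_rank_diffBound_le hrn hc hK (fun u hu => hminor _ hH0 u hu r hrn)
            (hcard _ hH0 r hrn) hn hcase hQ2 hcQ hH0 hH1 hH2).trans ?_
          exact hmono _ (by rw [← hA]; linarith)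
        · have h10 : n = 10 := by omega
          have hr10 : r = n := by omega
          rw [hr10]
          refine (sum_full_rank_diffBound_le h10 hc hC' (hdet _ hH0)
            (hex h10 _ _ hH0 (by omega)) hQ2 hcQ hH0 hH1 hH2).trans ?_
          exact hmono _ (by rw [← hB]; linarith)
    _ = _ := by simp; ring

/-- Cauchy–Schwarz over `p` gives `Q · Q · Q ^ (-201/100) = Q ^ (-1/100)` for the square of the sum.
-/
theorem exists_sum_dyadicPrimes_absSum_le (hn : 10 ≤ n) {F : MvPolynomial (Fin n) ℤ}
    (hF : F.IsHomogeneous 3) (hgc : GeometricCondition F) :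
    ∃ (C : ℝ) (Q₀ : ℕ), 0 < C ∧ ∀ Q ≥ Q₀,
      ∑ p ∈ dyadicPrimes Q, absSum F p ≤ C * (Q : ℝ) ^ (-(1 / 200) : ℝ) := by
  obtain ⟨C, Q₀, hC, h⟩ := exists_sum_diffBound_le hn hF hgc
  refine ⟨√(2 * C), max 1 Q₀, by positivity, ?_⟩
  intro Q hQ
  have hQ1 : 1 ≤ Q := (le_max_left _ _).trans hQ
  have hx0 : (0 : ℝ) < Q := by exact_mod_cast hQ1
  obtain ⟨H, hH, hsum⟩ := h Q ((le_max_right _ _).trans hQ)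
  have hHn : (0 : ℝ) < (H : ℝ) ^ n := by positivity
  have h1 := sq_sum_le_card_mul_sum_sq (s := dyadicPrimes Q) (f := fun p => absSum F p)
  have h2 : ∑ p ∈ dyadicPrimes Q, absSum F p ^ 2
      ≤ 2 * Q / (H : ℝ) ^ n * ∑ u ∈ box n H, ∑ p ∈ dyadicPrimes Q, diffBound F p u := by
    rw [Finset.sum_comm, Finset.mul_sum]
    refine Finset.sum_le_sum fun p hp => ?_
    obtain ⟨⟨-, hp2⟩, hpp⟩ := mem_dyadicPrimes.1 hp
    refine (absSum_prime_sq_le hF hpp hH).trans ?_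
    have : 0 ≤ ∑ u ∈ box n H, diffBound F p u :=
      Finset.sum_nonneg fun u _ => diffBound_nonneg F p u
    have hp2' : (p : ℝ) ≤ 2 * Q := by exact_mod_cast hp2.le
    gcongr
  have h3 : (∑ p ∈ dyadicPrimes Q, absSum F p) ^ 2 ≤ 2 * C * (Q : ℝ) ^ (-(1 / 100) : ℝ) := by
    refine h1.trans ?_
    have hcard : ((dyadicPrimes Q).card : ℝ) ≤ Q := by exact_mod_cast card_dyadicPrimes_le Q
    have hQQ : (Q : ℝ) ^ (-(1 / 100) : ℝ) = Q * Q * (Q : ℝ) ^ (-(201 / 100) : ℝ) := by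
      rw [mul_assoc, mul_comm (Q : ℝ) ((Q : ℝ) ^ _), ← Real.rpow_add_one hx0.ne',
        mul_comm, ← Real.rpow_add_one hx0.ne']
      norm_num
    calc _ ≤ (Q : ℝ) * (2 * Q / (H : ℝ) ^ n
          * (C * (Q : ℝ) ^ (-(201 / 100) : ℝ) * (H : ℝ) ^ n)) := by
          gcongr
          refine h2.trans ?_
          gcongr
      _ = _ := by rw [hQQ]; field_simp
  refine abs_le_of_sq_le_sq' ?_ (by positivity) |>.2
  rw [mul_pow, Real.sq_sqrt (by positivity), ← Real.rpow_natCast ((Q : ℝ) ^ _),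
    ← Real.rpow_mul hx0.le]
  refine h3.trans (le_of_eq ?_)
  norm_num

/-! ### Absolute convergence of the singular series. -/

theorem exists_absSum_le (hn : 10 ≤ n) {F : MvPolynomial (Fin n) ℤ}
    (hF : F.IsHomogeneous 3) (hgc : GeometricCondition F) :
    ∃ C : ℝ, 0 < C ∧ ∀ q : ℕ, 0 < q → absSum F q ≤ C * (q : ℝ) ^ (-(3 / 5) : ℝ) := by
  obtain ⟨C, hC, h⟩ := exists_norm_charSum_le hn hF hgc
  refine ⟨C, hC, fun q hq => ?_⟩
  have : NeZero q := ⟨hq.ne'⟩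
  have hq0 : (0 : ℝ) < q := by exact_mod_cast hq
  rw [absSum_eq]
  calc _ ≤ ∑ _a : (ZMod q)ˣ, C * (q : ℝ) ^ (-(8 / 5) : ℝ) := Finset.sum_le_sum fun a _ => h q a
    _ = (Fintype.card (ZMod q)ˣ) * (C * (q : ℝ) ^ (-(8 / 5) : ℝ)) := by
      rw [Finset.sum_const, nsmul_eq_mul, Finset.card_univ]
    _ ≤ q * (C * (q : ℝ) ^ (-(8 / 5) : ℝ)) := by
      gcongr
      rw [ZMod.card_units_eq_totient]
      exact Nat.totient_le q
    _ = C * ((q : ℝ) ^ (-(8 / 5) : ℝ) * q) := by ring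
    _ = _ := by
      rw [← Real.rpow_add_one hq0.ne']
      norm_num

theorem sum_range_two_pow_le {f : ℕ → ℝ} {g : ℕ → ℝ} {j₀ : ℕ}
    (h : ∀ j ≥ j₀, ∑ i ∈ Finset.Ico (2 ^ j) (2 * 2 ^ j), f i ≤ g j) (m : ℕ) :
    ∑ i ∈ Finset.range (2 ^ (j₀ + m)), f i
      ≤ ∑ i ∈ Finset.range (2 ^ j₀), f i + ∑ k ∈ Finset.range m, g (j₀ + k) := by
  induction m with
  | zero => simp
  | succ m ih =>
    rw [Finset.sum_range_succ]
    have e : 2 ^ (j₀ + (m + 1)) = 2 * 2 ^ (j₀ + m) := by ring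
    rw [e, ← Finset.sum_range_add_sum_Ico f (by omega : 2 ^ (j₀ + m) ≤ 2 * 2 ^ (j₀ + m))]
    have := h (j₀ + m) (by omega)
    linarith

theorem summable_absSum_prime (hn : 10 ≤ n) {F : MvPolynomial (Fin n) ℤ}
    (hF : F.IsHomogeneous 3) (hgc : GeometricCondition F) :
    Summable fun p : ℕ => if p.Prime then absSum F p else 0 := by
  obtain ⟨C, Q₀, hC, h⟩ := exists_sum_dyadicPrimes_absSum_le hn hF hgc
  set f : ℕ → ℝ := fun p => if p.Prime then absSum F p else 0 with hf
  have hf0 : ∀ p, 0 ≤ f p := by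
    intro p
    simp only [hf]
    split_ifs
    · exact absSum_nonneg F p
    · exact le_rfl
  set ρ : ℝ := (2 : ℝ) ^ (-(1 / 200) : ℝ) with hρ
  have hρ0 : 0 ≤ ρ := by positivity
  have hρ1 : ρ < 1 := Real.rpow_lt_one_of_one_lt_of_neg (by norm_num) (by norm_num)
  have hdy : ∀ j ≥ Q₀, ∑ i ∈ Finset.Ico (2 ^ j) (2 * 2 ^ j), f i ≤ C * ρ ^ j := by
    intro j hj
    have h1 := h (2 ^ j) (hj.trans (Nat.lt_two_pow_self).le)
    rw [dyadicPrimes, Finset.sum_filter] at h1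
    refine h1.trans (le_of_eq ?_)
    rw [hρ, ← Real.rpow_natCast, ← Real.rpow_mul (by norm_num), mul_comm _ (j : ℝ),
      Real.rpow_mul (by norm_num), Real.rpow_natCast]
    push_cast
    rfl
  have hgeom : Summable fun j => C * ρ ^ j := (summable_geometric_of_lt_one hρ0 hρ1).mul_left C
  refine summable_of_sum_range_le (c := ∑ i ∈ Finset.range (2 ^ Q₀), f i + ∑' j, C * ρ ^ j) hf0 ?_
  intro N
  have h2 : N ≤ 2 ^ (Q₀ + N) :=
    (Nat.lt_two_pow_self).le.trans (Nat.pow_le_pow_right (by norm_num) (by omega))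
  calc ∑ i ∈ Finset.range N, f i ≤ ∑ i ∈ Finset.range (2 ^ (Q₀ + N)), f i :=
        Finset.sum_le_sum_of_subset_of_nonneg (Finset.range_mono h2) fun i _ _ => hf0 i
    _ ≤ ∑ i ∈ Finset.range (2 ^ Q₀), f i + ∑ k ∈ Finset.range N, C * ρ ^ (Q₀ + k) :=
        sum_range_two_pow_le hdy N
    _ ≤ _ := by
      gcongr
      have h3 : ∑ k ∈ Finset.range N, C * ρ ^ (Q₀ + k)
          ≤ ∑ k ∈ Finset.range N, C * ρ ^ k := by
        refine Finset.sum_le_sum fun k _ => ?_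
        gcongr ?_ * ?_
        exact pow_le_pow_of_le_one hρ0 hρ1.le (by omega)
      exact h3.trans (hgeom.sum_le_tsum _ fun i _ => by positivity)

theorem summable_absSum_prime_pow (hn : 10 ≤ n) {F : MvPolynomial (Fin n) ℤ}
    (hF : F.IsHomogeneous 3) (hgc : GeometricCondition F) {p : ℕ} (hp : p.Prime) :
    Summable fun k => absSum F (p ^ k) := by
  obtain ⟨C, hC, h⟩ := exists_absSum_le hn hF hgc
  have hp1 : (1 : ℝ) < p := by exact_mod_cast hp.one_lt
  set ρ : ℝ := (p : ℝ) ^ (-(3 / 5) : ℝ) with hρ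
  have hρ0 : 0 ≤ ρ := by positivity
  have hρ1 : ρ < 1 := Real.rpow_lt_one_of_one_lt_of_neg hp1 (by norm_num)
  refine Summable.of_nonneg_of_le (fun k => absSum_nonneg F _) (fun k => ?_)
    ((summable_geometric_of_lt_one hρ0 hρ1).mul_left C)
  refine (h (p ^ k) (pow_pos hp.pos k)).trans (le_of_eq ?_)
  rw [hρ, ← Real.rpow_natCast _ k, ← Real.rpow_mul (by positivity), mul_comm _ (k : ℝ),
    Real.rpow_mul (by positivity), Real.rpow_natCast]
  push_cast
  rfl

/-- The contribution of the positive powers of `p`. -/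
noncomputable def primeTail (F : MvPolynomial (Fin n) ℤ) (p : ℕ) : ℝ :=
  ∑' k, absSum F (p ^ (k + 1))

theorem primeTail_nonneg (F : MvPolynomial (Fin n) ℤ) (p : ℕ) : 0 ≤ primeTail F p :=
  tsum_nonneg fun _ => absSum_nonneg F _

/-- The first term is kept apart, since at primes it is controlled only on average. The number `σ`
stands for a bound on the ratio that is uniform in `p`. -/
theorem tsum_succ_le_of_le_geometric {f : ℕ → ℝ} (hf : Summable f) {C ρ σ : ℝ} (hC : 0 ≤ C)
    (hρ0 : 0 ≤ ρ) (hρσ : ρ ≤ σ) (hσ1 : σ < 1) (h : ∀ k, f k ≤ C * ρ ^ k) :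
    ∑' k, f (k + 1) ≤ f 1 + C * (1 - σ)⁻¹ * ρ ^ 2 := by
  have hs1 : Summable fun k => f (k + 1) := (summable_nat_add_iff 1).2 hf
  have hs2 : Summable fun k => f (k + 1 + 1) :=
    (summable_nat_add_iff 1 (f := fun k => f (k + 1))).2 hs1
  rw [hs1.tsum_eq_zero_add, zero_add]
  have hg : HasSum (fun k => C * (ρ ^ 2 * ρ ^ k)) (C * (ρ ^ 2 * (1 - ρ)⁻¹)) :=
    ((hasSum_geometric_of_lt_one hρ0 (by linarith)).mul_left _).mul_left _
  have h1 : ∑' k, f (k + 1 + 1) ≤ C * (ρ ^ 2 * (1 - ρ)⁻¹) := by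
    rw [← hg.tsum_eq]
    refine hs2.tsum_le_tsum (fun k => ?_) hg.summable
    rw [← pow_add, add_comm 2 k]
    exact h (k + 1 + 1)
  have h2 : (1 - ρ)⁻¹ ≤ (1 - σ)⁻¹ := inv_anti₀ (by linarith) (by linarith)
  have h3 : C * (ρ ^ 2 * (1 - ρ)⁻¹) ≤ C * (ρ ^ 2 * (1 - σ)⁻¹) := by gcongr
  have h4 : C * (ρ ^ 2 * (1 - σ)⁻¹) = C * (1 - σ)⁻¹ * ρ ^ 2 := by ring
  linarith

theorem natCast_pow_rpow (p k : ℕ) (s : ℝ) : ((p ^ k : ℕ) : ℝ) ^ s = ((p : ℝ) ^ s) ^ k := by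
  rw [Nat.cast_pow, ← Real.rpow_natCast, ← Real.rpow_natCast, ← Real.rpow_mul (by positivity),
    ← Real.rpow_mul (by positivity), mul_comm]

theorem primeTail_le (hn : 10 ≤ n) {F : MvPolynomial (Fin n) ℤ}
    (hF : F.IsHomogeneous 3) (hgc : GeometricCondition F) {C : ℝ} (hC : 0 < C)
    (h : ∀ q : ℕ, 0 < q → absSum F q ≤ C * (q : ℝ) ^ (-(3 / 5) : ℝ)) {p : ℕ} (hp : p.Prime) :
    primeTail F p ≤ absSum F p
      + C * (1 - (2 : ℝ) ^ (-(3 / 5) : ℝ))⁻¹ * (p : ℝ) ^ (-(6 / 5) : ℝ) := by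
  have hp2 : (2 : ℝ) ≤ p := by exact_mod_cast hp.two_le
  have hσ1 : (2 : ℝ) ^ (-(3 / 5) : ℝ) < 1 :=
    Real.rpow_lt_one_of_one_lt_of_neg (by norm_num) (by norm_num)
  have hρσ : (p : ℝ) ^ (-(3 / 5) : ℝ) ≤ (2 : ℝ) ^ (-(3 / 5) : ℝ) :=
    Real.rpow_le_rpow_of_nonpos (by norm_num) hp2 (by norm_num)
  have hsq : ((p : ℝ) ^ (-(3 / 5) : ℝ)) ^ 2 = (p : ℝ) ^ (-(6 / 5) : ℝ) := by
    rw [← Real.rpow_natCast, ← Real.rpow_mul (by linarith)]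
    norm_num
  have := tsum_succ_le_of_le_geometric (summable_absSum_prime_pow hn hF hgc hp) hC.le
    (Real.rpow_nonneg (by linarith) _) hρσ hσ1 fun k => by
      rw [← natCast_pow_rpow]
      exact h (p ^ k) (pow_pos hp.pos k)
  rwa [hsq, pow_one] at this

theorem summable_primeTail (hn : 10 ≤ n) {F : MvPolynomial (Fin n) ℤ}
    (hF : F.IsHomogeneous 3) (hgc : GeometricCondition F) :
    Summable fun p : ℕ => if p.Prime then primeTail F p else 0 := by
  obtain ⟨C, hC, h⟩ := exists_absSum_le hn hF hgc
  have hmain : Summable fun p : ℕ => (if p.Prime then absSum F p else 0)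
      + C * (1 - (2 : ℝ) ^ (-(3 / 5) : ℝ))⁻¹ * (p : ℝ) ^ (-(6 / 5) : ℝ) :=
    (summable_absSum_prime hn hF hgc).add
      ((Real.summable_nat_rpow.2 (by norm_num)).mul_left _)
  refine Summable.of_nonneg_of_le (fun p => ?_) (fun p => ?_) hmain
  · split_ifs
    · exact primeTail_nonneg F p
    · exact le_rfl
  · split_ifs with hp
    · exact primeTail_le hn hF hgc hC h hp
    · have hσ1 : (2 : ℝ) ^ (-(3 / 5) : ℝ) < 1 :=
        Real.rpow_lt_one_of_one_lt_of_neg (by norm_num) (by norm_num)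
      have : 0 ≤ (1 - (2 : ℝ) ^ (-(3 / 5) : ℝ))⁻¹ := inv_nonneg.2 (by linarith)
      have : 0 ≤ (p : ℝ) ^ (-(6 / 5) : ℝ) := by positivity
      rw [zero_add]
      exact mul_nonneg (mul_nonneg hC.le ‹_›) ‹_›

theorem absSum_one (F : MvPolynomial (Fin n) ℤ) : absSum F 1 = 1 := by
  rw [absSum_eq_localSum, localSum_one]

theorem absSum_zero (F : MvPolynomial (Fin n) ℤ) : absSum F 0 = 0 := by
  rw [absSum_eq_localSum, localSum_zero]

theorem absSum_mul (F : MvPolynomial (Fin n) ℤ) {q r : ℕ} (h : q.Coprime r) :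
    absSum F (q * r) = absSum F q * absSum F r := by
  simp only [absSum_eq_localSum, localSum_mul F _ h]

/-- By multiplicativity a partial sum is at most a finite Euler product, and `1 + t ≤ exp t` bounds
this by the exponential of the sum of the prime tails. -/
theorem summable_absSum (hn : 10 ≤ n) {F : MvPolynomial (Fin n) ℤ}
    (hF : F.IsHomogeneous 3) (hgc : GeometricCondition F) : Summable (absSum F) := by
  have htail := summable_primeTail hn hF hgc
  refine summable_of_sum_range_le (c := Real.exp (∑' p : ℕ, if p.Prime then primeTail F p else 0))
    (absSum_nonneg F) ?_
  intro N
  have hsm := EulerProduct.summable_and_hasSum_smoothNumbers_prod_primesBelow_tsum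
    (f := absSum F) (absSum_one F) (fun h => absSum_mul F h)
    (fun hp => (summable_absSum_prime_pow hn hF hgc hp).norm) N
  have h1 : ∑ i ∈ Finset.range N, absSum F i
      ≤ ∏ p ∈ N.primesBelow, ∑' k, absSum F (p ^ k) := by
    have h2 : ∑ i ∈ Finset.range N, absSum F i = ∑ i ∈ (Finset.range N).erase 0, absSum F i := by
      rcases Nat.eq_zero_or_pos N with rfl | hN
      · simp
      · rw [← Finset.add_sum_erase _ _ (Finset.mem_range.2 hN), absSum_zero, zero_add]
    have hmem : ∀ i ∈ (Finset.range N).erase 0, i ∈ N.smoothNumbers := by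
      intro i hi
      obtain ⟨hi0, hi⟩ := Finset.mem_erase.1 hi
      refine ⟨hi0, fun p hp => ?_⟩
      exact (Nat.le_of_mem_primeFactorsList hp).trans_lt (Finset.mem_range.1 hi)
    rw [h2, ← hsm.2.tsum_eq, ← Finset.sum_subtype_of_mem (absSum F) hmem]
    exact hsm.2.summable.sum_le_tsum _ fun i _ => absSum_nonneg F _
  refine h1.trans ?_
  have h3 : ∏ p ∈ N.primesBelow, ∑' k, absSum F (p ^ k)
      ≤ ∏ p ∈ N.primesBelow, Real.exp (if p.Prime then primeTail F p else 0) := by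
    refine Finset.prod_le_prod (fun p _ => tsum_nonneg fun _ => absSum_nonneg F _) fun p hp => ?_
    have hpp := Nat.prime_of_mem_primesBelow hp
    rw [if_pos hpp, (summable_absSum_prime_pow hn hF hgc hpp).tsum_eq_zero_add, pow_zero,
      absSum_one, add_comm]
    exact Real.add_one_le_exp _
  refine h3.trans ?_
  rw [← Real.exp_sum]
  refine Real.exp_le_exp.2 (htail.sum_le_tsum _ fun p _ => ?_)
  split_ifs
  · exact primeTail_nonneg F p
  · exact le_rfl

/-! ### Smooth points modulo every prime. -/

/-- Hensel lifting of the root `0` modulo `p` of a polynomial whose derivative is a unit there. -/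
theorem exists_dvd_cubic {p : ℕ} (hp : p.Prime) (f d c b : ℤ) (hd : ¬ (p : ℤ) ∣ d) (m : ℕ) :
    ∃ t : ℤ, (p : ℤ) ∣ t ∧ (p : ℤ) ^ (m + 1) ∣ p * f + d * t + c * t ^ 2 + b * t ^ 3 := by
  have hp' : Prime (p : ℤ) := Nat.prime_iff_prime_int.1 hp
  induction m with
  | zero => exact ⟨0, dvd_zero _, by simp⟩
  | succ m ih =>
    obtain ⟨t, ⟨s, hs⟩, w, hw⟩ := ih
    obtain ⟨α, β, hαβ⟩ := (hp'.irreducible.coprime_iff_not_dvd (n := d)).2 hd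
    -- Newton step: `β` inverts the derivative `d` modulo `p`, and `p ∣ t` makes the quadratic and
    -- cubic corrections negligible.
    refine ⟨t + p ^ (m + 1) * (-(w * β)), ?_, ?_⟩
    · exact dvd_add ⟨s, hs⟩ (dvd_mul_of_dvd_left (dvd_pow_self _ (by omega)) _)
    · set v : ℤ := -(w * β) with hv
      refine ⟨w * α + c * (2 * s * v + p ^ m * v ^ 2)
        + b * (3 * p * s ^ 2 * v + 3 * p ^ (m + 1) * s * v ^ 2 + p ^ (2 * m + 1) * v ^ 3), ?_⟩
      have e : p * f + d * (t + p ^ (m + 1) * v) + c * (t + p ^ (m + 1) * v) ^ 2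
          + b * (t + p ^ (m + 1) * v) ^ 3
          = (p * f + d * t + c * t ^ 2 + b * t ^ 3) + p ^ (m + 1) * (d * v)
            + c * (2 * t * (p ^ (m + 1) * v) + (p ^ (m + 1) * v) ^ 2)
            + b * (3 * t ^ 2 * (p ^ (m + 1) * v) + 3 * t * (p ^ (m + 1) * v) ^ 2
              + (p ^ (m + 1) * v) ^ 3) := by ring
      have e2 : d * v = -w + w * α * p := by rw [hv]; linear_combination (-w) * hαβ
      rw [e, hw, e2, hs]
      ring

/-- No integral point satisfies the hypothesis of Hensel's lemma for `F = 0` at `p`. -/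
def NoSmoothPoint (F : MvPolynomial (Fin n) ℤ) (p : ℕ) : Prop :=
  ∀ (x : Fin n → ℤ) (l : ℕ) (y : Fin n → ℤ),
    (p : ℤ) ^ (2 * l + 1) ∣ eval x F → (p : ℤ) ^ (l + 1) ∣ gradDot F x y

section

variable {F : MvPolynomial (Fin n) ℤ} {p : ℕ}

theorem eval_add_smul (hF : F.IsHomogeneous 3) (e y : Fin n → ℤ) (t : ℤ) :
    eval (e + t • y) F
      = eval e F + t * gradDot F e y + t ^ 2 * gradDot F y e + t ^ 3 * eval y F := by
  rw [eval_add_eq hF, gradDot_smul_right, gradDot_smul_left hF, eval_smul_eq hF]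

theorem gradDot_add_smul (hF : F.IsHomogeneous 3) (e y : Fin n → ℤ) (t : ℤ) :
    gradDot F (e + t • y) y
      = gradDot F e y + t * (2 * gradDot F y e) + t ^ 2 * (3 * eval y F) := by
  rw [gradDot_add_left hF, gradDot_smul_left hF, gradDot_self hF, tri_smul_mid, tri_self_left hF]

/-- Along the line `e + t y` the cubic is `p ^ k` times a polynomial in `t` of the form treated by
`exists_dvd_cubic`. If `p ^ (k + 1) ∤ ∇F(e) · y`, Hensel gives `p ∣ t` with `p ^ (2k + 1) ∣ F(e + t
y)`. The absence of smooth points then makes `p ^ (k + 1)` divide the derivative there, which agrees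
with `∇F(e) · y` modulo `p ^ (k + 1)`. -/
theorem NoSmoothPoint.dvd_gradDot_left (hF : F.IsHomogeneous 3) (hp : p.Prime)
    (hbad : NoSmoothPoint F p) {k : ℕ}
    (hk : ∀ x y : Fin n → ℤ, (p : ℤ) ^ k ∣ eval x F → (p : ℤ) ^ k ∣ eval y F →
      (p : ℤ) ^ k ∣ gradDot F x y)
    {e y : Fin n → ℤ} (he : (p : ℤ) ^ (k + 1) ∣ eval e F) (hy : (p : ℤ) ^ k ∣ eval y F) :
    (p : ℤ) ^ (k + 1) ∣ gradDot F e y := by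
  have he' : (p : ℤ) ^ k ∣ eval e F := (pow_dvd_pow _ (Nat.le_succ k)).trans he
  obtain ⟨d, hd⟩ := hk e y he' hy
  obtain ⟨c, hc⟩ := hk y e hy he'
  obtain ⟨f, hf⟩ := he
  obtain ⟨b, hb⟩ := hy
  by_cases hpd : (p : ℤ) ∣ d
  · obtain ⟨d', rfl⟩ := hpd
    exact ⟨d', by rw [hd]; ring⟩
  obtain ⟨t, ⟨s, hs⟩, w, hw⟩ := exists_dvd_cubic hp f d c b hpd k
  have h1 : (p : ℤ) ^ (2 * k + 1) ∣ eval (e + t • y) F := by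
    refine ⟨w, ?_⟩
    rw [eval_add_smul hF, hf, hd, hc, hb]
    linear_combination (p : ℤ) ^ k * hw
  obtain ⟨g, hg⟩ := hbad _ k y h1
  rw [gradDot_add_smul hF, hc, hb] at hg
  refine ⟨g - s * (2 * c) - p * s ^ 2 * (3 * b), ?_⟩
  rw [hs] at hg
  linear_combination hg

/-- This is what makes the set `p ^ k ∣ F(x)` closed under addition. -/
theorem NoSmoothPoint.dvd_gradDot (hF : F.IsHomogeneous 3) (hp : p.Prime)
    (hbad : NoSmoothPoint F p) (k : ℕ) :
    ∀ x y : Fin n → ℤ, (p : ℤ) ^ k ∣ eval x F → (p : ℤ) ^ k ∣ eval y F →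
      (p : ℤ) ^ k ∣ gradDot F x y := by
  induction k with
  | zero => simp
  | succ k ih =>
    exact fun x y hx hy => hbad.dvd_gradDot_left hF hp ih hx
      ((pow_dvd_pow _ (Nat.le_succ k)).trans hy)

/-- The points at which `F` vanishes modulo `p ^ k`. -/
def NoSmoothPoint.lattice (hF : F.IsHomogeneous 3) (hp : p.Prime)
    (hbad : NoSmoothPoint F p) (k : ℕ) : AddSubgroup (Fin n → ℤ) where
  carrier := {x | (p : ℤ) ^ k ∣ eval x F}
  add_mem' {x y} hx hy := by
    have h1 := hbad.dvd_gradDot hF hp k x y hx hy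
    have h2 := hbad.dvd_gradDot hF hp k y x hy hx
    simp only [Set.mem_ofPred_eq] at *
    rw [eval_add_eq hF]
    exact dvd_add (dvd_add (dvd_add hx h1) h2) hy
  zero_mem' := by
    have h := eval_smul_eq hF 0 (0 : Fin n → ℤ)
    rw [smul_zero, zero_pow (by norm_num), zero_mul] at h
    rw [Set.mem_ofPred_eq, h]
    exact dvd_zero _
  neg_mem' {x} hx := by
    simp only [Set.mem_ofPred_eq] at *
    rwa [eval_neg_eq hF, dvd_neg]

theorem NoSmoothPoint.mem_lattice (hF : F.IsHomogeneous 3) (hp : p.Prime)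
    (hbad : NoSmoothPoint F p) {k : ℕ} {x : Fin n → ℤ} :
    x ∈ hbad.lattice hF hp k ↔ (p : ℤ) ^ k ∣ eval x F := Iff.rfl

theorem NoSmoothPoint.dvd_tri (hF : F.IsHomogeneous 3) (hp : p.Prime)
    (hbad : NoSmoothPoint F p) {k : ℕ} {x y z : Fin n → ℤ} (hx : x ∈ hbad.lattice hF hp k)
    (hy : y ∈ hbad.lattice hF hp k) (hz : z ∈ hbad.lattice hF hp k) :
    (p : ℤ) ^ k ∣ tri F x y z := by
  have h := gradDot_add_left hF x y z
  have h1 := hbad.dvd_gradDot hF hp k _ _ (add_mem hx hy) hz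
  have h2 := hbad.dvd_gradDot hF hp k _ _ hx hz
  have h3 := hbad.dvd_gradDot hF hp k _ _ hy hz
  have e : tri F x y z = gradDot F (x + y) z - gradDot F x z - gradDot F y z := by
    rw [h]; ring
  rw [e]
  exact dvd_sub (dvd_sub h1 h2) h3

theorem NoSmoothPoint.lattice_succ_le (hF : F.IsHomogeneous 3) (hp : p.Prime)
    (hbad : NoSmoothPoint F p) (k : ℕ) :
    hbad.lattice hF hp (k + 1) ≤ hbad.lattice hF hp k :=
  fun _ hx => (pow_dvd_pow _ (Nat.le_succ k)).trans hx

end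

/-- A cubic form in four variables over `ZMod p`, given by its coefficients, has a nontrivial
zero. -/
theorem exists_ne_zero_cubic_eq_zero {p : ℕ} [Fact p.Prime] (a : Fin 4 → ZMod p)
    (d : Fin 4 → Fin 4 → ZMod p) (t : Fin 4 → ZMod p) :
    ∃ s : Fin 4 → ZMod p, s ≠ 0 ∧
      a 0 * s 0 ^ 3 + a 1 * s 1 ^ 3 + a 2 * s 2 ^ 3 + a 3 * s 3 ^ 3
      + d 0 1 * (s 0 ^ 2 * s 1) + d 0 2 * (s 0 ^ 2 * s 2) + d 0 3 * (s 0 ^ 2 * s 3)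
      + d 1 0 * (s 1 ^ 2 * s 0) + d 1 2 * (s 1 ^ 2 * s 2) + d 1 3 * (s 1 ^ 2 * s 3)
      + d 2 0 * (s 2 ^ 2 * s 0) + d 2 1 * (s 2 ^ 2 * s 1) + d 2 3 * (s 2 ^ 2 * s 3)
      + d 3 0 * (s 3 ^ 2 * s 0) + d 3 1 * (s 3 ^ 2 * s 1) + d 3 2 * (s 3 ^ 2 * s 2)
      + t 0 * (s 1 * s 2 * s 3) + t 1 * (s 0 * s 2 * s 3) + t 2 * (s 0 * s 1 * s 3)
      + t 3 * (s 0 * s 1 * s 2) = 0 := by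
  have hp : p.Prime := Fact.out
  have hX : ∀ i j k : Fin 4, ∀ c : ZMod p,
      (C c * (X i * X j * X k) : MvPolynomial (Fin 4) (ZMod p)).IsHomogeneous 3 := fun i j k c =>
    (isHomogeneous_C _ c).mul (((isHomogeneous_X _ i).mul (isHomogeneous_X _ j)).mul
      (isHomogeneous_X _ k))
  let P : MvPolynomial (Fin 4) (ZMod p) :=
      C (a 0) * (X 0 * X 0 * X 0) + C (a 1) * (X 1 * X 1 * X 1) + C (a 2) * (X 2 * X 2 * X 2)
      + C (a 3) * (X 3 * X 3 * X 3)
      + C (d 0 1) * (X 0 * X 0 * X 1) + C (d 0 2) * (X 0 * X 0 * X 2)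
      + C (d 0 3) * (X 0 * X 0 * X 3) + C (d 1 0) * (X 1 * X 1 * X 0)
      + C (d 1 2) * (X 1 * X 1 * X 2) + C (d 1 3) * (X 1 * X 1 * X 3)
      + C (d 2 0) * (X 2 * X 2 * X 0) + C (d 2 1) * (X 2 * X 2 * X 1)
      + C (d 2 3) * (X 2 * X 2 * X 3) + C (d 3 0) * (X 3 * X 3 * X 0)
      + C (d 3 1) * (X 3 * X 3 * X 1) + C (d 3 2) * (X 3 * X 3 * X 2)
      + C (t 0) * (X 1 * X 2 * X 3) + C (t 1) * (X 0 * X 2 * X 3) + C (t 2) * (X 0 * X 1 * X 3)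
      + C (t 3) * (X 0 * X 1 * X 2)
  have hPh : P.IsHomogeneous 3 := by
    repeat' refine IsHomogeneous.add ?_ ?_
    all_goals exact hX _ _ _ _
  have hdeg : P.totalDegree < Fintype.card (Fin 4) := by
    have := hPh.totalDegree_le
    simp only [Fintype.card_fin]
    omega
  -- Chevalley–Warning: the degree 3 is less than the number of variables 4, so the zero at the
  -- origin is not the only one.
  have hdvd := char_dvd_card_solutions p hdeg
  have h0 : eval (0 : Fin 4 → ZMod p) P = 0 := by simp [P]
  have : Nonempty {x : Fin 4 → ZMod p // eval x P = 0} := ⟨⟨0, h0⟩⟩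
  have h1 : 1 < Fintype.card {x : Fin 4 → ZMod p // eval x P = 0} :=
    hp.one_lt.trans_le (Nat.le_of_dvd Fintype.card_pos hdvd)
  obtain ⟨⟨s, hs⟩, hne⟩ := Fintype.exists_ne_of_one_lt_card h1 ⟨0, h0⟩
  refine ⟨s, fun h => hne (Subtype.ext h), ?_⟩
  rw [← hs]
  simp only [P, map_add, map_mul, eval_C, eval_X]
  ring

section

variable {F : MvPolynomial (Fin n) ℤ} {p : ℕ}

theorem eval_sum_four (hF : F.IsHomogeneous 3) (y : Fin 4 → Fin n → ℤ) (s : Fin 4 → ℤ) :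
    eval (∑ i, s i • y i) F
    = eval (y 0) F * s 0 ^ 3 + eval (y 1) F * s 1 ^ 3 + eval (y 2) F * s 2 ^ 3
      + eval (y 3) F * s 3 ^ 3
      + gradDot F (y 0) (y 1) * (s 0 ^ 2 * s 1) + gradDot F (y 0) (y 2) * (s 0 ^ 2 * s 2)
      + gradDot F (y 0) (y 3) * (s 0 ^ 2 * s 3) + gradDot F (y 1) (y 0) * (s 1 ^ 2 * s 0)
      + gradDot F (y 1) (y 2) * (s 1 ^ 2 * s 2) + gradDot F (y 1) (y 3) * (s 1 ^ 2 * s 3)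
      + gradDot F (y 2) (y 0) * (s 2 ^ 2 * s 0) + gradDot F (y 2) (y 1) * (s 2 ^ 2 * s 1)
      + gradDot F (y 2) (y 3) * (s 2 ^ 2 * s 3) + gradDot F (y 3) (y 0) * (s 3 ^ 2 * s 0)
      + gradDot F (y 3) (y 1) * (s 3 ^ 2 * s 1) + gradDot F (y 3) (y 2) * (s 3 ^ 2 * s 2)
      + tri F (y 1) (y 2) (y 3) * (s 1 * s 2 * s 3) + tri F (y 0) (y 2) (y 3) * (s 0 * s 2 * s 3)
      + tri F (y 0) (y 1) (y 3) * (s 0 * s 1 * s 3)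
      + tri F (y 0) (y 1) (y 2) * (s 0 * s 1 * s 2) := by
  rw [Fin.sum_univ_four]
  simp only [eval_add_eq hF, gradDot_add_left hF, gradDot_add_right, gradDot_smul_left hF,
    gradDot_smul_right, eval_smul_eq hF, tri_smul_left, tri_smul_mid, tri_smul_right,
    tri_add_left]
  ring

/-- On combinations of four vectors of `L_k`, the cubic divided by `p ^ k` is an integral cubic form
in the four coefficients, so it has a nontrivial zero modulo `p`. -/
theorem NoSmoothPoint.exists_sum_mem_lattice (hF : F.IsHomogeneous 3) (hp : p.Prime)
    (hbad : NoSmoothPoint F p) {k : ℕ} {y : Fin 4 → Fin n → ℤ}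
    (hy : ∀ i, y i ∈ hbad.lattice hF hp k) :
    ∃ s : Fin 4 → ℤ, (∃ i, (s i : ZMod p) ≠ 0) ∧
      ∑ i, s i • y i ∈ hbad.lattice hF hp (k + 1) := by
  have := Fact.mk hp
  choose a ha using fun i => hy i
  choose d hd using fun i j => hbad.dvd_gradDot hF hp k _ _ (hy i) (hy j)
  choose t ht using fun i j l => hbad.dvd_tri hF hp (hy i) (hy j) (hy l)
  obtain ⟨s, hs0, hs⟩ := exists_ne_zero_cubic_eq_zero (p := p) (fun i => (a i : ZMod p))
    (fun i j => (d i j : ZMod p))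
    ![(t 1 2 3 : ZMod p), (t 0 2 3 : ZMod p), (t 0 1 3 : ZMod p), (t 0 1 2 : ZMod p)]
  obtain ⟨i, hi⟩ := Function.ne_iff.1 hs0
  choose r hr using fun i => ZMod.intCast_surjective (s i)
  refine ⟨r, ⟨i, by rw [hr]; exact hi⟩, ?_⟩
  rw [NoSmoothPoint.mem_lattice, eval_sum_four hF]
  simp only [ha, hd, ht, mul_assoc ((p : ℤ) ^ k), ← mul_add]
  rw [pow_succ]
  refine mul_dvd_mul_left _ ((ZMod.intCast_zmod_eq_zero_iff_dvd _ p).1 ?_)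
  push_cast
  simp only [hr]
  simpa [mul_assoc] using hs

theorem natCard_le_of_forall_dependent {V : Type*} [AddCommGroup V] (hp : p.Prime) (d : ℕ)
    (htor : ∀ v : V, p • v = 0)
    (h : ∀ v : Fin (d + 1) → V, ∃ s : Fin (d + 1) → ℤ, (∃ i, (s i : ZMod p) ≠ 0) ∧
      ∑ i, s i • v i = 0) : Nat.card V ≤ p ^ d := by
  have := Fact.mk hp
  by_cases hfin : Finite V
  swap
  · have := not_finite_iff_infinite.1 hfin
    rw [Nat.card_eq_zero_of_infinite]
    exact Nat.zero_le _
  let _ : Module (ZMod p) V := AddCommGroup.zmodModule htor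
  have hfr : Module.finrank (ZMod p) V ≤ d := by
    by_contra! hd
    obtain ⟨v, hv⟩ := exists_linearIndependent_of_le_finrank (Nat.succ_le_of_lt hd)
    obtain ⟨s, ⟨i, hi⟩, hs⟩ := h v
    refine hi (Fintype.linearIndependent_iff.1 hv (fun i => (s i : ZMod p)) ?_ i)
    simpa only [Int.cast_smul_eq_zsmul] using hs
  have : Module.Finite (ZMod p) V := Module.Finite.of_finite
  rw [@Module.natCard_eq_pow_finrank (ZMod p) V _ _ _ this, Nat.card_zmod]
  exact Nat.pow_le_pow_right hp.pos hfr

/-- The quotient `L_k / L_{k+1}` is killed by `p`, because `F(p x) = p ^ 3 F(x)`, and any four of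
its elements are dependent over `ZMod p`. -/
theorem NoSmoothPoint.relIndex_le (hF : F.IsHomogeneous 3) (hp : p.Prime)
    (hbad : NoSmoothPoint F p) (k : ℕ) :
    (hbad.lattice hF hp (k + 1)).relIndex (hbad.lattice hF hp k) ≤ p ^ 3 := by
  set L := hbad.lattice hF hp k with hL
  set N := (hbad.lattice hF hp (k + 1)).addSubgroupOf L with hN
  change Nat.card (L ⧸ N) ≤ p ^ 3
  refine natCard_le_of_forall_dependent hp 3 (fun v => ?_) fun v => ?_
  · obtain ⟨⟨x, hx⟩, rfl⟩ := QuotientAddGroup.mk_surjective v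
    rw [← QuotientAddGroup.mk_nsmul, QuotientAddGroup.eq_zero_iff, hN,
      AddSubgroup.mem_addSubgroupOf]
    have hx' : (p : ℤ) ^ k ∣ eval x F := hx
    change (p : ℤ) ^ (k + 1) ∣ eval (p • x) F
    rw [← natCast_zsmul, eval_smul_eq hF, pow_succ', pow_succ' (p : ℤ) 2, mul_assoc]
    exact mul_dvd_mul_left _ (dvd_mul_of_dvd_right hx' _)
  · choose y hy using fun i => QuotientAddGroup.mk_surjective (v i)
    obtain ⟨s, hi, hs⟩ := hbad.exists_sum_mem_lattice hF hp (y := fun i => (y i : Fin n → ℤ))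
      fun i => (y i).2
    refine ⟨s, hi, ?_⟩
    have : ∑ i, s i • v i = QuotientAddGroup.mk' N (∑ i, s i • y i) := by
      rw [map_sum]
      refine Finset.sum_congr rfl fun i _ => ?_
      rw [map_zsmul, ← hy]
      rfl
    rw [this]
    refine (QuotientAddGroup.eq_zero_iff _).2 ?_
    rw [hN, AddSubgroup.mem_addSubgroupOf]
    simpa using hs

theorem NoSmoothPoint.index_le (hF : F.IsHomogeneous 3) (hp : p.Prime)
    (hbad : NoSmoothPoint F p) (k : ℕ) :
    (hbad.lattice hF hp k).index ≤ p ^ (3 * k) := by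
  induction k with
  | zero =>
    have : hbad.lattice hF hp 0 = ⊤ := by
      ext x
      simp [NoSmoothPoint.mem_lattice]
    simp [this]
  | succ k ih =>
    rw [← AddSubgroup.relIndex_mul_index (hbad.lattice_succ_le hF hp k)]
    calc _ ≤ p ^ 3 * p ^ (3 * k) := Nat.mul_le_mul (hbad.relIndex_le hF hp k) ih
      _ = _ := by ring

theorem finite_quotient_of_smul_mem {N : AddSubgroup (Fin n → ℤ)} {q : ℤ} (hq : q ≠ 0)
    (h : ∀ x, q • x ∈ N) : Finite ((Fin n → ℤ) ⧸ N.toIntSubmodule) := by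
  refine Module.finite_of_fg_torsion _ ?_
  intro v
  obtain ⟨x, rfl⟩ := Submodule.Quotient.mk_surjective _ v
  refine ⟨⟨q, mem_nonZeroDivisors_of_ne_zero hq⟩, ?_⟩
  change Submodule.Quotient.mk (q • x) = 0
  exact (Submodule.Quotient.mk_eq_zero _).2 (h x)

theorem NoSmoothPoint.smul_mem_lattice (hF : F.IsHomogeneous 3) (hp : p.Prime)
    (hbad : NoSmoothPoint F p) (e : ℕ) (x : Fin n → ℤ) :
    ((p : ℤ) ^ e) • x ∈ hbad.lattice hF hp (3 * e) := by
  rw [NoSmoothPoint.mem_lattice, eval_smul_eq hF, ← pow_mul, mul_comm e 3]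
  exact dvd_mul_right _ _

theorem NoSmoothPoint.finite_quotient (hF : F.IsHomogeneous 3) (hp : p.Prime)
    (hbad : NoSmoothPoint F p) (e : ℕ) :
    Finite ((Fin n → ℤ) ⧸ (hbad.lattice hF hp (3 * e)).toIntSubmodule) :=
  finite_quotient_of_smul_mem (pow_ne_zero e (by exact_mod_cast hp.ne_zero))
    (hbad.smul_mem_lattice hF hp e)

/-- Let the rows of `B` be a basis of `L_{3e}`. Since `p ^ e u` lies in `L_{3e}`, the trilinear form
at two basis vectors and `p ^ e u` is divisible by `p ^ (3e)`. Hence every entry of `B (hess F u)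
Bᵀ` is divisible by `p ^ (2e)`, and taking determinants gives the claim. -/
theorem NoSmoothPoint.pow_dvd_sq_index_mul_det (hF : F.IsHomogeneous 3) (hp : p.Prime)
    (hbad : NoSmoothPoint F p) (e : ℕ) (u : Fin n → ℤ) :
    (p ^ (2 * e)) ^ n ∣ (hbad.lattice hF hp (3 * e)).index ^ 2 * (hess F u).det.natAbs := by
  set L := hbad.lattice hF hp (3 * e) with hL
  have hp0 : (p : ℤ) ≠ 0 := by exact_mod_cast hp.ne_zero
  have hmem : ∀ x, ((p : ℤ) ^ e) • x ∈ L := hbad.smul_mem_lattice hF hp e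
  have hr : Module.finrank ℤ L.toIntSubmodule = n := by
    rw [(Submodule.finiteQuotient_iff _).1 (hbad.finite_quotient hF hp e), Module.finrank_fin_fun]
  let b : Module.Basis (Fin n) ℤ L := Module.finBasisOfFinrankEq ℤ L.toIntSubmodule hr
  let B : Matrix (Fin n) (Fin n) ℤ := Matrix.of fun i => (b i : Fin n → ℤ)
  have hB : L.index = B.det.natAbs := by
    rw [AddSubgroup.index_eq_natAbs_det (Pi.basisFun ℤ (Fin n)) L b, Pi.basisFun_det_apply]
  have hdvd : ∀ i j, ((p : ℤ) ^ (2 * e)) ∣ (B * hess F u * B.transpose) i j := by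
    intro i j
    have e1 : (B * hess F u * B.transpose) i j = tri F (b i) u (b j) := by
      rw [tri_eq_dotProduct, mul_assoc]
      rfl
    have e2 := hbad.dvd_tri hF hp (b i).2 (hmem u) (b j).2
    rw [tri_smul_mid, (by ring : 3 * e = e + 2 * e), pow_add] at e2
    rw [e1]
    exact Int.dvd_of_mul_dvd_mul_left (pow_ne_zero e hp0) e2
  choose M hM using hdvd
  have hM' : B * hess F u * B.transpose = ((p : ℤ) ^ (2 * e)) • Matrix.of M := by
    ext i j
    simp [hM]
  have hdet := congrArg Matrix.det hM'
  rw [Matrix.det_mul, Matrix.det_mul, Matrix.det_transpose, Matrix.det_smul,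
    Fintype.card_fin] at hdet
  have h3 : L.index ^ 2 * (hess F u).det.natAbs
      = (p ^ (2 * e)) ^ n * (Matrix.of M).det.natAbs := by
    rw [hB, ← Int.natAbs_pow, ← Int.natAbs_mul]
    have : B.det ^ 2 * (hess F u).det = ((p : ℤ) ^ (2 * e)) ^ n * (Matrix.of M).det := by
      rw [← hdet]; ring
    rw [this, Int.natAbs_mul, Int.natAbs_pow, Int.natAbs_pow, Int.natAbs_natCast]
  exact ⟨_, h3⟩

theorem not_noSmoothPoint (hn : 10 ≤ n) (hF : F.IsHomogeneous 3) (hp : p.Prime)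
    {u : Fin n → ℤ} (hu : (hess F u).det ≠ 0) : ¬ NoSmoothPoint F p := by
  intro hbad
  have hΔ : 0 < (hess F u).det.natAbs := Int.natAbs_pos.2 hu
  set D := (hess F u).det.natAbs with hD
  -- The exponent `e = D` is large enough: the bounds give `p ^ (20 e) ≤ p ^ (18 e) D`, whereas `p ^
  -- (2 D) > D`.
  have h1 := hbad.pow_dvd_sq_index_mul_det hF hp D u
  have h2 := hbad.index_le hF hp (3 * D)
  have hi : (hbad.lattice hF hp (3 * D)).index ≠ 0 := by
    have : Finite ((Fin n → ℤ) ⧸ hbad.lattice hF hp (3 * D)) := hbad.finite_quotient hF hp D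
    exact AddSubgroup.index_ne_zero_of_finite
  have h3 := Nat.le_of_dvd (by positivity) h1
  have h4 : p ^ (20 * D) ≤ p ^ (18 * D) * D := by
    calc p ^ (20 * D) ≤ (p ^ (2 * D)) ^ n := by
          rw [← pow_mul]
          refine Nat.pow_le_pow_right hp.pos ?_
          nlinarith
      _ ≤ _ := h3
      _ ≤ (p ^ (3 * (3 * D))) ^ 2 * D := by gcongr
      _ = _ := by rw [← pow_mul]; ring_nf
  have h5 : p ^ (20 * D) = p ^ (18 * D) * p ^ (2 * D) := by rw [← pow_add]; ring_nf
  rw [h5] at h4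
  have h6 := Nat.le_of_mul_le_mul_left h4 (pow_pos hp.pos _)
  have h7 : 2 * D < p ^ (2 * D) := Nat.lt_pow_self hp.one_lt
  omega

/-- Over each prime, the cubic has a point where it can be solved by Hensel lifting. -/
theorem exists_smooth_point (hn : 10 ≤ n) (hF : F.IsHomogeneous 3) (hp : p.Prime)
    {u : Fin n → ℤ} (hu : (hess F u).det ≠ 0) :
    ∃ (x : Fin n → ℤ) (l : ℕ) (j : Fin n), (p : ℤ) ^ (2 * l + 1) ∣ eval x F ∧
      ¬ (p : ℤ) ^ (l + 1) ∣ eval x (pderiv j F) := by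
  by_contra! h
  refine not_noSmoothPoint hn hF hp hu fun x l y hx => ?_
  exact Finset.dvd_sum fun j _ => dvd_mul_of_dvd_left (h x l j hx) _

end

/-! ### Local densities as limits of normalised counts of zeros. -/

theorem card_mul_sum_comp {G H : Type*} [AddCommGroup G] [AddCommGroup H] [Fintype G] [Fintype H]
    (f : G →+ H) (hf : Function.Surjective f) (φ : H → ℂ) :
    (Fintype.card H : ℂ) * ∑ g, φ (f g) = Fintype.card G * ∑ h, φ h := by
  have h1 : ∀ h, ∑ g, φ (f g + h) = ∑ g, φ (f g) := by
    intro h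
    obtain ⟨g₀, rfl⟩ := hf h
    rw [← Equiv.sum_comp (Equiv.addRight g₀) fun g => φ (f g)]
    simp
  have h2 : ∀ g, ∑ h, φ (f g + h) = ∑ h, φ h := fun g =>
    Equiv.sum_comp (Equiv.addLeft (f g)) φ
  calc (Fintype.card H : ℂ) * ∑ g, φ (f g) = ∑ h, ∑ g, φ (f g + h) := by
        simp [h1]
    _ = ∑ g, ∑ h, φ (f g + h) := Finset.sum_comm
    _ = _ := by simp [h2]

theorem expSum_mul_mul (F : MvPolynomial (Fin n) ℤ) (p q a : ℕ) [NeZero p] [NeZero q] :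
    expSum F (p * q) (p * a) = (p : ℂ) ^ n * expSum F q a := by
  rw [expSum_eq_charSum, expSum_eq_charSum]
  let f : (Fin n → ZMod (p * q)) →+ (Fin n → ZMod q) :=
    { toFun := fun x i => ZMod.castHom (dvd_mul_left q p) (ZMod q) (x i)
      map_zero' := by ext i; simp
      map_add' := fun x y => by ext i; simp }
  have hfc : ∀ y : Fin n → ℤ, f (fun i => (y i : ZMod (p * q))) = fun i => (y i : ZMod q) := by
    intro y
    ext i
    exact map_intCast (ZMod.castHom (dvd_mul_left q p) (ZMod q)) (y i)
  have hf : Function.Surjective f := by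
    intro x
    obtain ⟨y, rfl⟩ := exists_intCast_eq q x
    exact ⟨_, hfc y⟩
  have h := card_mul_sum_comp f hf fun x => ZMod.stdAddChar ((a : ZMod q) * aeval x F)
  have e : charSum F (p * q) ((p * a : ℕ) : ZMod (p * q))
      = ∑ g, ZMod.stdAddChar ((a : ZMod q) * aeval (f g) F) := by
    refine Finset.sum_congr rfl fun x _ => ?_
    obtain ⟨y, rfl⟩ := exists_intCast_eq (p * q) x
    rw [hfc, aeval_intCast, aeval_intCast, ← Int.cast_natCast (R := ZMod q) a,
      ← Int.cast_natCast (R := ZMod (p * q)) (p * a), ← Int.cast_mul, ← Int.cast_mul,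
      ZMod.stdAddChar_coe, ZMod.stdAddChar_coe]
    have hp0 : (p : ℂ) ≠ 0 := Nat.cast_ne_zero.2 (NeZero.ne p)
    have hq0 : (q : ℂ) ≠ 0 := Nat.cast_ne_zero.2 (NeZero.ne q)
    congr 1
    push_cast
    field_simp
  rw [← e] at h
  have hq0 : (q : ℂ) ^ n ≠ 0 := pow_ne_zero _ (Nat.cast_ne_zero.2 (NeZero.ne q))
  simp only [Fintype.card_fun, ZMod.card, Fintype.card_fin] at h
  push_cast at h ⊢
  rw [mul_pow] at h
  refine mul_left_cancel₀ hq0 ?_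
  rw [h, charSum]
  ring

/-- The normalised number of solutions of `F ≡ 0` modulo `q`, as an exponential sum. -/
noncomputable def densitySum (F : MvPolynomial (Fin n) ℤ) (q : ℕ) : ℂ :=
  ∑ a ∈ Finset.range q, expSum F q a / (q : ℂ) ^ n

/-- Residues modulo `p ^ (N + 1)` are either coprime to `p` or multiples `p a`, and the latter
reproduce the normalised sums modulo `p ^ N`. -/
theorem densitySum_prime_pow_succ (F : MvPolynomial (Fin n) ℤ) {p : ℕ} (hp : p.Prime) (N : ℕ) :
    densitySum F (p ^ (N + 1))
      = densitySum F (p ^ N) + localSum F (MonoidHom.id ℂ) (p ^ (N + 1)) := by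
  have : NeZero p := ⟨hp.ne_zero⟩
  have : NeZero (p ^ N) := ⟨pow_ne_zero _ hp.ne_zero⟩
  have hp0 : (p : ℂ) ≠ 0 := Nat.cast_ne_zero.2 hp.ne_zero
  rw [densitySum, ← Finset.sum_filter_add_sum_filter_not _ fun a => Nat.Coprime a (p ^ (N + 1)),
    add_comm]
  congr 1
  rw [densitySum]
  symm
  refine Finset.sum_bij' (fun a _ => p * a) (fun b _ => b / p) ?_ ?_ ?_ ?_ ?_
  · intro a ha
    rw [Finset.mem_range] at ha
    rw [Finset.mem_filter, Finset.mem_range, Nat.coprime_pow_right_iff (Nat.succ_pos N)]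
    refine ⟨?_, fun h => ?_⟩
    · rw [pow_succ']
      exact Nat.mul_lt_mul_of_pos_left ha hp.pos
    · exact hp.one_lt.ne' (Nat.Coprime.eq_one_of_dvd h.symm (dvd_mul_right _ _))
  · intro b hb
    rw [Finset.mem_filter, Finset.mem_range] at hb
    rw [Finset.mem_range]
    refine Nat.div_lt_of_lt_mul ?_
    rw [← pow_succ']
    exact hb.1
  · intro a _
    exact Nat.mul_div_cancel_left _ hp.pos
  · intro b hb
    rw [Finset.mem_filter, Nat.coprime_pow_right_iff (Nat.succ_pos N), Nat.coprime_comm,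
      hp.coprime_iff_not_dvd, not_not] at hb
    exact Nat.mul_div_cancel' hb.2
  · intro a _
    rw [pow_succ', expSum_mul_mul, Nat.cast_mul, mul_pow,
      mul_div_mul_left _ _ (pow_ne_zero n hp0)]

theorem sum_range_localSum_prime_pow (F : MvPolynomial (Fin n) ℤ) {p : ℕ} (hp : p.Prime) (N : ℕ) :
    ∑ k ∈ Finset.range (N + 1), localSum F (MonoidHom.id ℂ) (p ^ k) = densitySum F (p ^ N) := by
  induction N with
  | zero =>
    rw [zero_add, Finset.sum_range_one, pow_zero, localSum_one]
    simp [densitySum, expSum]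
  | succ N ih => rw [Finset.sum_range_succ, ih, densitySum_prime_pow_succ F hp]

/-- The number of solutions of `F ≡ 0` modulo `q`. -/
noncomputable def zeroCard (F : MvPolynomial (Fin n) ℤ) (q : ℕ) : ℕ :=
  Nat.card {x : Fin n → ZMod q // aeval x F = 0}

theorem densitySum_eq (F : MvPolynomial (Fin n) ℤ) (q : ℕ) [NeZero q] :
    densitySum F q = q * zeroCard F q / (q : ℂ) ^ n := by
  rw [densitySum, ← Finset.sum_div]
  congr 1
  have h1 : ∑ a ∈ Finset.range q, expSum F q a = ∑ a : ZMod q, charSum F q a := by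
    refine Finset.sum_bij' (fun a _ => (a : ZMod q)) (fun b _ => b.val) ?_ ?_ ?_ ?_ ?_
    · intro a _; exact Finset.mem_univ _
    · intro b _; exact Finset.mem_range.2 (ZMod.val_lt b)
    · intro a ha
      exact ZMod.val_cast_of_lt (Finset.mem_range.1 ha)
    · intro b _
      exact ZMod.natCast_zmod_val b
    · intro a _
      exact expSum_eq_charSum F q a
  rw [h1]
  unfold charSum
  rw [Finset.sum_comm]
  -- Orthogonality: summing over all `a` detects `F(x) = 0` modulo `q`.
  simp_rw [AddChar.sum_mulShift _ (ZMod.isPrimitive_stdAddChar q)]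
  classical
  simp only [Nat.cast_ite, Nat.cast_zero]
  rw [Finset.sum_ite, Finset.sum_const_zero, add_zero, Finset.sum_const, ZMod.card, nsmul_eq_mul,
    zeroCard, Nat.card_eq_fintype_card, Fintype.card_subtype, mul_comm]

/-- Moving by `s = p ^ l t` in the direction `j` extracts `p ^ (2l)` from every term, and leaves a
cubic in `t` with linear coefficient `d` prime to `p`. -/
theorem exists_eval_add_single_dvd {F : MvPolynomial (Fin n) ℤ} (hF : F.IsHomogeneous 3) {p : ℕ}
    (hp : p.Prime) {y : Fin n → ℤ} {l : ℕ} {j : Fin n} (hy : (p : ℤ) ^ (2 * l + 1) ∣ eval y F)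
    {d : ℤ} (hd : eval y (pderiv j F) = (p : ℤ) ^ l * d) (hpd : ¬ (p : ℤ) ∣ d) (m : ℕ) :
    ∃ s : ℤ, (p : ℤ) ^ (2 * l + 1 + m) ∣ eval (y + s • Pi.single j 1) F := by
  obtain ⟨f, hf⟩ := hy
  obtain ⟨t, -, w, hw⟩ := exists_dvd_cubic hp f d (gradDot F (Pi.single j 1) y)
    ((p : ℤ) ^ l * eval (Pi.single j 1) F) hpd m
  refine ⟨(p : ℤ) ^ l * t, w, ?_⟩
  rw [eval_add_smul hF, gradDot_single, hf, hd]
  linear_combination (p : ℤ) ^ (2 * l) * hw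

theorem exists_exact_smooth_point {F : MvPolynomial (Fin n) ℤ} {p : ℕ} {x : Fin n → ℤ} {l : ℕ}
    {j : Fin n} (hx : (p : ℤ) ^ (2 * l + 1) ∣ eval x F)
    (hj : ¬ (p : ℤ) ^ (l + 1) ∣ eval x (pderiv j F)) :
    ∃ (l' : ℕ) (d : ℤ), (p : ℤ) ^ (2 * l' + 1) ∣ eval x F ∧
      eval x (pderiv j F) = (p : ℤ) ^ l' * d ∧ ¬ (p : ℤ) ∣ d := by
  induction l with
  | zero => exact ⟨0, _, hx, by rw [pow_zero, one_mul], by simpa using hj⟩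
  | succ l ih =>
    by_cases h : (p : ℤ) ^ (l + 1) ∣ eval x (pderiv j F)
    · obtain ⟨d, hd⟩ := h
      refine ⟨l + 1, d, hx, hd, fun h => hj ?_⟩
      obtain ⟨d', rfl⟩ := h
      exact ⟨d', by rw [hd]; ring⟩
    · exact ih ((pow_dvd_pow _ (by omega)).trans hx) h

/-- Changing the coordinates other than `j` by multiples of `p ^ (2l + 1)` preserves the Hensel
hypotheses, and coordinate `j` can then be solved for. The `p ^ m` choices for each free coordinate
remain distinct modulo `p ^ (2l + 1 + m)`. -/
theorem pow_le_zeroCard {F : MvPolynomial (Fin n) ℤ} (hF : F.IsHomogeneous 3) {p : ℕ}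
    (hp : p.Prime) {x : Fin n → ℤ} {l : ℕ} {j : Fin n} (hx : (p : ℤ) ^ (2 * l + 1) ∣ eval x F)
    {d : ℤ} (hd : eval x (pderiv j F) = (p : ℤ) ^ l * d) (hpd : ¬ (p : ℤ) ∣ d) (m : ℕ) :
    (p ^ m) ^ (n - 1) ≤ zeroCard F (p ^ (2 * l + 1 + m)) := by
  have : NeZero (p ^ m) := ⟨pow_ne_zero _ hp.ne_zero⟩
  have : NeZero (p ^ (2 * l + 1 + m)) := ⟨pow_ne_zero _ hp.ne_zero⟩
  have key : ∀ z : {i // i ≠ j} → ZMod (p ^ m), ∃ w : Fin n → ℤ,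
      (p : ℤ) ^ (2 * l + 1 + m) ∣ eval w F ∧
      ∀ i : {i // i ≠ j}, w i = x i + (p : ℤ) ^ (2 * l + 1) * (z i).val := by
    intro z
    let v : Fin n → ℤ := fun i => if h : i ≠ j then ((z ⟨i, h⟩).val : ℤ) else 0
    have h1 : (p : ℤ) ^ (2 * l + 1) ∣ eval (x + (p : ℤ) ^ (2 * l + 1) • v) F := by
      rw [eval_add_smul hF, pow_two, pow_three, mul_assoc, mul_assoc, add_assoc, add_assoc]
      refine dvd_add hx (dvd_add (dvd_mul_right _ _) (dvd_add (dvd_mul_right _ _) ?_))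
      exact dvd_mul_right _ _
    have h2 : eval (x + (p : ℤ) ^ (2 * l + 1) • v) (pderiv j F)
        = (p : ℤ) ^ l * (d + p * ((p : ℤ) ^ l * (tri F x v (Pi.single j 1)
          + (p : ℤ) ^ (2 * l + 1) * gradDot F v (Pi.single j 1)))) := by
      rw [← gradDot_single, gradDot_add_left hF, gradDot_smul_left hF, tri_smul_mid,
        gradDot_single, hd]
      ring
    have h3 : ¬ (p : ℤ) ∣ d + p * ((p : ℤ) ^ l * (tri F x v (Pi.single j 1)
          + (p : ℤ) ^ (2 * l + 1) * gradDot F v (Pi.single j 1))) := by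
      rwa [dvd_add_left (dvd_mul_right _ _)]
    obtain ⟨s, hs⟩ := exists_eval_add_single_dvd hF hp h1 h2 h3 m
    refine ⟨_, hs, fun i => ?_⟩
    have hi : (Pi.single j (1 : ℤ) : Fin n → ℤ) i = 0 := Pi.single_eq_of_ne i.2 _
    simp only [Pi.add_apply, Pi.smul_apply, hi, smul_eq_mul, v]
    rw [dif_pos i.2]
    ring
  choose w hw hwz using key
  let f : ({i // i ≠ j} → ZMod (p ^ m)) →
      {x : Fin n → ZMod (p ^ (2 * l + 1 + m)) // aeval x F = 0} := fun z =>
    ⟨fun i => (w z i : ZMod (p ^ (2 * l + 1 + m))), by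
      rw [aeval_intCast, ZMod.intCast_zmod_eq_zero_iff_dvd]
      push_cast
      exact hw z⟩
  have hf : Function.Injective f := by
    intro z z' h
    funext i
    have h1 := congrFun (congrArg Subtype.val h) i
    change ((w z i : ℤ) : ZMod (p ^ (2 * l + 1 + m))) = (w z' i : ℤ) at h1
    rw [ZMod.intCast_eq_intCast_iff_dvd_sub, hwz, hwz] at h1
    push_cast at h1
    rw [add_sub_add_left_eq_sub, ← mul_sub, pow_add] at h1
    have h2 := Int.dvd_of_mul_dvd_mul_left
      (pow_ne_zero _ (by exact_mod_cast hp.ne_zero : (p : ℤ) ≠ 0)) h1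
    have h3 : (((z i).val : ℤ) : ZMod (p ^ m)) = ((z' i).val : ℤ) := by
      rw [ZMod.intCast_eq_intCast_iff_dvd_sub]
      push_cast
      exact h2
    simpa using h3
  have hcard := Nat.card_le_card_of_injective f hf
  rw [Nat.card_fun, Nat.card_zmod, Nat.card_eq_fintype_card, Fintype.card_subtype_compl,
    Fintype.card_fin, Fintype.card_subtype_eq] at hcard
  exact hcard

/-- The `p`-adic density of zeros is positive as soon as there is a smooth `p`-adic point. -/
theorem exists_pos_tsum_localSum_eq {F : MvPolynomial (Fin n) ℤ} (hF : F.IsHomogeneous 3) {p : ℕ}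
    (hp : p.Prime) (hs : Summable fun k => localSum F (MonoidHom.id ℂ) (p ^ k))
    (h : ∃ (x : Fin n → ℤ) (l : ℕ) (j : Fin n), (p : ℤ) ^ (2 * l + 1) ∣ eval x F ∧
      ¬ (p : ℤ) ^ (l + 1) ∣ eval x (pderiv j F)) :
    ∃ r : ℝ, 0 < r ∧ ∑' k, localSum F (MonoidHom.id ℂ) (p ^ k) = (r : ℂ) := by
  obtain ⟨x, l₀, j, hx, hj⟩ := h
  obtain ⟨l, d, hx, hd, hpd⟩ := exists_exact_smooth_point hx hj
  have hn : 1 ≤ n := by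
    have := j.2
    omega
  have hp0 : (0 : ℝ) < p := by exact_mod_cast hp.pos
  set A : ℕ → ℂ := fun k => localSum F (MonoidHom.id ℂ) (p ^ k) with hA
  let u : ℕ → ℝ := fun N => (p ^ N : ℕ) * zeroCard F (p ^ N) / ((p ^ N : ℕ) : ℝ) ^ n
  have hu : ∀ N, ∑ k ∈ Finset.range (N + 1), A k = (u N : ℂ) := by
    intro N
    have : NeZero (p ^ N) := ⟨pow_ne_zero _ hp.ne_zero⟩
    rw [sum_range_localSum_prime_pow F hp, densitySum_eq]
    simp only [u]
    push_cast
    rfl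
  have ht : Filter.Tendsto (fun N => (u N : ℂ)) Filter.atTop (nhds (∑' k, A k)) := by
    have := (Filter.tendsto_add_atTop_iff_nat 1).2 hs.hasSum.tendsto_sum_nat
    exact this.congr hu
  have hre : Filter.Tendsto u Filter.atTop (nhds (∑' k, A k).re) := by
    have := (Complex.continuous_re.tendsto _).comp ht
    exact this
  -- For `N = 2l + 1 + m` the powers of `p ^ m` cancel in `p ^ (N (1 - n)) · p ^ (m (n - 1))`, so
  -- the lower bound is independent of `m` and survives in the limit.
  have hlow : ∀ m, ((p : ℝ) ^ ((2 * l + 1) * (n - 1)))⁻¹ ≤ u (m + (2 * l + 1)) := by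
    intro m
    have h1 : ((p ^ m) ^ (n - 1) : ℝ) ≤ zeroCard F (p ^ (m + (2 * l + 1))) := by
      rw [add_comm m]
      exact_mod_cast pow_le_zeroCard hF hp hx hd hpd m
    simp only [u]
    push_cast
    rw [le_div_iff₀ (by positivity)]
    refine le_trans (le_of_eq ?_) (mul_le_mul_of_nonneg_left h1 (by positivity))
    obtain ⟨k, rfl⟩ := Nat.exists_eq_add_of_le hn
    rw [Nat.add_sub_cancel_left, inv_mul_eq_div, div_eq_iff (by positivity)]
    ring
  refine ⟨(∑' k, A k).re, ?_,
    tendsto_nhds_unique ht ((Complex.continuous_ofReal.tendsto _).comp hre)⟩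
  have hlim := (Filter.tendsto_add_atTop_iff_nat (2 * l + 1)).2 hre
  exact lt_of_lt_of_le (inv_pos.2 (pow_pos hp0 _)) (ge_of_tendsto' hlim hlow)

/-! ### The Euler product and positivity. -/

theorem norm_localSum_le (F : MvPolynomial (Fin n) ℤ) (q : ℕ) :
    ‖localSum F (MonoidHom.id ℂ) q‖ ≤ absSum F q :=
  norm_sum_le _ _

theorem norm_tsum_localSum_sub_one_le {F : MvPolynomial (Fin n) ℤ} {p : ℕ}
    (hs : Summable fun k => absSum F (p ^ k)) :
    ‖∑' k, localSum F (MonoidHom.id ℂ) (p ^ k) - 1‖ ≤ primeTail F p := by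
  have hA : Summable fun k => localSum F (MonoidHom.id ℂ) (p ^ k) :=
    hs.of_norm_bounded fun k => norm_localSum_le F _
  rw [hA.tsum_eq_zero_add, pow_zero, localSum_one, add_sub_cancel_left]
  exact tsum_of_norm_bounded ((summable_nat_add_iff 1).2 hs).hasSum fun k => norm_localSum_le F _

/-- Each Euler factor is a positive real within `primeTail F p` of 1. The logarithms are therefore
summable, and the product is the exponential of their sum. -/
theorem exists_pos_tsum_eq (hn : 10 ≤ n) {F : MvPolynomial (Fin n) ℤ}
    (hF : F.IsHomogeneous 3) (hgc : GeometricCondition F) :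
    ∃ s : ℝ, 0 < s ∧ ∑' q, localSum F (MonoidHom.id ℂ) q = (s : ℂ) := by
  have hsum : Summable fun q => ‖localSum F (MonoidHom.id ℂ) q‖ :=
    Summable.of_nonneg_of_le (fun _ => norm_nonneg _) (norm_localSum_le F)
      (summable_absSum hn hF hgc)
  obtain ⟨u, hu⟩ := exists_det_hess_ne_zero hgc
  have hpp : ∀ p : Nat.Primes, Summable fun k => absSum F ((p : ℕ) ^ k) := fun p =>
    summable_absSum_prime_pow hn hF hgc p.2
  choose r hr0 hr using fun p : Nat.Primes => exists_pos_tsum_localSum_eq hF p.2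
    ((hpp p).of_norm_bounded fun k => norm_localSum_le F _) (exists_smooth_point hn hF p.2 hu)
  have hr1 : Summable fun p => r p - 1 := by
    have h1 : Summable fun p : Nat.Primes => primeTail F p := by
      refine ((summable_primeTail hn hF hgc).comp_injective Subtype.val_injective).congr fun p => ?_
      simp [p.2]
    refine h1.of_norm_bounded fun p => ?_
    have h2 := norm_tsum_localSum_sub_one_le (hpp p)
    rw [hr, ← Complex.ofReal_one, ← Complex.ofReal_sub, Complex.norm_real] at h2
    exact h2
  have hlog := Real.summable_log_one_add_of_summable hr1
  simp only [add_sub_cancel] at hlog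
  have hprod := Real.hasProd_of_hasSum_log hr0 hlog.hasSum
  have hprodC := hprod.map Complex.ofRealHom Complex.continuous_ofReal
  have heuler := EulerProduct.eulerProduct_hasProd (f := localSum F (MonoidHom.id ℂ))
    (localSum_one F _) (fun h => localSum_mul F _ h) hsum (localSum_zero F _)
  simp only [hr] at heuler
  exact ⟨_, Real.exp_pos _, heuler.unique hprodC⟩

theorem hasSum_pnat {E : Type*} [AddCommMonoid E] [TopologicalSpace E] {f : ℕ → E} {a : E}
    (hf : HasSum f a) (h0 : f 0 = 0) : HasSum (fun q : ℕ+ => f q) a := by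
  refine (Function.Injective.hasSum_iff PNat.coe_injective fun q hq => ?_).2 hf
  rcases Nat.eq_zero_or_pos q with rfl | h
  · exact h0
  · exact absurd ⟨⟨q, h⟩, rfl⟩ hq

end CubicForm

theorem theorem1 (n : ℕ) (hn : 10 ≤ n) (F : MvPolynomial (Fin n) ℤ) (hF : F.IsHomogeneous 3)
    (hgc : CubicForm.GeometricCondition F) :
    (Summable fun q : ℕ+ =>
      ∑ a ∈ CubicForm.reducedResidues q, ‖CubicForm.expSum F q a / ((q : ℕ) : ℂ) ^ n‖) ∧
    ∃ s : ℝ, 0 < s ∧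
      HasSum (fun q : ℕ+ =>
        ∑ a ∈ CubicForm.reducedResidues q, CubicForm.expSum F q a / ((q : ℕ) : ℂ) ^ n) (s : ℂ) := by
  have habs := CubicForm.summable_absSum hn hF hgc
  obtain ⟨s, hs0, hs⟩ := CubicForm.exists_pos_tsum_eq hn hF hgc
  refine ⟨(CubicForm.hasSum_pnat habs.hasSum (CubicForm.absSum_zero F)).summable, s, hs0, ?_⟩
  rw [← hs]
  exact CubicForm.hasSum_pnat (f := CubicForm.localSum F (MonoidHom.id ℂ))
    (habs.of_norm_bounded (CubicForm.norm_localSum_le F)).hasSum (CubicForm.localSum_zero F _)
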